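/- Let $\mathbb{F}_q$ be a fixed finite field. A representation $\pi$ over a field $\mathbb{F}$ of a finite quiver with vertex set $V$ and arrow set $E$ (multiple arrows are allowed, and loops too) consists of finite-dimensional vector spaces $U_v$, $v\in V$, and linear maps $\pi_e : U_v\to U_w$, one for each arrow $e: v\to w$. It is indecomposable if it is not isomorphic to a direct sum of two non-zero representations, and absolutely indecomposable if $\overline{\mathbb{F}}\otimes_{\mathbb{F}}\pi$ is indecomposable over the algebraic closure $\overline{\mathbb{F}}$. Then: 1. There is an algorithm (a program for the unit-cost random access machine with addition and truncated subtraction, without multiplication) which, given as input a finite quiver and a representation $\pi$ of it over $\mathbb{F}_q$ with $U_v=\mathbb{F}_q^{n_v}$ (the lists of the $n_v$, of the sources and targets of the arrows, and of the entries of the matrices of the maps), decides whether $\pi$ is absolutely indecomposable or not, in time polynomial in $N=\sum_{v} n_v$ up to a linear factor for the size of the quiver: there is a polynomial $p$, depending only on $\mathbb{F}_q$ (and on the numbering of its elements by $0,\dots,q-1$), such that the algorithm halts after at most $p(N)\,(1+|V|+|E|)$ steps on every input. 2. For every such $\pi$ and every basis $a_1,\dots,a_m$ of the algebra $\operatorname{End}\pi\subset\operatorname{End}_{\mathbb{F}_q}U$,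 where $U=\bigoplus_v U_v$, the representation $\pi$ is absolutely indecomposable if and only if for each $i$ there is $\gamma_i\in\mathbb{F}_q$ with $\det_U(\lambda I_N+a_i)=(\lambda+\gamma_i)^N$, and the lower central series of the Lie algebra $(\operatorname{End}\pi)_-$ (that is, $\operatorname{End}\pi$ with the bracket $[a,b]=ab-ba$) reaches zero. -/

import Mathlib

open scoped TensorProduct

/-! ## Representations of quivers -/

universe u v w k l

/-! An associative algebra is regarded as a Lie algebra with the commutator as its bracket. -/
attribute [local instance] LieRing.ofAssociativeRing

/-- A (finite-dimensional) representation over a field `K` of a quiver with vertex set `V`. -/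
structure QuiverRep (V : Type u) [Quiver.{v} V] (K : Type k) [Field K] where
  /-- the vector space at a vertex -/
  space : V → Type w
  [addCommGroup : ∀ i, AddCommGroup (space i)]
  [module : ∀ i, Module K (space i)]
  [finite : ∀ i, FiniteDimensional K (space i)]
  /-- the linear map at an arrow -/
  map : ∀ {i j : V}, (i ⟶ j) → (space i →ₗ[K] space j)

namespace QuiverRep

attribute [instance] QuiverRep.addCommGroup QuiverRep.module QuiverRep.finite

section

variable {V : Type u} [Quiver.{v} V] {K : Type k} [Field K]

/-- An isomorphism of representations: linear isomorphisms at the vertices that intertwine the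
maps at all arrows. -/
structure Iso (ρ σ : QuiverRep.{u, v, w, k} V K) where
  /-- the linear isomorphism at a vertex -/
  equiv : ∀ i, ρ.space i ≃ₗ[K] σ.space i
  comm : ∀ {i j : V} (e : i ⟶ j) (x : ρ.space i), equiv j (ρ.map e x) = σ.map e (equiv i x)

/-- The direct sum of two representations. -/
def directSum (ρ σ : QuiverRep.{u, v, w, k} V K) : QuiverRep.{u, v, w, k} V K where
  space i := ρ.space i × σ.space i
  map e := (ρ.map e).prodMap (σ.map e)

/-- A representation is non-zero if one of its vector spaces is. -/
def IsNonzero (ρ : QuiverRep.{u, v, w, k} V K) : Prop :=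
  ∃ i, Nontrivial (ρ.space i)

/-- A representation is indecomposable if it is not isomorphic to a direct sum of two non-zero
representations. -/
def IsIndecomposable (ρ : QuiverRep.{u, v, w, k} V K) : Prop :=
  ¬ ∃ ρ₁ ρ₂ : QuiverRep.{u, v, w, k} V K,
    ρ₁.IsNonzero ∧ ρ₂.IsNonzero ∧ Nonempty (Iso ρ (ρ₁.directSum ρ₂))

/-- Extension of scalars from `K` to an extension field `L`. -/
noncomputable def baseChange (ρ : QuiverRep.{u, v, w, k} V K) (L : Type l) [Field L]
    [Algebra K L] : QuiverRep.{u, v, max l w, l} V L where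
  space i := L ⊗[K] ρ.space i
  map e := (ρ.map e).baseChange L

/-- A representation is absolutely indecomposable if it is indecomposable over the algebraic
closure of the ground field. -/
def IsAbsolutelyIndecomposable (ρ : QuiverRep.{u, v, w, k} V K) : Prop :=
  (ρ.baseChange (AlgebraicClosure K)).IsIndecomposable

/-- The algebra of endomorphisms of a representation, as a subalgebra of the algebra of all
endomorphisms of the direct sum of its vector spaces (the vertex set is finite in the
applications): the block diagonal endomorphisms whose blocks commute with the maps at all
arrows. -/
def endAlgebra (ρ : QuiverRep.{u, v, w, k} V K) :
    Subalgebra K (Module.End K (∀ i, ρ.space i)) where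
  carrier := {a | ∃ f : ∀ i, Module.End K (ρ.space i),
    (∀ (i j : V) (e : i ⟶ j), f j ∘ₗ ρ.map e = ρ.map e ∘ₗ f i) ∧
      ∀ (x : ∀ i, ρ.space i) (i : V), a x i = f i (x i)}
  mul_mem' := by
    rintro a b ⟨f, hf, ha⟩ ⟨g, hg, hb⟩
    refine ⟨fun i => f i * g i, fun i j e => ?_, fun x i => by simp [ha, hb]⟩
    ext x
    have h1 := LinearMap.congr_fun (hg i j e) x
    have h2 := LinearMap.congr_fun (hf i j e) (g i x)
    simp only [LinearMap.comp_apply] at h1 h2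
    simp [h1, h2]
  add_mem' := by
    rintro a b ⟨f, hf, ha⟩ ⟨g, hg, hb⟩
    refine ⟨fun i => f i + g i, fun i j e => ?_, fun x i => by simp [ha, hb]⟩
    rw [LinearMap.add_comp, LinearMap.comp_add, hf, hg]
  algebraMap_mem' := by
    intro c
    refine ⟨fun i => algebraMap K _ c, fun i j e => ?_, fun x i => by simp⟩
    ext x
    simp

end

end QuiverRep

/-! ## Representations given by matrices -/

/-- A finite quiver (multiple arrows and loops are allowed), with vertices and arrows numbered,
given by the source and the target of every arrow. -/
structure QuiverData where
  /-- the number of vertices -/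
  numVertices : ℕ
  /-- the number of arrows -/
  numArrows : ℕ
  /-- the source of an arrow -/
  src : Fin numArrows → Fin numVertices
  /-- the target of an arrow -/
  tgt : Fin numArrows → Fin numVertices

namespace QuiverData

/-- The vertices of the quiver. (A separate type, since `Fin n` itself already carries the quiver
structure that comes from its order.) -/
@[ext]
structure Vertex (Q : QuiverData) where
  /-- the number of the vertex -/
  index : Fin Q.numVertices

/-- The vertices and their numbers. -/
def vertexEquiv (Q : QuiverData) : Fin Q.numVertices ≃ Q.Vertex where
  toFun i := ⟨i⟩
  invFun i := i.index

instance (Q : QuiverData) : Fintype Q.Vertex := Fintype.ofEquiv _ Q.vertexEquiv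

instance (Q : QuiverData) : DecidableEq Q.Vertex := Q.vertexEquiv.symm.decidableEq

instance (Q : QuiverData) : Quiver Q.Vertex where
  Hom i j := {e : Fin Q.numArrows // Q.src e = i.index ∧ Q.tgt e = j.index}

end QuiverData

/-- A quiver together with a representation of it over `F` in which the vector space at the
vertex `i` is `F ^ dim i`: one matrix for every arrow. -/
structure MatrixRep (F : Type k) where
  /-- the quiver -/
  quiver : QuiverData
  /-- the dimensions of the vector spaces at the vertices -/
  dim : Fin quiver.numVertices → ℕ
  /-- the matrices of the maps at the arrows -/
  mat : ∀ e : Fin quiver.numArrows,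
    Matrix (Fin (dim (quiver.tgt e))) (Fin (dim (quiver.src e))) F

namespace MatrixRep

section

variable {F : Type k}

/-- The sum of the dimensions of the vector spaces at all vertices. -/
def totalDim (π : MatrixRep F) : ℕ := ∑ i, π.dim i

/-- The representation that is described by the matrices. -/
def toRep [Field F] (π : MatrixRep F) : QuiverRep.{0, 0, k, k} π.quiver.Vertex F where
  space i := Fin (π.dim i.index) → F
  map {i j} a :=
    match i, j, a with
    | ⟨_⟩, ⟨_⟩, ⟨e, rfl, rfl⟩ => Matrix.toLin' (π.mat e)

/-- The entries of all matrices, arrow by arrow and row by row, where `code` numbers the elements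
of the field. -/
def entries {q : ℕ} (code : F ≃ Fin q) (π : MatrixRep F) : List ℕ :=
  (List.finRange π.quiver.numArrows).flatMap fun e =>
    (List.finRange (π.dim (π.quiver.tgt e))).flatMap fun i =>
      (List.finRange (π.dim (π.quiver.src e))).map fun j => (code (π.mat e i j) : ℕ)

end

end MatrixRep

/-! ## Random access machines

The unit-cost random access machine with addition and truncated subtraction (and without
multiplication), which is polynomially equivalent to the Turing machine. A program mentions
finitely many registers and finitely many memories; every memory is an infinite array of natural
numbers, which is accessed by indirect addressing. -/

namespace RAM

/-- The content of the registers `reg x` and of the cells `mem a n` of the memories. -/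
@[ext]
structure State where
  /-- the content of a register -/
  reg : ℕ → ℕ
  /-- the content of a cell of a memory -/
  mem : ℕ → ℕ → ℕ

/-- Programs. -/
inductive Program where
  /-- `reg x := c` -/
  | const (x c : ℕ) : Program
  /-- `reg x := reg y` -/
  | copy (x y : ℕ) : Program
  /-- `reg x := reg y + reg z` -/
  | add (x y z : ℕ) : Program
  /-- `reg x := max (reg y - reg z) 0` -/
  | sub (x y z : ℕ) : Program
  /-- `reg x := mem a (reg y)` -/
  | load (x a y : ℕ) : Program
  /-- `mem a (reg x) := reg y` -/
  | store (a x y : ℕ) : Program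
  /-- one program after the other -/
  | seq (P Q : Program) : Program
  /-- if `reg x` is not zero then `P`, else `Q` -/
  | branch (x : ℕ) (P Q : Program) : Program
  /-- as long as `reg x` is not zero, `P` -/
  | loop (x : ℕ) (P : Program) : Program

/-- Set a register. -/
def State.setReg (s : State) (x n : ℕ) : State :=
  { s with reg := Function.update s.reg x n }

/-- Set a cell of a memory. -/
def State.setMem (s : State) (a i n : ℕ) : State :=
  { s with mem := Function.update s.mem a (Function.update (s.mem a) i n) }

/-- `Exec P s s' t`: started in the state `s`, the program `P` halts in the state `s'` after `t`
steps. Every instruction and every test of a register takes one step. -/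
inductive Exec : Program → State → State → ℕ → Prop where
  | const (s : State) (x c : ℕ) : Exec (.const x c) s (s.setReg x c) 1
  | copy (s : State) (x y : ℕ) : Exec (.copy x y) s (s.setReg x (s.reg y)) 1
  | add (s : State) (x y z : ℕ) : Exec (.add x y z) s (s.setReg x (s.reg y + s.reg z)) 1
  | sub (s : State) (x y z : ℕ) : Exec (.sub x y z) s (s.setReg x (s.reg y - s.reg z)) 1
  | load (s : State) (x a y : ℕ) : Exec (.load x a y) s (s.setReg x (s.mem a (s.reg y))) 1
  | store (s : State) (a x y : ℕ) : Exec (.store a x y) s (s.setMem a (s.reg x) (s.reg y)) 1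
  | seq {P Q : Program} {s s' s'' : State} {t t' : ℕ} (h : Exec P s s' t)
      (h' : Exec Q s' s'' t') : Exec (.seq P Q) s s'' (t + t')
  | branch_pos {x : ℕ} {P Q : Program} {s s' : State} {t : ℕ} (hx : s.reg x ≠ 0)
      (h : Exec P s s' t) : Exec (.branch x P Q) s s' (t + 1)
  | branch_zero {x : ℕ} {P Q : Program} {s s' : State} {t : ℕ} (hx : s.reg x = 0)
      (h : Exec Q s s' t) : Exec (.branch x P Q) s s' (t + 1)
  | loop_pos {x : ℕ} {P : Program} {s s' s'' : State} {t t' : ℕ} (hx : s.reg x ≠ 0)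
      (h : Exec P s s' t) (h' : Exec (.loop x P) s' s'' t') :
      Exec (.loop x P) s s'' (t + t' + 1)
  | loop_zero {x : ℕ} {P : Program} {s : State} (hx : s.reg x = 0) : Exec (.loop x P) s s 1

/-- Programs are deterministic: the final state and the running time are determined by the initial
state. -/
theorem Exec.deterministic {P : Program} {s s₁ s₂ : State} {t₁ t₂ : ℕ} (h₁ : Exec P s s₁ t₁)
    (h₂ : Exec P s s₂ t₂) : s₁ = s₂ ∧ t₁ = t₂ := by
  induction h₁ generalizing s₂ t₂ with
  | seq _ _ ih ih' =>
    cases h₂ with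
    | seq g g' =>
      obtain ⟨rfl, rfl⟩ := ih g
      obtain ⟨rfl, rfl⟩ := ih' g'
      exact ⟨rfl, rfl⟩
  | branch_pos hx _ ih =>
    cases h₂ with
    | branch_pos _ g => obtain ⟨rfl, rfl⟩ := ih g; exact ⟨rfl, rfl⟩
    | branch_zero hx' _ => exact absurd hx' hx
  | branch_zero hx _ ih =>
    cases h₂ with
    | branch_pos hx' _ => exact absurd hx hx'
    | branch_zero _ g => obtain ⟨rfl, rfl⟩ := ih g; exact ⟨rfl, rfl⟩
  | loop_pos hx _ _ ih ih' =>
    cases h₂ with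
    | loop_pos _ g g' =>
      obtain ⟨rfl, rfl⟩ := ih g
      obtain ⟨rfl, rfl⟩ := ih' g'
      exact ⟨rfl, rfl⟩
    | loop_zero hx' => exact absurd hx' hx
  | loop_zero hx =>
    cases h₂ with
    | loop_pos hx' _ _ => exact absurd hx hx'
    | loop_zero _ => exact ⟨rfl, rfl⟩
  | _ => cases h₂; exact ⟨rfl, rfl⟩

end RAM

/-- The initial state of the machine on the input `π`: registers `0` and `1` hold the numbers of
vertices and arrows, memory `0` the dimensions, memories `1` and `2` the sources and the targets of
the arrows, memory `3` the entries of the matrices; all other registers and cells hold `0`. -/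
def MatrixRep.initialState {F : Type k} {q : ℕ} (code : F ≃ Fin q) (π : MatrixRep F) :
    RAM.State where
  reg
    | 0 => π.quiver.numVertices
    | 1 => π.quiver.numArrows
    | _ => 0
  mem
    | 0 => fun n => (List.ofFn π.dim).getD n 0
    | 1 => fun n => (List.ofFn fun e => (π.quiver.src e : ℕ)).getD n 0
    | 2 => fun n => (List.ofFn fun e => (π.quiver.tgt e : ℕ)).getD n 0
    | 3 => fun n => (π.entries code).getD n 0
    | _ => fun _ => 0

/-!
Both parts rest on one criterion. Call an algebra over a field `F` *scalar plus nilpotent* if each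
of its elements is the sum of a scalar and a nilpotent element (`IsScalarPlusNilpotent`). Over a
finite field, a representation is absolutely indecomposable iff its endomorphism algebra is scalar
plus nilpotent (`QuiverRep.isAbsolutelyIndecomposable_iff`). If it is absolutely indecomposable,
Fitting's lemma over the algebraic closure shows that each endomorphism has a single eigenvalue `μ`;
a `q ^ s`-th power of the endomorphism is then the scalar `μ ^ q ^ s`, which therefore lies in `F`
and, since Frobenius is bijective on `F`, differs from the endomorphism by a nilpotent. Conversely,
write the projection onto a direct summand over the algebraic closure in a basis of this field
extension: its coordinates are endomorphisms over `F`, that is, scalars plus elements of the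
radical, so that the projection is a scalar plus a nilpotent and has only one eigenvalue.

*Second part.* That the characteristic polynomial of `-a` is `(X + γ) ^ N` means that `a - γ` is
nilpotent. If the algebra is scalar plus nilpotent, then it is Lie nilpotent by Engel's theorem.
Conversely, a Lie nilpotent algebra acts on each simple module through a commutative quotient
(`lie_mem_annihilatorLieIdeal`), where nilpotent elements act as zero. So the nilpotent elements lie
in the radical, and it suffices to consider the elements of a basis.

*First part.* The algorithm computes a spanning set `A i` of the endomorphism algebra, as the matrices
that commute with all arrows and with the projections to the vertices, by imposing one linear
equation at a time; from each `A i` it subtracts the scalar `γ i` which is the only candidate for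
`A i - γ i` to be nilpotent; it then applies all the `A i - γ i` to the whole space, `N` times, and
answers whether this leads to zero (`isScalarPlusNilpotent_iff_iterate`). If the algebra is scalar
plus nilpotent, then the `A i - γ i` lie in the nilpotent radical; conversely, if `N`-fold products
of the `A i - γ i` vanish, then all elements of their span are nilpotent.

The number of vectors in a spanning set never changes: elimination replaces a spanning set by an
equally long one, in which vectors may vanish (`span_eliminate`), and images are computed as double
orthogonal complements. All loops thus have lengths that are known in advance. The algorithm
is written in a small language of loop programs (`RAM.Exp`, `RAM.Cmd`), in which its correctness is a
matter of evaluation, and a compiler to the random access machine is proved correct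
(`RAM.Cmd.realizes`) with a bound for the running time that is read off from the lengths of the
loops. Only the outermost loops run over the vertices and the arrows, whence the linear factor
(`RAM.Cmd.cost_le_of_outer`).
-/

/-! ### Algebras whose elements are scalar plus nilpotent -/

/-- Every element of the algebra is the sum of a scalar and a nilpotent element. For a
finite-dimensional algebra this says that it is zero or local with residue field `K`. -/
def IsScalarPlusNilpotent (K : Type*) (A : Type*) [Field K] [Ring A] [Algebra K A] : Prop :=
  ∀ x : A, ∃ c : K, IsNilpotent (x - algebraMap K A c)

section Radical

variable {K A : Type*} [Field K] [Ring A] [Algebra K A]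

/-- If `a * b` is a unit, then `b` has a left inverse `c`, and `c ^ k * b ^ k = 1` for all `k`. -/
theorem not_isUnit_mul_of_isNilpotent [Nontrivial A] {a b : A} (hb : IsNilpotent b) :
    ¬ IsUnit (a * b) := by
  rintro ⟨u, hu⟩
  obtain ⟨n, hn⟩ := hb
  have h1 : (↑u⁻¹ * a) * b = 1 := by rw [mul_assoc, ← hu]; simp
  have h : ∀ k, (↑u⁻¹ * a) ^ k * b ^ k = 1 := by
    intro k
    induction k with
    | zero => simp
    | succ k ih =>
      rw [pow_succ, pow_succ', mul_assoc, ← mul_assoc _ b, h1, one_mul, ih]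
  have := h n
  rw [hn, mul_zero] at this
  exact zero_ne_one this

/-- If all elements are scalar plus nilpotent, the nilpotent ones lie in the Jacobson radical:
otherwise some multiple `a * b` of a nilpotent `b` is congruent to `1` modulo a maximal left ideal,
but `a * b` is not a unit, hence nilpotent. -/
theorem IsScalarPlusNilpotent.mem_jacobson (h : IsScalarPlusNilpotent K A) {b : A}
    (hb : IsNilpotent b) : b ∈ Ring.jacobson A := by
  rw [Ring.jacobson_eq_sInf_isMaximal, Submodule.mem_sInf]
  intro I hI
  have hI : Ideal.IsMaximal I := hI
  by_contra hbI
  have hnt : Nontrivial A := by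
    by_contra hn
    rw [not_nontrivial_iff_subsingleton] at hn
    exact hbI (by rw [Subsingleton.elim b 0]; exact I.zero_mem)
  obtain ⟨a, i, hi, hab⟩ : ∃ a, ∃ i ∈ I, a * b + i = 1 := by
    have := hI.exists_inv hbI
    obtain ⟨a, i, hi, h⟩ := this
    exact ⟨a, i, hi, h⟩
  have hnu := not_isUnit_mul_of_isNilpotent (a := a) hb
  obtain ⟨c, hc⟩ := h (a * b)
  by_cases hc0 : c = 0
  · subst hc0
    rw [map_zero, sub_zero] at hc
    have : IsUnit i := by
      have := hc.isUnit_one_sub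
      rwa [← hab, add_sub_cancel_left] at this
    exact hI.ne_top (Ideal.eq_top_of_isUnit_mem I hi this)
  · apply hnu
    have hu : IsUnit (algebraMap K A c) := (IsUnit.mk0 c hc0).map _
    have := hc.isUnit_add_left_of_commute hu (Algebra.commute_algebraMap_right c _)
    simpa using this

end Radical

section LieNilpotent

variable {K A : Type*} [Field K] [Ring A] [Algebra K A]

/-- The elements that act as zero on a module, as a Lie ideal. -/
def annihilatorLieIdeal (K A S : Type*) [Field K] [Ring A] [Algebra K A] [AddCommGroup S]
    [Module A S] : LieSubmodule K A A where
  carrier := {r | ∀ s : S, r • s = 0}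
  zero_mem' := by simp
  add_mem' := by
    intro a b ha hb s
    rw [add_smul, ha, hb, add_zero]
  smul_mem' := by
    intro c x hx s
    rw [Algebra.smul_def, mul_smul, hx, smul_zero]
  lie_mem := by
    intro x m hm s
    change (x * m - m * x) • s = 0
    rw [sub_smul, mul_smul, mul_smul, hm, hm, smul_zero, sub_zero]

/-- An element which commutes with everything modulo the annihilator of a simple module acts on
that module injectively or as zero. -/
theorem smul_injective_or_eq_zero {S : Type*} [AddCommGroup S] [Module A S] [IsSimpleModule A S]
    {z : A} (hz : ∀ (w : A) (s : S), w • z • s = z • w • s) :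
    (∀ s : S, z • s = 0 → s = 0) ∨ ∀ s : S, z • s = 0 := by
  let N : Submodule A S :=
    { carrier := {s | z • s = 0}
      zero_mem' := by simp
      add_mem' := by
        intro a b ha hb
        change z • (a + b) = 0
        rw [smul_add, show z • a = 0 from ha, show z • b = 0 from hb, add_zero]
      smul_mem' := by
        intro c s hs
        change z • c • s = 0
        rw [← hz, show z • s = 0 from hs, smul_zero] }
  rcases eq_bot_or_eq_top N with h | h
  · left
    intro s hs
    have : s ∈ N := hs
    rwa [h, Submodule.mem_bot] at this
  · right
    intro s
    have : s ∈ N := by rw [h]; trivial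
    exact this

/-- A Lie nilpotent algebra acts on a simple module through a commutative quotient: a commutator
`z = [x, y]` that acts by a nonzero central operator would act invertibly, and
`(ad (x y)) ^ k y = z ^ k y` could not vanish. -/
theorem lie_mem_annihilatorLieIdeal {S : Type*} [AddCommGroup S] [Module A S] [IsSimpleModule A S]
    (hA : LieRing.IsNilpotent A) (x y : A) : ⁅x, y⁆ ∈ annihilatorLieIdeal K A S := by
  obtain ⟨m, hm⟩ := LieModule.exists_forall_pow_toEnd_eq_zero K A A
  obtain ⟨n, hn⟩ := (LieModule.isNilpotent_iff K A A).mp hA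
  have step : ∀ j, LieModule.lowerCentralSeries K A A (j + 2) ≤ annihilatorLieIdeal K A S →
      LieModule.lowerCentralSeries K A A (j + 1) ≤ annihilatorLieIdeal K A S := by
    intro j hj
    conv_lhs => rw [LieModule.lowerCentralSeries_succ]
    rw [LieSubmodule.lie_le_iff]
    intro x _ y hy
    set z := ⁅x, y⁆ with hz
    -- `⁅w, z⁆` lies in the next term of the series, so `z` acts by a central operator
    have hcomm : ∀ (w : A) (s : S), w • z • s = z • w • s := by
      intro w s
      have h1 : ⁅w, z⁆ ∈ annihilatorLieIdeal K A S := by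
        apply hj
        rw [LieModule.lowerCentralSeries_succ, LieModule.lowerCentralSeries_succ]
        exact LieSubmodule.lie_mem_lie (LieSubmodule.mem_top w)
          (LieSubmodule.lie_mem_lie (LieSubmodule.mem_top x) hy)
      have h2 := h1 s
      rw [LieRing.of_associative_ring_bracket, sub_smul, mul_smul, mul_smul, sub_eq_zero] at h2
      exact h2
    rcases smul_injective_or_eq_zero hcomm with hinj | h0
    · have hinjp : ∀ k (s : S), z ^ k • s = 0 → s = 0 := by
        intro k
        induction k with
        | zero => simp
        | succ k ih =>
          intro s hs
          rw [pow_succ', mul_smul] at hs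
          exact ih s (hinj _ hs)
      have hcommp : ∀ k (w : A) (s : S), w • z ^ k • s = z ^ k • w • s := by
        intro k
        induction k with
        | zero => simp
        | succ k ih =>
          intro w s
          rw [pow_succ, mul_smul, mul_smul, ih, hcomm]
      have had : ∀ k (s : S), ((LieModule.toEnd K A A (x * y) ^ k) y) • s = z ^ k • y • s := by
        intro k
        induction k with
        | zero => simp
        | succ k ih =>
          intro s
          rw [pow_succ', Module.End.mul_apply, LieModule.toEnd_apply_apply,
            LieRing.of_associative_ring_bracket, sub_smul, mul_smul (x * y), mul_smul _ (x * y), ih,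
            ih, hcommp, ← smul_sub, ← mul_smul, ← mul_smul, ← sub_smul, pow_succ, mul_smul,
            ← mul_smul z]
          congr 2
          rw [hz, LieRing.of_associative_ring_bracket]
          noncomm_ring
      -- hence `y`, and with it `z = ⁅x, y⁆`, acts as zero after all
      have hy0 : ∀ s : S, y • s = 0 := by
        intro s
        apply hinjp m
        rw [← had, hm, LinearMap.zero_apply, zero_smul]
      exact (annihilatorLieIdeal K A S).lie_mem (x := x) (m := y) hy0
    · exact h0
  have h1 : ∀ j, LieModule.lowerCentralSeries K A A (j + 1) ≤ annihilatorLieIdeal K A S →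
      LieModule.lowerCentralSeries K A A 1 ≤ annihilatorLieIdeal K A S := by
    intro j
    induction j with
    | zero => simp
    | succ j ih => exact fun h => ih (step j h)
  apply h1 n
  · rw [LieModule.lowerCentralSeries_succ, hn]
    simp
  · rw [LieModule.lowerCentralSeries_succ]
    exact LieSubmodule.lie_mem_lie (LieSubmodule.mem_top x) (by simp)

/-- In a Lie nilpotent algebra the nilpotent elements lie in the Jacobson radical: modulo a maximal
left ideal they are central, hence act injectively or as zero. -/
theorem mem_jacobson_of_isNilpotent_of_lie (K : Type*) {A : Type*} [Field K] [Ring A]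
    [Algebra K A] (hA : LieRing.IsNilpotent A) {b : A} (hb : IsNilpotent b) :
    b ∈ Ring.jacobson A := by
  rw [Ring.jacobson_eq_sInf_isMaximal, Submodule.mem_sInf]
  intro I hI
  have hI : Ideal.IsMaximal I := hI
  have : IsSimpleModule A (A ⧸ I) := isSimpleModule_iff_isCoatom.mpr hI.out
  have hcomm : ∀ (w : A) (s : A ⧸ I), w • b • s = b • w • s := by
    intro w s
    have h2 := lie_mem_annihilatorLieIdeal (K := K) (S := A ⧸ I) hA w b s
    rw [LieRing.of_associative_ring_bracket, sub_smul, mul_smul, mul_smul, sub_eq_zero] at h2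
    exact h2
  rcases smul_injective_or_eq_zero hcomm with hinj | h0
  · exfalso
    obtain ⟨n, hn⟩ := hb
    have hinjp : ∀ k (s : A ⧸ I), b ^ k • s = 0 → s = 0 := by
      intro k
      induction k with
      | zero => simp
      | succ k ih =>
        intro s hs
        rw [pow_succ', mul_smul] at hs
        exact ih s (hinj _ hs)
    have : (Submodule.Quotient.mk 1 : A ⧸ I) = 0 := hinjp n _ (by rw [hn, zero_smul])
    rw [Submodule.Quotient.mk_eq_zero] at this
    exact hI.ne_top ((Ideal.eq_top_iff_one I).mpr this)
  · have := h0 (Submodule.Quotient.mk 1)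
    rwa [← Submodule.Quotient.mk_smul, smul_eq_mul, mul_one, Submodule.Quotient.mk_eq_zero]
      at this

end LieNilpotent

section FiniteDimensional

variable {K A : Type*} [Field K] [Ring A] [Algebra K A] [FiniteDimensional K A]

theorem exists_jacobson_pow_eq_bot (K A : Type*) [Field K] [Ring A] [Algebra K A]
    [FiniteDimensional K A] : ∃ n, Ring.jacobson A ^ n = ⊥ := by
  have : IsArtinianRing A := IsArtinianRing.of_finite K A
  obtain ⟨n, hn⟩ := IsArtinianRing.isNilpotent_jacobson_bot (R := A)
  rw [Ideal.jacobson_bot] at hn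
  exact ⟨n, hn⟩

theorem isNilpotent_of_mem_jacobson (K : Type*) {A : Type*} [Field K] [Ring A] [Algebra K A]
    [FiniteDimensional K A] {x : A} (hx : x ∈ Ring.jacobson A) : IsNilpotent x := by
  obtain ⟨n, hn⟩ := exists_jacobson_pow_eq_bot K A
  refine ⟨n, ?_⟩
  have := Ideal.pow_mem_pow hx n
  rwa [hn] at this

/-- A finite-dimensional Lie nilpotent algebra that is spanned by elements which are scalar plus
nilpotent consists of such elements. -/
theorem IsScalarPlusNilpotent.of_isNilpotent_of_span {ι : Type*} {a : ι → A}
    (hA : LieRing.IsNilpotent A) (ha : Submodule.span K (Set.range a) = ⊤)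
    (h : ∀ i, ∃ c : K, IsNilpotent (a i - algebraMap K A c)) : IsScalarPlusNilpotent K A := by
  suffices H : ∀ x : A, ∃ c : K, x - algebraMap K A c ∈ Ring.jacobson A from
    fun x => (H x).imp fun c hc => isNilpotent_of_mem_jacobson K hc
  intro x
  have hx : x ∈ Submodule.span K (Set.range a) := by rw [ha]; trivial
  induction hx using Submodule.span_induction with
  | mem x hx =>
    obtain ⟨i, rfl⟩ := hx
    exact (h i).imp fun c hc => mem_jacobson_of_isNilpotent_of_lie K hA hc
  | zero => exact ⟨0, by simp⟩
  | add x y _ _ hx hy =>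
    obtain ⟨c, hc⟩ := hx
    obtain ⟨d, hd⟩ := hy
    refine ⟨c + d, ?_⟩
    rw [map_add, add_sub_add_comm]
    exact Submodule.add_mem _ hc hd
  | smul t x _ hx =>
    obtain ⟨c, hc⟩ := hx
    refine ⟨t * c, ?_⟩
    rw [map_mul, Algebra.smul_def, ← mul_sub]
    exact Ideal.mul_mem_left _ _ hc

/-- By Engel's theorem, since subtracting a scalar from `x` does not change `ad x`. -/
theorem IsScalarPlusNilpotent.lieRing_isNilpotent (h : IsScalarPlusNilpotent K A) :
    LieRing.IsNilpotent A := by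
  rw [LieAlgebra.isNilpotent_iff_forall (R := K)]
  intro x
  obtain ⟨c, hc⟩ := h x
  have : LieAlgebra.ad K A x = LieAlgebra.ad K A (x - algebraMap K A c) := by
    ext y
    simp only [LieAlgebra.ad_apply, LieRing.of_associative_ring_bracket, sub_mul, mul_sub,
      Algebra.commutes]
    abel
  rw [this]
  exact LieAlgebra.ad_nilpotent_of_nilpotent hc

end FiniteDimensional

/-- A linear endomorphism is scalar plus nilpotent iff its characteristic polynomial is a power of
a linear factor. -/
theorem charpoly_neg_eq_iff {K U : Type*} [Field K] [AddCommGroup U] [Module K U]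
    [FiniteDimensional K U] (a : Module.End K U) (c : K) :
    (-a).charpoly = (Polynomial.X + Polynomial.C c) ^ Module.finrank K U ↔
      IsNilpotent (a - algebraMap K (Module.End K U) c) := by
  have h1 : IsNilpotent (a - algebraMap K (Module.End K U) c) ↔
      ((-a) - (-c) • (1 : Module.End K U)).charpoly = Polynomial.X ^ Module.finrank K U := by
    rw [LinearMap.charpoly_eq_X_pow_iff, ← Module.End.isNilpotent_iff_of_finite,
      ← isNilpotent_neg_iff]
    congr! 1
    rw [Algebra.algebraMap_eq_smul_one]
    module
  rw [h1, LinearMap.charpoly_sub_smul]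
  constructor
  · intro h
    rw [h]
    simp
  · intro h
    have := congrArg (fun p => p.comp (Polynomial.X + Polynomial.C c)) h
    simp only [Polynomial.comp_assoc] at this
    simpa using this

/-! ### Absolute indecomposability and the endomorphism algebra -/

namespace QuiverRep

section

variable {V : Type u} [Quiver.{v} V] {K : Type k} [Field K]

/-- Fitting's lemma: an endomorphism `y` of an indecomposable representation that has a kernel at
one vertex is nilpotent at all vertices. -/
theorem IsIndecomposable.isNilpotent {σ : QuiverRep.{u, v, w, k} V K} (hσ : σ.IsIndecomposable)
    (y : ∀ i, Module.End K (σ.space i))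
    (hy : ∀ (i j : V) (e : i ⟶ j), y j ∘ₗ σ.map e = σ.map e ∘ₗ y i)
    {i₀ : V} {x₀ : σ.space i₀} (hx₀ : x₀ ≠ 0) (hyx : y i₀ x₀ = 0) (i : V) :
    IsNilpotent (y i) := by
  have hyn : ∀ (n : ℕ) (i j : V) (e : i ⟶ j) (x : σ.space i),
      (y j ^ n) (σ.map e x) = σ.map e ((y i ^ n) x) := by
    intro n i j e
    induction n with
    | zero => simp
    | succ n ih =>
      intro x
      rw [pow_succ', pow_succ', Module.End.mul_apply, Module.End.mul_apply, ih]
      exact LinearMap.congr_fun (hy i j e) _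
  have hmem : ∀ i x, x ∈ (⨆ n, LinearMap.ker (y i ^ n)) ↔ ∃ n, (y i ^ n) x = 0 := by
    intro i x
    rw [Submodule.mem_iSup_of_directed]
    · simp
    · refine (monotone_nat_of_le_succ ?_).directed_le
      intro n x hx
      rw [LinearMap.mem_ker] at hx ⊢
      rw [pow_succ', Module.End.mul_apply, hx, map_zero]
  let σ₁ : QuiverRep.{u, v, w, k} V K :=
    { space := fun i => ↥(⨆ n, LinearMap.ker (y i ^ n))
      map := fun {i j} e => (σ.map e).restrict (by
        intro x hx
        rw [hmem] at hx ⊢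
        obtain ⟨n, hn⟩ := hx
        exact ⟨n, by rw [hyn, hn, map_zero]⟩) }
  let σ₂ : QuiverRep.{u, v, w, k} V K :=
    { space := fun i => ↥(⨅ n, LinearMap.range (y i ^ n))
      map := fun {i j} e => (σ.map e).restrict (by
        intro x hx
        rw [Submodule.mem_iInf] at hx ⊢
        intro n
        obtain ⟨z, hz⟩ := hx n
        exact ⟨σ.map e z, by rw [hyn, hz]⟩) }
  have hc := fun i => (y i).isCompl_iSup_ker_pow_iInf_range_pow
  by_contra hn
  refine hσ ⟨σ₁, σ₂, ⟨i₀, ?_⟩, ⟨i, ?_⟩, ⟨?_⟩⟩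
  · refine ⟨⟨⟨x₀, (hmem _ _).mpr ⟨1, by rwa [pow_one]⟩⟩, 0, ?_⟩⟩
    intro h
    exact hx₀ (congrArg Subtype.val h)
  · by_contra hs
    rw [not_nontrivial_iff_subsingleton] at hs
    apply hn
    rw [Module.End.isNilpotent_iff_of_finite]
    intro m
    rw [← hmem]
    have hbot : (⨅ n, LinearMap.range (y i ^ n)) = ⊥ := by
      rw [eq_bot_iff]
      intro z hz
      have : (⟨z, hz⟩ : σ₂.space i) = 0 := Subsingleton.elim _ _
      exact congrArg Subtype.val this
    have := (hc i).sup_eq_top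
    rw [hbot, sup_bot_eq] at this
    rw [this]
    trivial
  · refine ⟨fun i => (Submodule.prodEquivOfIsCompl _ _ (hc i)).symm, ?_⟩
    intro i j e x
    obtain ⟨⟨a, b⟩, rfl⟩ := (Submodule.prodEquivOfIsCompl _ _ (hc i)).surjective x
    have key : (Submodule.prodEquivOfIsCompl _ _ (hc j)).symm
        (σ.map e (Submodule.prodEquivOfIsCompl _ _ (hc i) (a, b))) =
        (σ₁.map e a, σ₂.map e b) := by
      rw [LinearEquiv.symm_apply_eq]
      simp [σ₁, σ₂]
    refine key.trans ?_
    have := (Submodule.prodEquivOfIsCompl _ _ (hc i)).symm_apply_apply (a, b)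
    change _ = (σ₁.map e ((Submodule.prodEquivOfIsCompl _ _ (hc i)).symm
      (Submodule.prodEquivOfIsCompl _ _ (hc i) (a, b))).1, σ₂.map e
      ((Submodule.prodEquivOfIsCompl _ _ (hc i)).symm
      (Submodule.prodEquivOfIsCompl _ _ (hc i) (a, b))).2)
    rw [this]

/-- The component of an endomorphism at a vertex. -/
def component (ρ : QuiverRep.{u, v, w, k} V K) [DecidableEq V] (i : V) :
    ρ.endAlgebra →ₐ[K] Module.End K (ρ.space i) :=
  AlgHom.ofLinearMap
    { toFun := fun a => LinearMap.proj i ∘ₗ (a : Module.End K (∀ i, ρ.space i)) ∘ₗ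
        LinearMap.single K ρ.space i
      map_add' := by intro a b; ext x; simp
      map_smul' := by intro a b; ext x; simp }
    (by ext x; simp)
    (by
      rintro ⟨a, f, hf, ha⟩ ⟨b, g, hg, hb⟩
      ext x
      simp [ha, hb])

theorem component_apply (ρ : QuiverRep.{u, v, w, k} V K) [DecidableEq V] (a : ρ.endAlgebra) (i : V)
    (x : ∀ i, ρ.space i) :
    ρ.component i a (x i) = (a : Module.End K (∀ i, ρ.space i)) x i := by
  obtain ⟨a, f, hf, ha⟩ := a
  change a _ i = a x i
  simp [ha]

theorem component_comm (ρ : QuiverRep.{u, v, w, k} V K) [DecidableEq V] (a : ρ.endAlgebra)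
    {i j : V} (e : i ⟶ j) : ρ.component j a ∘ₗ ρ.map e = ρ.map e ∘ₗ ρ.component i a := by
  obtain ⟨a, f, hf, ha⟩ := a
  have : ∀ i x, ρ.component i ⟨a, f, hf, ha⟩ x = f i x := by
    intro i x
    change a _ i = _
    simp [ha]
  ext x
  simpa [this] using LinearMap.congr_fun (hf i j e) x

theorem endAlgebra_ext {ρ : QuiverRep.{u, v, w, k} V K} [DecidableEq V] {a b : ρ.endAlgebra}
    (h : ∀ i, ρ.component i a = ρ.component i b) : a = b := by
  apply Subtype.ext
  apply LinearMap.ext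
  intro x
  funext i
  rw [← component_apply, ← component_apply, h]

/-- The endomorphism with given components. -/
def endOfComponents (ρ : QuiverRep.{u, v, w, k} V K) (f : ∀ i, Module.End K (ρ.space i))
    (hf : ∀ (i j : V) (e : i ⟶ j), f j ∘ₗ ρ.map e = ρ.map e ∘ₗ f i) : ρ.endAlgebra :=
  ⟨LinearMap.pi fun i => f i ∘ₗ LinearMap.proj i, f, hf, fun _ _ => rfl⟩

theorem component_endOfComponents (ρ : QuiverRep.{u, v, w, k} V K) [DecidableEq V]
    (f : ∀ i, Module.End K (ρ.space i))
    (hf : ∀ (i j : V) (e : i ⟶ j), f j ∘ₗ ρ.map e = ρ.map e ∘ₗ f i) (i : V) :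
    ρ.component i (ρ.endOfComponents f hf) = f i := by
  ext x
  change f i _ = _
  simp

theorem finiteDimensional_endAlgebra [Finite V] (ρ : QuiverRep.{u, v, w, k} V K) :
    FiniteDimensional K ρ.endAlgebra :=
  FiniteDimensional.finiteDimensional_subalgebra _

end

section

/-- `A` need not be commutative: the identity is that of polynomials over `K`, evaluated at `a`. -/
theorem sub_algebraMap_pow_expChar_pow {K A : Type*} [Field K] [Ring A] [Algebra K A] (p n : ℕ)
    [ExpChar K p] (a : A) (c : K) :
    (a - algebraMap K A c) ^ p ^ n = a ^ p ^ n - algebraMap K A (c ^ p ^ n) := by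
  have h : (Polynomial.X - Polynomial.C c) ^ p ^ n = Polynomial.X ^ p ^ n -
      Polynomial.C (c ^ p ^ n) := by
    rw [sub_pow_expChar_pow, Polynomial.C_pow]
  simpa using congrArg (Polynomial.aeval a) h

variable {V : Type u} [Quiver.{v} V] {F : Type k} [Field F]

/-- Over the algebraic closure an endomorphism has a single eigenvalue, by Fitting's lemma; a high
power of the Frobenius makes it a scalar endomorphism that is defined over `F`. -/
theorem IsAbsolutelyIndecomposable.isScalarPlusNilpotent [Finite V] [Finite F]
    {ρ : QuiverRep.{u, v, w, k} V F} (h : ρ.IsAbsolutelyIndecomposable) :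
    IsScalarPlusNilpotent F ρ.endAlgebra := by
  classical
  have := Fintype.ofFinite F
  intro a
  by_cases htriv : ∀ i, Subsingleton (ρ.space i)
  · refine ⟨0, ?_⟩
    have : a - algebraMap F _ 0 = 0 := by
      apply endAlgebra_ext
      intro i
      ext x
      exact Subsingleton.elim _ _
    rw [this]
    exact IsNilpotent.zero
  push Not at htriv
  obtain ⟨i₀, hi₀⟩ := htriv
  let L := AlgebraicClosure F
  let g : ∀ i, Module.End L (L ⊗[F] ρ.space i) := fun i => (ρ.component i a).baseChange L
  have hg : ∀ (i j : V) (e : i ⟶ j), g j ∘ₗ (ρ.map e).baseChange L =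
      (ρ.map e).baseChange L ∘ₗ g i := by
    intro i j e
    rw [← LinearMap.baseChange_comp, component_comm, LinearMap.baseChange_comp]
  obtain ⟨μ, hμ⟩ := Module.End.exists_eigenvalue (g i₀)
  obtain ⟨x₀, hx₀⟩ := hμ.exists_hasEigenvector
  have hcomm : ∀ (i j : V) (e : i ⟶ j) (x : L ⊗[F] ρ.space i),
      (g j - algebraMap L _ μ) ((ρ.map e).baseChange L x) =
        (ρ.map e).baseChange L ((g i - algebraMap L _ μ) x) := by
    intro i j e x
    have := LinearMap.congr_fun (hg i j e) x
    rw [LinearMap.sub_apply, LinearMap.sub_apply, map_sub, Module.algebraMap_end_apply,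
      Module.algebraMap_end_apply, map_smul]
    exact congrArg (· - _) this
  have hnil : ∀ i, IsNilpotent (g i - algebraMap L _ μ) := by
    refine h.isNilpotent (σ := ρ.baseChange L)
      (fun i => (g i - algebraMap L _ μ : Module.End L (L ⊗[F] ρ.space i))) ?_
      (i₀ := i₀) (x₀ := x₀) hx₀.2 ?_
    · exact fun i j e => LinearMap.ext (hcomm i j e)
    · have := hx₀.apply_eq_smul
      change g i₀ x₀ - μ • x₀ = 0
      rw [this, sub_self]
  choose n hn using hnil
  obtain ⟨N, hN⟩ := Finite.exists_le n
  obtain ⟨p, hp⟩ := CharP.exists F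
  obtain ⟨r, hprime, hr⟩ := FiniteField.card F p
  have : Fact p.Prime := ⟨hprime⟩
  have : ExpChar F p := ExpChar.prime hprime
  have : ExpChar L p := expChar_of_injective_algebraMap (algebraMap F L).injective p
  -- the exponent is a power `q ^ N` of the cardinality, so that it fixes the elements of `F`
  have hQ : N ≤ p ^ (r * N : ℕ) := by
    rw [pow_mul, ← hr]
    exact (Nat.lt_pow_self Fintype.one_lt_card).le
  have hpow : ∀ i, g i ^ p ^ (r * N : ℕ) = algebraMap L _ (μ ^ p ^ (r * N : ℕ)) := by
    intro i
    rw [← sub_eq_zero, ← sub_algebraMap_pow_expChar_pow]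
    exact pow_eq_zero_of_le ((hN i).trans hQ) (hn i)
  have hpow' : ∀ i (x : ρ.space i), (1 : L) ⊗ₜ[F] ((ρ.component i a ^ p ^ (r * N : ℕ)) x) =
      (μ ^ p ^ (r * N : ℕ)) ⊗ₜ[F] x := by
    intro i x
    have := LinearMap.congr_fun (hpow i) (1 ⊗ₜ x)
    simp only [g] at this
    rw [← LinearMap.baseChange_pow, Module.algebraMap_end_apply] at this
    simpa [TensorProduct.smul_tmul'] using this
  obtain ⟨x₁, hx₁⟩ := exists_ne (0 : ρ.space i₀)
  obtain ⟨φ, hφ⟩ := Module.Projective.exists_dual_ne_zero F hx₁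
  -- apply a linear form over `F` to see that the scalar is defined over `F`
  obtain ⟨c, hc⟩ : ∃ c : F, algebraMap F L c = μ ^ p ^ (r * N : ℕ) := by
    refine ⟨(φ x₁)⁻¹ * φ ((ρ.component i₀ a ^ p ^ (r * N : ℕ)) x₁), ?_⟩
    have := congrArg (fun z => TensorProduct.rid F L ((LinearMap.lTensor L φ) z)) (hpow' i₀ x₁)
    simp only [LinearMap.lTensor_tmul, TensorProduct.rid_tmul] at this
    rw [Algebra.smul_def, Algebra.smul_def, mul_one] at this
    rw [map_mul, this, ← mul_assoc, ← map_mul, inv_mul_cancel₀ hφ, map_one, one_mul]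
  refine ⟨c, p ^ (r * N : ℕ), ?_⟩
  refine (sub_algebraMap_pow_expChar_pow (A := ρ.endAlgebra) p (r * N) a c).trans ?_
  rw [sub_eq_zero]
  have hcc : c ^ p ^ (r * N : ℕ) = c := by
    rw [pow_mul, ← hr, FiniteField.pow_card_pow]
  rw [hcc]
  apply endAlgebra_ext
  intro i
  rw [map_pow, AlgHom.commutes]
  ext x
  have := hpow' i x
  rw [← hc, Algebra.algebraMap_eq_smul_one, TensorProduct.smul_tmul] at this
  rw [Module.algebraMap_end_apply]
  exact Module.FaithfullyFlat.tensorProduct_mk_injective (A := F) (B := L) _ this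

end

section

variable {V : Type u} [Quiver.{v} V] {F : Type k} [Field F]

/-- Expanding an endomorphism over the extension field in a basis of the field extension writes it
as a linear combination of endomorphisms over the ground field. Each of them is a scalar plus an
element of the radical, and the radical remains nilpotent after extension of scalars. -/
theorem exists_isNilpotent_sub_of_comm [Finite V] {ρ : QuiverRep.{u, v, w, k} V F}
    (h : IsScalarPlusNilpotent F ρ.endAlgebra) (L : Type l) [Field L] [Algebra F L]
    (g : ∀ i, Module.End L (L ⊗[F] ρ.space i))
    (hg : ∀ (i j : V) (e : i ⟶ j), g j ∘ₗ (ρ.map e).baseChange L =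
      (ρ.map e).baseChange L ∘ₗ g i) :
    ∃ d : L, ∀ i, IsNilpotent (g i - algebraMap L _ d) := by
  classical
  have := Fintype.ofFinite V
  have := ρ.finiteDimensional_endAlgebra
  let ω := Module.Free.chooseBasis F L
  let T := fun i => TensorProduct.equivFinsuppOfBasisLeft (N := ρ.space i) ω
  have hT : ∀ i j (f : ρ.space i →ₗ[F] ρ.space j) (z : L ⊗[F] ρ.space i) κ,
      T j (f.baseChange L z) κ = f (T i z κ) := by
    intro i j f z κ
    induction z with
    | zero => simp
    | add x y hx hy => simp [hx, hy]
    | tmul x y => simp [T]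
  -- the coordinates of the endomorphism
  let f : ∀ κ i, Module.End F (ρ.space i) := fun κ i =>
    Finsupp.lapply κ ∘ₗ (T i).toLinearMap ∘ₗ (g i).restrictScalars F ∘ₗ TensorProduct.mk F L _ 1
  have hf : ∀ κ i x, f κ i x = T i (g i (1 ⊗ₜ x)) κ := fun _ _ _ => rfl
  have hfc : ∀ κ (i j : V) (e : i ⟶ j), f κ j ∘ₗ ρ.map e = ρ.map e ∘ₗ f κ i := by
    intro κ i j e
    apply LinearMap.ext
    intro x
    change f κ j (ρ.map e x) = ρ.map e (f κ i x)
    rw [hf, hf, ← hT]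
    have := LinearMap.congr_fun (hg i j e) (1 ⊗ₜ x)
    rw [LinearMap.comp_apply, LinearMap.comp_apply, LinearMap.baseChange_tmul] at this
    rw [this]
  let x : ∀ κ, ρ.endAlgebra := fun κ => ρ.endOfComponents (f κ) (hfc κ)
  -- only finitely many of the coordinates do not vanish
  have hfin : ∀ i, ∃ S : Finset _, ∀ κ ∉ S, f κ i = 0 := by
    intro i
    let b := Module.finBasis F (ρ.space i)
    refine ⟨Finset.univ.biUnion fun m => (T i (g i (1 ⊗ₜ b m))).support, ?_⟩
    intro κ hκ
    apply b.ext
    intro m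
    rw [hf]
    simp only [Finset.mem_biUnion, Finset.mem_univ, true_and, not_exists] at hκ
    simpa using hκ m
  choose S hS using hfin
  let S' := Finset.univ.biUnion S
  have hS' : ∀ i, ∀ κ ∉ S', f κ i = 0 := by
    intro i κ hκ
    apply hS
    intro hκ'
    exact hκ (Finset.mem_biUnion.mpr ⟨i, Finset.mem_univ _, hκ'⟩)
  choose c hc using h
  let θ : ∀ i, ρ.endAlgebra → Module.End L (L ⊗[F] ρ.space i) :=
    fun i a => (ρ.component i a).baseChange L
  have hgsum : ∀ i, g i = ∑ κ ∈ S', ω κ • θ i (x κ) := by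
    intro i
    ext u
    have h1 : g i (1 ⊗ₜ u) = (T i).symm (T i (g i (1 ⊗ₜ u))) := by simp
    have h2 : (T i (g i (1 ⊗ₜ u))).support ⊆ S' := by
      intro κ hκ
      by_contra hκ'
      rw [Finsupp.mem_support_iff, ← hf, hS' i κ hκ'] at hκ
      exact hκ rfl
    rw [TensorProduct.AlgebraTensorModule.curry_apply, TensorProduct.AlgebraTensorModule.curry_apply]
    simp only [TensorProduct.curry_apply,
      LinearMap.coe_restrictScalars]
    rw [h1, TensorProduct.equivFinsuppOfBasisLeft_symm_apply, Finsupp.sum_of_support_subset _ h2]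
    · simp only [LinearMap.sum_apply, LinearMap.smul_apply]
      refine Finset.sum_congr rfl fun κ _ => ?_
      simp only [θ, x]
      rw [component_endOfComponents, LinearMap.baseChange_tmul, TensorProduct.smul_tmul', hf,
        smul_eq_mul, mul_one]
    · simp
  obtain ⟨n, hn⟩ := exists_jacobson_pow_eq_bot F ρ.endAlgebra
  -- powers of the extended radical are spanned by the powers of the radical
  have key : ∀ i (y : Module.End L (L ⊗[F] ρ.space i)),
      y ∈ Submodule.span L (θ i '' (Ring.jacobson ρ.endAlgebra : Set ρ.endAlgebra)) →
      ∀ m, y ^ m ∈ Submodule.span L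
        (θ i '' ((Ring.jacobson ρ.endAlgebra ^ m : Ideal ρ.endAlgebra) : Set ρ.endAlgebra)) := by
    intro i y hy m
    induction m with
    | zero =>
      refine Submodule.subset_span ⟨1, ?_, ?_⟩
      · rw [Submodule.pow_zero, Ideal.one_eq_top]
        exact Submodule.mem_top
      simp only [θ, map_one, pow_zero]
      exact LinearMap.baseChange_one F _
    | succ m ih =>
      rw [pow_succ]
      have := Submodule.mul_mem_mul ih hy
      rw [Submodule.span_mul_span] at this
      refine Submodule.span_mono ?_ this
      rintro _ ⟨_, ⟨a, ha, rfl⟩, _, ⟨b, hb, rfl⟩, rfl⟩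
      refine ⟨a * b, ?_, ?_⟩
      · rw [Submodule.pow_succ]
        exact Ideal.mul_mem_mul ha hb
      · simp only [θ, map_mul]
        exact LinearMap.baseChange_mul _ _
  refine ⟨∑ κ ∈ S', ω κ * algebraMap F L (c (x κ)), fun i => ⟨n, ?_⟩⟩
  have hmem : g i - algebraMap L _ (∑ κ ∈ S', ω κ * algebraMap F L (c (x κ))) ∈
      Submodule.span L (θ i '' (Ring.jacobson ρ.endAlgebra : Set ρ.endAlgebra)) := by
    rw [hgsum, map_sum, ← Finset.sum_sub_distrib]
    refine Submodule.sum_mem _ fun κ _ => ?_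
    rw [map_mul, ← Algebra.smul_def]
    have hsub : ω κ • θ i (x κ) - ω κ • algebraMap L _ (algebraMap F L (c (x κ))) =
        ω κ • (θ i (x κ) - algebraMap L _ (algebraMap F L (c (x κ)))) := (smul_sub _ _ _).symm
    rw [hsub]
    refine Submodule.smul_mem _ _ (Submodule.subset_span
      ⟨x κ - algebraMap F _ (c (x κ)), ?_, ?_⟩)
    · exact IsScalarPlusNilpotent.mem_jacobson (fun a => ⟨c a, hc a⟩) (hc _)
    · have h1 : ρ.component i (x κ - algebraMap F _ (c (x κ))) =
          ρ.component i (x κ) - algebraMap F _ (c (x κ)) :=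
        (map_sub (ρ.component i) _ _).trans
          (congrArg (ρ.component i (x κ) - ·) ((ρ.component i).commutes _))
      simp only [θ]
      rw [h1, LinearMap.baseChange_sub]
      congr 1
      ext u
      simp [TensorProduct.smul_tmul', Algebra.algebraMap_eq_smul_one]
  have := key i _ hmem n
  rw [hn] at this
  have hle : Submodule.span L (θ i '' ((⊥ : Ideal ρ.endAlgebra) : Set ρ.endAlgebra)) ≤ ⊥ := by
    rw [Submodule.span_le]
    rintro _ ⟨a, ha, rfl⟩
    rw [SetLike.mem_coe, Submodule.mem_bot] at ha
    subst ha
    simp [θ]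
  exact (Submodule.mem_bot L).mp (hle this)

/-- The projection onto a direct summand has the eigenvalues `0` and `1`, but a scalar plus a
nilpotent has only one eigenvalue. -/
theorem isAbsolutelyIndecomposable_of_isScalarPlusNilpotent [Finite V]
    {ρ : QuiverRep.{u, v, w, k} V F} (h : IsScalarPlusNilpotent F ρ.endAlgebra) :
    ρ.IsAbsolutelyIndecomposable := by
  rintro ⟨ρ₁, ρ₂, ⟨i₁, hi₁⟩, ⟨i₂, hi₂⟩, ⟨Φ⟩⟩
  let L := AlgebraicClosure F
  obtain ⟨φ, hφ⟩ : ∃ φ : ∀ i, (L ⊗[F] ρ.space i) ≃ₗ[L] (ρ₁.space i × ρ₂.space i),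
      ∀ (i j : V) (e : i ⟶ j) x, φ j ((ρ.map e).baseChange L x) =
        (ρ₁.map e (φ i x).1, ρ₂.map e (φ i x).2) :=
    ⟨fun i => Φ.equiv i, fun i j e x => Φ.comm e x⟩
  -- the projection onto the first summand
  let g : ∀ i, Module.End L (L ⊗[F] ρ.space i) := fun i =>
    (φ i).symm.toLinearMap ∘ₗ
      (LinearMap.inl L (ρ₁.space i) (ρ₂.space i) ∘ₗ LinearMap.fst L (ρ₁.space i) (ρ₂.space i)) ∘ₗ
      (φ i).toLinearMap
  have hg : ∀ i x, g i x = (φ i).symm ((φ i x).1, 0) := fun _ _ => rfl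
  obtain ⟨d, hd⟩ := exists_isNilpotent_sub_of_comm h L g (by
    intro i j e
    apply LinearMap.ext
    intro x
    change g j ((ρ.map e).baseChange L x) = (ρ.map e).baseChange L (g i x)
    rw [hg, hg, LinearEquiv.symm_apply_eq, hφ, hφ,
      LinearEquiv.apply_symm_apply, map_zero])
  have heig : ∀ i (x : L ⊗[F] ρ.space i) (t : L), x ≠ 0 → g i x = t • x → d = t := by
    intro i x t hx hgx
    obtain ⟨n, hn⟩ := hd i
    have hpow : ∀ m, ((g i - algebraMap L _ d) ^ m) x = (t - d) ^ m • x := by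
      intro m
      induction m with
      | zero => simp
      | succ m ih =>
        rw [pow_succ', Module.End.mul_apply, ih, map_smul, LinearMap.sub_apply, hgx,
          Module.algebraMap_end_apply, ← sub_smul, smul_smul, ← pow_succ]
    have := hpow n
    rw [hn, LinearMap.zero_apply, eq_comm, smul_eq_zero] at this
    rcases this with h0 | h0
    · exact (sub_eq_zero.mp (eq_zero_of_pow_eq_zero h0)).symm
    · exact absurd h0 hx
  obtain ⟨x₁, hx₁⟩ := exists_ne (0 : ρ₁.space i₁)
  obtain ⟨x₂, hx₂⟩ := exists_ne (0 : ρ₂.space i₂)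
  have h1 : d = 1 := by
    refine heig i₁ ((φ i₁).symm (x₁, 0)) 1 ?_ ?_
    · rw [ne_eq, LinearEquiv.symm_apply_eq, map_zero]
      exact fun h => hx₁ (congrArg Prod.fst h)
    · rw [hg, LinearEquiv.apply_symm_apply, one_smul]
  have h0 : d = 0 := by
    refine heig i₂ ((φ i₂).symm (0, x₂)) 0 ?_ ?_
    · rw [ne_eq, LinearEquiv.symm_apply_eq, map_zero]
      exact fun h => hx₂ (congrArg Prod.snd h)
    · rw [hg, LinearEquiv.apply_symm_apply, zero_smul, LinearEquiv.symm_apply_eq, map_zero]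
      rfl
  exact one_ne_zero (h1.symm.trans h0)

/-- A representation over a finite field is absolutely indecomposable iff its endomorphism algebra
is zero or local with residue field `F`. -/
theorem isAbsolutelyIndecomposable_iff [Finite V] [Finite F] {ρ : QuiverRep.{u, v, w, k} V F} :
    ρ.IsAbsolutelyIndecomposable ↔ IsScalarPlusNilpotent F ρ.endAlgebra :=
  ⟨fun h => h.isScalarPlusNilpotent, isAbsolutelyIndecomposable_of_isScalarPlusNilpotent⟩

/-- It suffices to consider a basis of the endomorphism algebra, if this algebra is Lie nilpotent. -/
theorem isAbsolutelyIndecomposable_iff_charpoly [Finite V] [Finite F]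
    (ρ : QuiverRep.{u, v, w, k} V F) {ι : Type*} (a : Module.Basis ι F ρ.endAlgebra) :
    ρ.IsAbsolutelyIndecomposable ↔
      (∀ i, ∃ γ : F, (-(a i : Module.End F (∀ j, ρ.space j))).charpoly =
        (Polynomial.X + Polynomial.C γ) ^ Module.finrank F (∀ j, ρ.space j)) ∧
      ∃ n, LieModule.lowerCentralSeries F ρ.endAlgebra ρ.endAlgebra n = ⊥ := by
  have := ρ.finiteDimensional_endAlgebra
  have hsub : ∀ (x : ρ.endAlgebra) (γ : F),
      (-(x : Module.End F (∀ j, ρ.space j))).charpoly =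
        (Polynomial.X + Polynomial.C γ) ^ Module.finrank F (∀ j, ρ.space j) ↔
      IsNilpotent (x - algebraMap F _ γ) := by
    intro x γ
    rw [charpoly_neg_eq_iff, ← IsNilpotent.map_iff (f := ρ.endAlgebra.val) Subtype.val_injective]
    rfl
  rw [isAbsolutelyIndecomposable_iff, ← LieModule.isNilpotent_iff]
  simp only [hsub]
  constructor
  · intro h
    exact ⟨fun i => h (a i), h.lieRing_isNilpotent⟩
  · rintro ⟨h1, h2⟩
    exact .of_isNilpotent_of_span h2 a.span_eq h1

end

end QuiverRep

/-! ### A language of loop programs and its compilation -/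

namespace RAM

/-- The state after the steps `f 0, …, f (n - 1)`. -/
def iterSteps {α : Type*} (f : ℕ → α → α) (a : α) : ℕ → α
  | 0 => a
  | n + 1 => f n (iterSteps f a n)

/-- What a loop program cannot change: eight parameters, which bound all loops, and the four input
memories. -/
structure Env where
  /-- the parameters -/
  par : Fin 8 → ℕ
  /-- the input memories -/
  inp : Fin 4 → ℕ → ℕ

/-- What a loop program changes: variables and arrays. -/
structure Store where
  /-- the variables -/
  var : ℕ → ℕ
  /-- the arrays -/
  mem : ℕ → ℕ → ℕ

/-- Expressions. They are evaluated without side effects. -/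
inductive Exp where
  /-- a parameter -/
  | par (b : Fin 8) : Exp
  /-- a variable -/
  | var (x : ℕ) : Exp
  /-- a numeral -/
  | const (c : ℕ) : Exp
  /-- a sum -/
  | add (e₁ e₂ : Exp) : Exp
  /-- a truncated difference -/
  | sub (e₁ e₂ : Exp) : Exp
  /-- an entry of an input memory -/
  | inp (a : Fin 4) (e : Exp) : Exp
  /-- an entry of an array -/
  | get (a : ℕ) (e : Exp) : Exp
  /-- if `e` is zero then `e₁`, else `e₂` -/
  | ifz (e e₁ e₂ : Exp) : Exp
  /-- a binary function given by its table on `0, …, d`; larger arguments are read as `d` -/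
  | op (d : ℕ) (f : ℕ → ℕ → ℕ) (e₁ e₂ : Exp) : Exp
  /-- `y := e₀`, and `y := e₁` for `x = 0, …, par b - 1`, where `x` and `y` are bound variables;
  the value is the last value of `y` -/
  | fold (b : Fin 8) (x y : ℕ) (e₀ e₁ : Exp) : Exp

/-- The value of an expression. -/
def Exp.eval (Γ : Env) (m : ℕ → ℕ → ℕ) : Exp → (ℕ → ℕ) → ℕ
  | .par b, _ => Γ.par b
  | .var x, ρ => ρ x
  | .const c, _ => c
  | .add e₁ e₂, ρ => e₁.eval Γ m ρ + e₂.eval Γ m ρ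
  | .sub e₁ e₂, ρ => e₁.eval Γ m ρ - e₂.eval Γ m ρ
  | .inp a e, ρ => Γ.inp a (e.eval Γ m ρ)
  | .get a e, ρ => m a (e.eval Γ m ρ)
  | .ifz e e₁ e₂, ρ => if e.eval Γ m ρ = 0 then e₁.eval Γ m ρ else e₂.eval Γ m ρ
  | .op d f e₁ e₂, ρ => f (min d (e₁.eval Γ m ρ)) (min d (e₂.eval Γ m ρ))
  | .fold b x y e₀ e₁, ρ =>
    iterSteps (fun i r => e₁.eval Γ m (Function.update (Function.update ρ x i) y r))
      (e₀.eval Γ m ρ) (Γ.par b)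

/-- Loop programs. -/
inductive Cmd where
  /-- assign the value of an expression to a variable -/
  | set (x : ℕ) (e : Exp) : Cmd
  /-- fill the array `a`, as a `par b × par b'` matrix, with the values of `e`, where the bound
  variables `x` and `y` are the row and the column; all values are computed before the array is
  changed -/
  | fill (a : ℕ) (b : Fin 8) (x : ℕ) (b' : Fin 8) (y : ℕ) (e : Exp) : Cmd
  /-- one program after the other -/
  | seq (c₁ c₂ : Cmd) : Cmd
  /-- execute `c` for `x = 0, …, par b - 1` -/
  | iterate (b : Fin 8) (x : ℕ) (c : Cmd) : Cmd

/-- The effect of a loop program. -/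
def Cmd.run (Γ : Env) : Cmd → Store → Store
  | .set x e, σ => { σ with var := Function.update σ.var x (e.eval Γ σ.mem σ.var) }
  | .fill a b x b' y e, σ =>
    { σ with
      mem := Function.update σ.mem a fun t =>
        if t < Γ.par b * Γ.par b' then
          e.eval Γ σ.mem
            (Function.update (Function.update σ.var x (t / Γ.par b')) y (t % Γ.par b'))
        else σ.mem a t }
  | .seq c₁ c₂, σ => c₂.run Γ (c₁.run Γ σ)
  | .iterate b x c, σ =>
    iterSteps (fun i σ => c.run Γ { σ with var := Function.update σ.var x i }) σ (Γ.par b)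

/-! The parameters are kept in the registers `0, …, 7`, the variables in the even registers from
`8` on, intermediate results in the odd registers from `9` on, the inputs in the memories
`0, …, 3` and the arrays in the memories from `5` on. The memory `4` is a buffer. -/

/-- The register of a variable. -/
def varReg (x : ℕ) : ℕ := 8 + 2 * x

/-- The `j`-th register for intermediate results. -/
def tmpReg (j : ℕ) : ℕ := 9 + 2 * j

theorem tmpReg_inj {i j : ℕ} : tmpReg i = tmpReg j ↔ i = j := by
  unfold tmpReg; omega

theorem varReg_inj {i j : ℕ} : varReg i = varReg j ↔ i = j := by
  unfold varReg; omega

theorem varReg_ne_tmpReg (x j : ℕ) : varReg x ≠ tmpReg j := by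
  unfold varReg tmpReg; omega

theorem tmpReg_ne_varReg (x j : ℕ) : tmpReg j ≠ varReg x := (varReg_ne_tmpReg x j).symm

theorem par_ne_tmpReg (b : Fin 8) (j : ℕ) : (b : ℕ) ≠ tmpReg j := by
  unfold tmpReg; omega

theorem par_ne_varReg (b : Fin 8) (j : ℕ) : (b : ℕ) ≠ varReg j := by
  unfold varReg; omega

theorem setReg_reg (s : State) (x n r : ℕ) :
    (s.setReg x n).reg r = if r = x then n else s.reg r := by
  simp [State.setReg, Function.update_apply]

theorem setReg_mem (s : State) (x n : ℕ) : (s.setReg x n).mem = s.mem := rfl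

theorem setMem_reg (s : State) (a i n : ℕ) : (s.setMem a i n).reg = s.reg := rfl

theorem setMem_mem (s : State) (a i n c j : ℕ) :
    (s.setMem a i n).mem c j = if c = a ∧ j = i then n else s.mem c j := by
  by_cases h : c = a
  · subst h
    simp [State.setMem, Function.update_apply]
  · simp [State.setMem, h]

/-- The machine state `s` contains the data `Γ` and `σ` of a loop program. -/
structure Represents (Γ : Env) (σ : Store) (s : State) : Prop where
  par : ∀ b : Fin 8, s.reg b = Γ.par b
  var : ∀ x, s.reg (varReg x) = σ.var x
  inp : ∀ a : Fin 4, s.mem a = Γ.inp a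
  mem : ∀ a, s.mem (5 + a) = σ.mem a

/-- The state `s'` differs from `s` only in registers for intermediate results from the `k`-th
on. -/
structure Agree (k : ℕ) (s s' : State) : Prop where
  mem : s'.mem = s.mem
  reg : ∀ r, (∀ j, k ≤ j → r ≠ tmpReg j) → s'.reg r = s.reg r

theorem Agree.trans {k : ℕ} {s₁ s₂ s₃ : State} (h : Agree k s₁ s₂) (h' : Agree k s₂ s₃) :
    Agree k s₁ s₃ :=
  ⟨h'.mem.trans h.mem, fun r hr => (h'.reg r hr).trans (h.reg r hr)⟩

theorem Agree.mono {k k' : ℕ} {s s' : State} (h : Agree k' s s') (hk : k ≤ k') : Agree k s s' :=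
  ⟨h.mem, fun r hr => h.reg r fun j hj => hr j (hk.trans hj)⟩

theorem Agree.tmp {k j : ℕ} {s s' : State} (h : Agree k s s') (hj : j < k) :
    s'.reg (tmpReg j) = s.reg (tmpReg j) :=
  h.reg _ fun i hi => by rw [Ne, tmpReg_inj]; omega

theorem Agree.setReg {k j : ℕ} (s : State) (n : ℕ) (hj : k ≤ j) :
    Agree k s (s.setReg (tmpReg j) n) :=
  ⟨rfl, fun r hr => by rw [setReg_reg, if_neg (hr j hj)]⟩

theorem Agree.represents {k : ℕ} {s s' : State} {Γ : Env} {σ : Store} (h : Agree k s s')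
    (hs : Represents Γ σ s) : Represents Γ σ s' where
  par b := by rw [h.reg _ fun j _ => par_ne_tmpReg b j, hs.par]
  var x := by rw [h.reg _ fun j _ => varReg_ne_tmpReg x j, hs.var]
  inp a := by rw [h.mem, hs.inp]
  mem a := by rw [h.mem, hs.mem]

theorem Represents.setVar {Γ : Env} {σ : Store} {s : State} (h : Represents Γ σ s) (x n : ℕ) :
    Represents Γ { σ with var := Function.update σ.var x n } (s.setReg (varReg x) n) where
  par b := by rw [setReg_reg, if_neg (par_ne_varReg b x), h.par]
  var y := by simp [setReg_reg, varReg_inj, Function.update_apply, h.var]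
  inp a := h.inp a
  mem a := h.mem a

/-- The program `P y` for the value `y`, or `m` if this is smaller, of the register `r`, which is
counted down; the register `one` contains `1`. -/
def select (r one : ℕ) (P : ℕ → Program) : ℕ → ℕ → Program
  | 0, j => P j
  | m + 1, j => .branch r (.seq (.sub r r one) (select r one P m (j + 1))) (P j)

/-- `P` for the values `0, 1, …` of the register `tmpReg (k + 1)`, as many as the register `b`
says. -/
def countLoop (k b : ℕ) (P : Program) : Program :=
  .seq (.copy (tmpReg k) b) (.seq (.const (tmpReg (k + 1)) 0) (.seq (.const (tmpReg (k + 2)) 1)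
    (.loop (tmpReg k) (.seq P (.seq (.add (tmpReg (k + 1)) (tmpReg (k + 1)) (tmpReg (k + 2)))
      (.sub (tmpReg k) (tmpReg k) (tmpReg (k + 2))))))))

/-- The program that puts the value of an expression into the `k`-th register for intermediate
results and does not change those before it. -/
def Exp.compile : Exp → ℕ → Program
  | .par b, k => .copy (tmpReg k) b
  | .var x, k => .copy (tmpReg k) (varReg x)
  | .const c, k => .const (tmpReg k) c
  | .add e₁ e₂, k => .seq (e₁.compile k) (.seq (e₂.compile (k + 1))
      (.add (tmpReg k) (tmpReg k) (tmpReg (k + 1))))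
  | .sub e₁ e₂, k => .seq (e₁.compile k) (.seq (e₂.compile (k + 1))
      (.sub (tmpReg k) (tmpReg k) (tmpReg (k + 1))))
  | .inp a e, k => .seq (e.compile k) (.load (tmpReg k) a (tmpReg k))
  | .get a e, k => .seq (e.compile k) (.load (tmpReg k) (5 + a) (tmpReg k))
  | .ifz e e₁ e₂, k => .seq (e.compile k) (.branch (tmpReg k) (e₂.compile k) (e₁.compile k))
  | .op d f e₁ e₂, k => .seq (e₁.compile k) (.seq (e₂.compile (k + 1))
      (.seq (.const (tmpReg (k + 2)) 1)
        (select (tmpReg k) (tmpReg (k + 2))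
          (fun i => select (tmpReg (k + 1)) (tmpReg (k + 2))
            (fun j => .const (tmpReg k) (f i j)) d 0) d 0)))
  | .fold b x y e₀ e₁, k =>
    .seq (e₀.compile (k + 5)) (.seq (.copy (tmpReg (k + 3)) (varReg x))
      (.seq (.copy (tmpReg (k + 4)) (varReg y))
      (.seq (countLoop k b (.seq (.copy (varReg x) (tmpReg (k + 1)))
        (.seq (.copy (varReg y) (tmpReg (k + 5))) (.seq (e₁.compile (k + 6))
          (.copy (tmpReg (k + 5)) (tmpReg (k + 6)))))))
      (.seq (.copy (varReg x) (tmpReg (k + 3))) (.seq (.copy (varReg y) (tmpReg (k + 4)))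
        (.copy (tmpReg k) (tmpReg (k + 5))))))))

/-- A bound for the running time of the compiled expression. -/
def Exp.cost (par : Fin 8 → ℕ) : Exp → ℕ
  | .par _ => 1
  | .var _ => 1
  | .const _ => 1
  | .add e₁ e₂ => e₁.cost par + e₂.cost par + 1
  | .sub e₁ e₂ => e₁.cost par + e₂.cost par + 1
  | .inp _ e => e.cost par + 1
  | .get _ e => e.cost par + 1
  | .ifz e e₁ e₂ => e.cost par + (e₁.cost par + e₂.cost par) + 1
  | .op d _ e₁ e₂ => e₁.cost par + e₂.cost par + 1 + (2 * d + (2 * d + 1))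
  | .fold b _ _ e₀ e₁ => e₀.cost par + (4 + par b * (e₁.cost par + 3 + 3)) + 5

/-- The machine program of a loop program. It does not change the first `k` registers for
intermediate results. -/
def Cmd.compile : Cmd → ℕ → Program
  | .set x e, k => .seq (e.compile k) (.copy (varReg x) (tmpReg k))
  | .fill a b x b' y e, k =>
    .seq (.copy (tmpReg (k + 6)) (varReg x)) (.seq (.copy (tmpReg (k + 7)) (varReg y))
      (.seq (.const (tmpReg (k + 8)) 0)
      (.seq (countLoop k b (countLoop (k + 3) b' (.seq (.copy (varReg x) (tmpReg (k + 1)))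
        (.seq (.copy (varReg y) (tmpReg (k + 4))) (.seq (e.compile (k + 9))
          (.seq (.store 4 (tmpReg (k + 8)) (tmpReg (k + 9)))
            (.add (tmpReg (k + 8)) (tmpReg (k + 8)) (tmpReg (k + 2)))))))))
      (.seq (.copy (varReg x) (tmpReg (k + 6))) (.seq (.copy (varReg y) (tmpReg (k + 7)))
      (countLoop k (tmpReg (k + 8)) (.seq (.load (tmpReg (k + 9)) 4 (tmpReg (k + 1)))
        (.store (5 + a) (tmpReg (k + 1)) (tmpReg (k + 9))))))))))
  | .seq c₁ c₂, k => .seq (c₁.compile k) (c₂.compile k)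
  | .iterate b x c, k =>
    countLoop k b (.seq (.copy (varReg x) (tmpReg (k + 1))) (c.compile (k + 3)))

/-- A bound for the running time of the compiled loop program. -/
def Cmd.cost (par : Fin 8 → ℕ) : Cmd → ℕ
  | .set _ e => e.cost par + 1
  | .fill _ b _ b' _ e =>
    (4 + par b * (4 + par b' * (e.cost par + 4 + 3) + 3)) + (4 + par b * par b' * (2 + 3)) + 5
  | .seq c₁ c₂ => c₁.cost par + c₂.cost par
  | .iterate b _ c => 4 + par b * (1 + c.cost par + 3)

/-- `select` counts down the register `tmpReg i` and then executes the selected program, which may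
rely on all other registers; `Q` and `c` are any properties of its result and its running time. -/
theorem exec_select {i o : ℕ} {P : ℕ → Program} {Q : State → Prop} {c : ℕ} (hoi : o ≠ i)
    (m : ℕ) : ∀ (j : ℕ) (s : State), s.reg (tmpReg o) = 1 →
      (∀ s₁ : State, s₁.mem = s.mem → (∀ r, r ≠ tmpReg i → s₁.reg r = s.reg r) →
        ∃ s' t, Exec (P (j + min m (s.reg (tmpReg i)))) s₁ s' t ∧ t ≤ c ∧ Q s') →
      ∃ s' t, Exec (select (tmpReg i) (tmpReg o) P m j) s s' t ∧ t ≤ 2 * m + c ∧ Q s' := by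
  have hoi' : tmpReg o ≠ tmpReg i := by rwa [Ne, tmpReg_inj]
  induction m with
  | zero =>
    intro j s _ h
    obtain ⟨s', t, h1, h2, h3⟩ := h s rfl fun _ _ => rfl
    exact ⟨s', t, by simpa [select] using h1, by omega, h3⟩
  | succ m ih =>
    intro j s ho h
    by_cases hv : s.reg (tmpReg i) = 0
    · obtain ⟨s', t, h1, h2, h3⟩ := h s rfl fun _ _ => rfl
      rw [hv] at h1
      exact ⟨s', t + 1, .branch_zero hv h1, by omega, h3⟩
    · obtain ⟨s', t, h1, h2, h3⟩ := ih (j + 1)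
        (s.setReg (tmpReg i) (s.reg (tmpReg i) - s.reg (tmpReg o)))
        (by rw [setReg_reg, if_neg hoi', ho]) (by
          intro s₁ hm hr
          rw [setReg_reg, if_pos rfl, ho]
          have : j + 1 + min m (s.reg (tmpReg i) - 1) = j + min (m + 1) (s.reg (tmpReg i)) := by
            omega
          rw [this]
          exact h s₁ hm fun r hri => by rw [hr r hri, setReg_reg, if_neg hri])
      exact ⟨s', 1 + t + 1, .branch_pos hv (.seq (.sub _ _ _ _) h1), by omega, h3⟩

/-- The invariant `I i` of a counting loop, which must not depend on the three registers that
control the loop, holds after `i` rounds. -/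
theorem exec_countLoop {k b n c : ℕ} {P : Program} {s : State} (I : ℕ → State → Prop)
    (hb : s.reg b = n)
    (hI : ∀ i s s', I i s → s'.mem = s.mem →
      (∀ r, r ≠ tmpReg k → r ≠ tmpReg (k + 1) → r ≠ tmpReg (k + 2) → s'.reg r = s.reg r) → I i s')
    (hP : ∀ i < n, ∀ s, I i s → s.reg (tmpReg (k + 1)) = i → s.reg (tmpReg (k + 2)) = 1 →
      ∃ s' t, Exec P s s' t ∧ t ≤ c ∧ I (i + 1) s' ∧ ∀ j < 3,
        s'.reg (tmpReg (k + j)) = s.reg (tmpReg (k + j)))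
    (h : I 0 s) :
    ∃ s' t, Exec (countLoop k b P) s s' t ∧ t ≤ 4 + n * (c + 3) ∧ I n s' := by
  have key : ∀ m i s, i + m = n → I i s → s.reg (tmpReg k) = m → s.reg (tmpReg (k + 1)) = i →
      s.reg (tmpReg (k + 2)) = 1 → ∃ s' t, Exec (.loop (tmpReg k) (.seq P
        (.seq (.add (tmpReg (k + 1)) (tmpReg (k + 1)) (tmpReg (k + 2)))
          (.sub (tmpReg k) (tmpReg k) (tmpReg (k + 2)))))) s s' t ∧
        t ≤ 1 + m * (c + 3) ∧ I n s' := by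
    intro m
    induction m with
    | zero =>
      intro i s hi h h0 _ _
      obtain rfl : i = n := by omega
      exact ⟨s, 1, .loop_zero h0, by omega, h⟩
    | succ m ih =>
      intro i s hi h h0 h1 h2
      obtain ⟨s₁, t₁, e₁, ht₁, hI₁, hs₁⟩ := hP i (by omega) s h h1 h2
      have g0 := hs₁ 0 (by omega)
      have g1 := hs₁ 1 (by omega)
      have g2 := hs₁ 2 (by omega)
      rw [add_zero] at g0
      set s₂ := s₁.setReg (tmpReg (k + 1)) (s₁.reg (tmpReg (k + 1)) + s₁.reg (tmpReg (k + 2)))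
        with hs₂
      set s₃ := s₂.setReg (tmpReg k) (s₂.reg (tmpReg k) - s₂.reg (tmpReg (k + 2))) with hs₃
      obtain ⟨s', t, e, ht, hI'⟩ := ih (i + 1) s₃ (by omega)
        (hI _ s₁ _ hI₁ rfl (by
          intro r hr0 hr1 hr2
          rw [hs₃, setReg_reg, if_neg hr0, hs₂, setReg_reg, if_neg hr1]))
        (by simp [hs₃, hs₂, setReg_reg, tmpReg_inj, g0, g2, h0, h2])
        (by simp [hs₃, hs₂, setReg_reg, tmpReg_inj, g1, g2, h1, h2])
        (by simp [hs₃, hs₂, setReg_reg, tmpReg_inj, g2, h2])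
      refine ⟨s', (t₁ + (1 + 1)) + t + 1,
        .loop_pos (by omega) (.seq e₁ (.seq (.add _ _ _ _) (.sub _ _ _ _))) e, ?_, hI'⟩
      rw [add_mul]
      omega
  set s₁ := s.setReg (tmpReg k) (s.reg b) with hs₁
  set s₂ := s₁.setReg (tmpReg (k + 1)) 0 with hs₂
  set s₃ := s₂.setReg (tmpReg (k + 2)) 1 with hs₃
  obtain ⟨s', t, e, ht, hI'⟩ := key n 0 s₃ (by omega)
    (hI _ s _ h rfl (by
      intro r hr0 hr1 hr2
      rw [hs₃, setReg_reg, if_neg hr2, hs₂, setReg_reg, if_neg hr1, hs₁, setReg_reg, if_neg hr0]))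
    (by simp [hs₃, hs₂, hs₁, setReg_reg, tmpReg_inj, hb])
    (by simp [hs₃, hs₂, setReg_reg, tmpReg_inj])
    (by simp [hs₃, setReg_reg])
  exact ⟨s', 1 + (1 + (1 + t)), .seq (.copy _ _ _) (.seq (.const _ _ _) (.seq (.const _ _ _) e)),
    by omega, hI'⟩

/-- The compiled expression computes the value of the expression, within the stated time. -/
theorem Exp.exec_compile (Γ : Env) (e : Exp) : ∀ (k : ℕ) (σ : Store) (s : State),
    Represents Γ σ s → ∃ s' t, Exec (e.compile k) s s' t ∧ t ≤ e.cost Γ.par ∧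
      s'.reg (tmpReg k) = e.eval Γ σ.mem σ.var ∧ Agree k s s' := by
  have binary : ∀ (e₁ e₂ : Exp) (f : ℕ → ℕ → ℕ) (P : ℕ → Program)
      (_ : ∀ k s, Exec (P k) s (s.setReg (tmpReg k) (f (s.reg (tmpReg k)) (s.reg (tmpReg (k + 1))))) 1)
      (_ : ∀ (k : ℕ) (σ : Store) (s : State),
        Represents Γ σ s → ∃ s' t, Exec (e₁.compile k) s s' t ∧ t ≤ e₁.cost Γ.par ∧
          s'.reg (tmpReg k) = e₁.eval Γ σ.mem σ.var ∧ Agree k s s')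
      (_ : ∀ (k : ℕ) (σ : Store) (s : State),
        Represents Γ σ s → ∃ s' t, Exec (e₂.compile k) s s' t ∧ t ≤ e₂.cost Γ.par ∧
          s'.reg (tmpReg k) = e₂.eval Γ σ.mem σ.var ∧ Agree k s s')
      (k : ℕ) (σ : Store) (s : State),
      Represents Γ σ s → ∃ s' t, Exec (.seq (e₁.compile k) (.seq (e₂.compile (k + 1)) (P k))) s s' t ∧
        t ≤ e₁.cost Γ.par + e₂.cost Γ.par + 1 ∧
        s'.reg (tmpReg k) = f (e₁.eval Γ σ.mem σ.var) (e₂.eval Γ σ.mem σ.var) ∧ Agree k s s' := by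
    intro e₁ e₂ f P hP ih₁ ih₂ k σ s hs
    obtain ⟨s₁, t₁, x₁, ht₁, hv₁, ha₁⟩ := ih₁ k σ s hs
    obtain ⟨s₂, t₂, x₂, ht₂, hv₂, ha₂⟩ := ih₂ (k + 1) σ s₁ (ha₁.represents hs)
    refine ⟨_, _, .seq x₁ (.seq x₂ (hP k _)), by omega, ?_,
      (ha₁.trans (ha₂.mono (by omega))).trans (Agree.setReg _ _ le_rfl)⟩
    rw [setReg_reg, if_pos rfl, hv₂, ha₂.tmp (by omega), hv₁]
  induction e with
  | par b =>
    intro k σ s hs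
    exact ⟨_, 1, .copy _ _ _, le_rfl, by simp [setReg_reg, hs.par, eval],
      Agree.setReg _ _ le_rfl⟩
  | var x =>
    intro k σ s hs
    exact ⟨_, 1, .copy _ _ _, le_rfl, by simp [setReg_reg, hs.var, eval],
      Agree.setReg _ _ le_rfl⟩
  | const c =>
    intro k σ s hs
    exact ⟨_, 1, .const _ _ _, le_rfl, by simp [setReg_reg, eval], Agree.setReg _ _ le_rfl⟩
  | add e₁ e₂ ih₁ ih₂ => exact binary e₁ e₂ _ _ (fun k s => .add _ _ _ _) ih₁ ih₂
  | sub e₁ e₂ ih₁ ih₂ => exact binary e₁ e₂ _ _ (fun k s => .sub _ _ _ _) ih₁ ih₂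
  | inp a e ih =>
    intro k σ s hs
    obtain ⟨s₁, t₁, x₁, ht₁, hv₁, ha₁⟩ := ih k σ s hs
    refine ⟨_, _, .seq x₁ (.load _ _ _ _), by simp only [cost]; omega, ?_,
      ha₁.trans (Agree.setReg _ _ le_rfl)⟩
    rw [setReg_reg, if_pos rfl, hv₁, (ha₁.represents hs).inp, eval]
  | get a e ih =>
    intro k σ s hs
    obtain ⟨s₁, t₁, x₁, ht₁, hv₁, ha₁⟩ := ih k σ s hs
    refine ⟨_, _, .seq x₁ (.load _ _ _ _), by simp only [cost]; omega, ?_,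
      ha₁.trans (Agree.setReg _ _ le_rfl)⟩
    rw [setReg_reg, if_pos rfl, hv₁, (ha₁.represents hs).mem, eval]
  | ifz e e₁ e₂ ih ih₁ ih₂ =>
    intro k σ s hs
    obtain ⟨s₁, t₁, x₁, ht₁, hv₁, ha₁⟩ := ih k σ s hs
    by_cases h : e.eval Γ σ.mem σ.var = 0
    · obtain ⟨s₂, t₂, x₂, ht₂, hv₂, ha₂⟩ := ih₁ k σ s₁ (ha₁.represents hs)
      exact ⟨_, _, .seq x₁ (.branch_zero (hv₁.trans h) x₂), by simp only [cost]; omega,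
        by rw [hv₂, eval, if_pos h], ha₁.trans ha₂⟩
    · obtain ⟨s₂, t₂, x₂, ht₂, hv₂, ha₂⟩ := ih₂ k σ s₁ (ha₁.represents hs)
      exact ⟨_, _, .seq x₁ (.branch_pos (by rwa [hv₁]) x₂), by simp only [cost]; omega,
        by rw [hv₂, eval, if_neg h], ha₁.trans ha₂⟩
  | op d f e₁ e₂ ih₁ ih₂ =>
    intro k σ s hs
    obtain ⟨s₁, t₁, x₁, ht₁, hv₁, ha₁⟩ := ih₁ k σ s hs
    obtain ⟨s₂, t₂, x₂, ht₂, hv₂, ha₂⟩ := ih₂ (k + 1) σ s₁ (ha₁.represents hs)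
    have hv₁' : s₂.reg (tmpReg k) = e₁.eval Γ σ.mem σ.var := by rw [ha₂.tmp (by omega), hv₁]
    set s₃ := s₂.setReg (tmpReg (k + 2)) 1 with hs₃
    have ha₃ : Agree k s s₃ :=
      (ha₁.trans (ha₂.mono (by omega))).trans (Agree.setReg _ _ (by omega))
    obtain ⟨s', t, x, ht, hq⟩ := exec_select (i := k) (o := k + 2) (c := 2 * d + 1)
      (P := fun i => select (tmpReg (k + 1)) (tmpReg (k + 2))
            (fun j => .const (tmpReg k) (f i j)) d 0)
      (Q := fun s' => s'.reg (tmpReg k) = (op d f e₁ e₂).eval Γ σ.mem σ.var ∧ Agree k s s')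
      (by omega) d 0 s₃ (by rw [hs₃, setReg_reg, if_pos rfl]) (by
        intro s₄ hm₄ hr₄
        refine exec_select (by omega) d 0 s₄ ?_ ?_
        · rw [hr₄ _ (by rw [Ne, tmpReg_inj]; omega), hs₃, setReg_reg, if_pos rfl]
        · intro s₅ hm₅ hr₅
          refine ⟨_, 1, .const _ _ _, le_rfl, ?_, ?_⟩
          · rw [setReg_reg, if_pos rfl, hr₄ _ (by rw [Ne, tmpReg_inj]; omega), hs₃]
            simp only [setReg_reg, tmpReg_inj]
            simp [hv₁', hv₂, eval]
          · refine ha₃.trans ⟨hm₅.trans hm₄, ?_⟩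
            intro r hr
            rw [setReg_reg, if_neg (hr k le_rfl), hr₅ r (hr (k + 1) (by omega)),
              hr₄ r (hr k le_rfl)])
    exact ⟨s', _, .seq x₁ (.seq x₂ (.seq (.const _ _ _) x)), by simp only [cost]; omega, hq.1, hq.2⟩
  | fold b x y e₀ e₁ ih₀ ih₁ =>
    intro k σ s hs
    obtain ⟨s₁, t₁, x₁, ht₁, hv₁, ha₁⟩ := ih₀ (k + 5) σ s hs
    have hs₁ := ha₁.represents hs
    set s₂ := s₁.setReg (tmpReg (k + 3)) (s₁.reg (varReg x)) with hs₂
    set s₃ := s₂.setReg (tmpReg (k + 4)) (s₂.reg (varReg y)) with hs₃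
    let R := iterSteps (fun i r => e₁.eval Γ σ.mem
      (Function.update (Function.update σ.var x i) y r)) (e₀.eval Γ σ.mem σ.var)
    obtain ⟨s₄, t₄, x₄, ht₄, hm₄, hx₄, hy₄, hR₄, hr₄⟩ := exec_countLoop (k := k) (b := b)
      (n := Γ.par b) (c := e₁.cost Γ.par + 3) (s := s₃) (P := (.seq (.copy (varReg x) (tmpReg (k + 1)))
        (.seq (.copy (varReg y) (tmpReg (k + 5))) (.seq (e₁.compile (k + 6))
          (.copy (tmpReg (k + 5)) (tmpReg (k + 6)))))))
      (fun i s' => s'.mem = s.mem ∧ s'.reg (tmpReg (k + 3)) = σ.var x ∧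
        s'.reg (tmpReg (k + 4)) = σ.var y ∧ s'.reg (tmpReg (k + 5)) = R i ∧
        ∀ r, (∀ j, k ≤ j → r ≠ tmpReg j) → r ≠ varReg x → r ≠ varReg y → s'.reg r = s.reg r)
      (by
        rw [← hs₁.par b]
        simp [hs₃, hs₂, setReg_reg, par_ne_tmpReg])
      (by
        rintro i s s' ⟨h1, h2, h3, h4, h5⟩ hm hr
        refine ⟨hm.trans h1, ?_, ?_, ?_, ?_⟩
        · rw [hr _ (by simp [tmpReg_inj]) (by simp [tmpReg_inj]) (by simp [tmpReg_inj]), h2]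
        · rw [hr _ (by simp [tmpReg_inj]) (by simp [tmpReg_inj]) (by simp [tmpReg_inj]), h3]
        · rw [hr _ (by simp [tmpReg_inj]) (by simp [tmpReg_inj]) (by simp [tmpReg_inj]), h4]
        · intro r hr1 hr2 hr3
          rw [hr r (hr1 _ (by omega)) (hr1 _ (by omega)) (hr1 _ (by omega)), h5 r hr1 hr2 hr3])
      (by
        rintro i - q ⟨h1, h2, h3, h4, h5⟩ hi _
        set q₁ := q.setReg (varReg x) (q.reg (tmpReg (k + 1))) with hq₁
        set q₂ := q₁.setReg (varReg y) (q₁.reg (tmpReg (k + 5))) with hq₂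
        have hq : Represents Γ
            ⟨Function.update (Function.update σ.var x i) y (R i), σ.mem⟩ q₂ := by
          refine ⟨fun b => ?_, fun z => ?_, fun a => ?_, fun a => ?_⟩
          · rw [hq₂, setReg_reg, if_neg (par_ne_varReg b _), hq₁, setReg_reg,
              if_neg (par_ne_varReg b _), h5 _ (fun j _ => par_ne_tmpReg b j)
              (par_ne_varReg b _) (par_ne_varReg b _), hs.par]
          · simp only [hq₂, hq₁, setReg_reg, varReg_inj, Function.update_apply, tmpReg_ne_varReg,
              if_false, h4, hi]
            split_ifs with hy hx
            · rfl
            · rfl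
            · rw [h5 _ (fun j _ => varReg_ne_tmpReg z j) (by rwa [Ne, varReg_inj])
                (by rwa [Ne, varReg_inj]), hs.var]
          · change q.mem a = _
            rw [h1, hs.inp]
          · change q.mem (5 + a) = _
            rw [h1, hs.mem]
        obtain ⟨q₃, t₃, w₃, hw₃, hv₃, ha₃⟩ := ih₁ (k + 6) _ q₂ hq
        have htmp : ∀ j < k + 5, q₃.reg (tmpReg j) = q.reg (tmpReg j) := by
          intro j hj
          rw [ha₃.tmp (by omega), hq₂, setReg_reg, if_neg (tmpReg_ne_varReg _ _), hq₁, setReg_reg,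
            if_neg (tmpReg_ne_varReg _ _)]
        refine ⟨_, _, .seq (.copy _ _ _) (.seq (.copy _ _ _) (.seq w₃ (.copy _ _ _))), by omega,
          ⟨?_, ?_, ?_, ?_, ?_⟩, ?_⟩
        · rw [setReg_mem, ha₃.mem]
          exact h1
        · rw [setReg_reg, if_neg (by rw [tmpReg_inj]; omega), htmp _ (by omega), h2]
        · rw [setReg_reg, if_neg (by rw [tmpReg_inj]; omega), htmp _ (by omega), h3]
        · rw [setReg_reg, if_pos rfl, hv₃]
          rfl
        · intro r hr hrx hry
          rw [setReg_reg, if_neg (hr _ (by omega)), ha₃.reg r (fun j hj => hr j (by omega)), hq₂,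
            setReg_reg, if_neg hry, hq₁, setReg_reg, if_neg hrx, h5 r hr hrx hry]
        · intro j hj
          rw [setReg_reg, if_neg (by rw [tmpReg_inj]; omega), htmp _ (by omega)])
      (by
        refine ⟨ha₁.mem, ?_, ?_, ?_, ?_⟩
        · simp [hs₃, hs₂, setReg_reg, tmpReg_inj, hs₁.var]
        · simp [hs₃, hs₂, setReg_reg, hs₁.var, varReg_ne_tmpReg]
        · simp [hs₃, hs₂, setReg_reg, tmpReg_inj, hv₁, R, iterSteps]
        · intro r hr hrx hry
          rw [hs₃, setReg_reg, if_neg (hr _ (by omega)), hs₂, setReg_reg, if_neg (hr _ (by omega)),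
            ha₁.reg r fun j hj => hr j (by omega)])
    refine ⟨_, _, .seq x₁ (.seq (.copy _ _ _) (.seq (.copy _ _ _) (.seq x₄
      (.seq (.copy _ _ _) (.seq (.copy _ _ _) (.copy _ _ _)))))), by simp only [cost]; omega,
      ?_, ⟨hm₄, ?_⟩⟩
    · simp [setReg_reg, tmpReg_ne_varReg, hR₄, R, eval]
    · intro r hr
      rw [setReg_reg, if_neg (hr k le_rfl)]
      simp only [setReg_reg, tmpReg_ne_varReg, if_false, hx₄, hy₄]
      split_ifs with hry hrx
      · rw [hry, hs.var]
      · rw [hrx, hs.var]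
      · exact hr₄ r hr hrx hry

end RAM

namespace RAM

/-- The effect of a machine program: from a state with the data `σ` to one with the data `σ'`, in
at most `c` steps, without changing the first `k` registers for intermediate results. -/
def Realizes (Γ : Env) (P : Program) (k : ℕ) (σ σ' : Store) (c : ℕ) : Prop :=
  ∀ s, Represents Γ σ s → ∃ s' t, Exec P s s' t ∧ t ≤ c ∧ Represents Γ σ' s' ∧
    ∀ j < k, s'.reg (tmpReg j) = s.reg (tmpReg j)

/-- The two loops of `Cmd.fill` that write the values into the buffer. -/
theorem exec_fillBuffer (Γ : Env) (e : Exp) (b b' : Fin 8) (x y k : ℕ) (σ : Store) (s : State)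
    (hs : Represents Γ σ s) (s₁ : State) (hm₁ : s₁.mem = s.mem)
    (hx₁ : s₁.reg (tmpReg (k + 6)) = σ.var x) (hy₁ : s₁.reg (tmpReg (k + 7)) = σ.var y)
    (hp₁ : s₁.reg (tmpReg (k + 8)) = 0)
    (hr₁ : ∀ r, (∀ j, k ≤ j → r ≠ tmpReg j) → s₁.reg r = s.reg r) :
    ∃ s' t, Exec (countLoop k b (countLoop (k + 3) b' (.seq (.copy (varReg x) (tmpReg (k + 1)))
        (.seq (.copy (varReg y) (tmpReg (k + 4))) (.seq (e.compile (k + 9))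
          (.seq (.store 4 (tmpReg (k + 8)) (tmpReg (k + 9)))
            (.add (tmpReg (k + 8)) (tmpReg (k + 8)) (tmpReg (k + 2))))))))) s₁ s' t ∧
      t ≤ 4 + Γ.par b * (4 + Γ.par b' * (e.cost Γ.par + 4 + 3) + 3) ∧
      (∀ a, a ≠ 4 → s'.mem a = s.mem a) ∧
      (∀ t < Γ.par b * Γ.par b', s'.mem 4 t = e.eval Γ σ.mem
        (Function.update (Function.update σ.var x (t / Γ.par b')) y (t % Γ.par b'))) ∧
      s'.reg (tmpReg (k + 6)) = σ.var x ∧ s'.reg (tmpReg (k + 7)) = σ.var y ∧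
      s'.reg (tmpReg (k + 8)) = Γ.par b * Γ.par b' ∧
      ∀ r, (∀ j, k ≤ j → r ≠ tmpReg j) → r ≠ varReg x → r ≠ varReg y → s'.reg r = s.reg r := by
  let Inv : ℕ → State → Prop := fun T s' =>
      (∀ a, a ≠ 4 → s'.mem a = s.mem a) ∧
      (∀ t < T, s'.mem 4 t = e.eval Γ σ.mem
        (Function.update (Function.update σ.var x (t / Γ.par b')) y (t % Γ.par b'))) ∧
      s'.reg (tmpReg (k + 6)) = σ.var x ∧ s'.reg (tmpReg (k + 7)) = σ.var y ∧
      s'.reg (tmpReg (k + 8)) = T ∧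
      ∀ r, (∀ j, k ≤ j → r ≠ tmpReg j) → r ≠ varReg x → r ≠ varReg y → s'.reg r = s.reg r
  have stable : ∀ T q q', Inv T q → q'.mem = q.mem → (∀ r, (∀ j < 6, r ≠ tmpReg (k + j)) →
      q'.reg r = q.reg r) → Inv T q' := by
    rintro T q q' ⟨h1, h2, h3, h4, h5, h6⟩ hm hr
    refine ⟨by rwa [hm], by rwa [hm], ?_, ?_, ?_, ?_⟩
    · rw [hr _ fun j hj => by rw [Ne, tmpReg_inj]; omega, h3]
    · rw [hr _ fun j hj => by rw [Ne, tmpReg_inj]; omega, h4]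
    · rw [hr _ fun j hj => by rw [Ne, tmpReg_inj]; omega, h5]
    · intro r hr1 hr2 hr3
      rw [hr r fun j _ => hr1 _ (by omega), h6 r hr1 hr2 hr3]
  refine exec_countLoop (n := Γ.par b) (fun i => Inv (i * Γ.par b')) ?_ ?_ ?_ ?_
  · rw [hr₁ _ fun j _ => par_ne_tmpReg b j, hs.par]
  · intro i q q' h hm hr
    exact stable _ q q' h hm fun r h => hr r (h 0 (by omega)) (h 1 (by omega)) (h 2 (by omega))
  · intro i hi q hq hqi hq1
    obtain ⟨q', t, hx, ht, ⟨hI, g0, g1, g2⟩⟩ := exec_countLoop (k := k + 3) (b := b')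
      (n := Γ.par b') (c := e.cost Γ.par + 4) (s := q)
      (P := .seq (.copy (varReg x) (tmpReg (k + 1)))
        (.seq (.copy (varReg y) (tmpReg (k + 4))) (.seq (e.compile (k + 9))
          (.seq (.store 4 (tmpReg (k + 8)) (tmpReg (k + 9)))
            (.add (tmpReg (k + 8)) (tmpReg (k + 8)) (tmpReg (k + 2)))))))
      (fun j q' => Inv (i * Γ.par b' + j) q' ∧ q'.reg (tmpReg k) = q.reg (tmpReg k) ∧
        q'.reg (tmpReg (k + 1)) = i ∧ q'.reg (tmpReg (k + 2)) = 1)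
      (by rw [hq.2.2.2.2.2 _ (fun j _ => par_ne_tmpReg b' j) (par_ne_varReg _ _)
        (par_ne_varReg _ _), hs.par])
      (by
        rintro j p p' ⟨hI, h0, h1, h2⟩ hm hr
        refine ⟨stable _ p p' hI hm fun r h =>
          hr r (h 3 (by omega)) (h 4 (by omega)) (h 5 (by omega)), ?_, ?_, ?_⟩
        · rw [hr _ (by simp [tmpReg_inj]) (by simp [tmpReg_inj, add_assoc])
            (by simp [tmpReg_inj, add_assoc]), h0]
        · rw [hr _ (by simp [tmpReg_inj]) (by simp [tmpReg_inj, add_assoc])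
            (by simp [tmpReg_inj, add_assoc]), h1]
        · rw [hr _ (by simp [tmpReg_inj]) (by simp [tmpReg_inj, add_assoc])
            (by simp [tmpReg_inj, add_assoc]), h2])
      (by
        rintro j hj p ⟨⟨h1, h2, h3, h4, h5, h6⟩, g0, g1, g2⟩ hpj _
        set p₁ := p.setReg (varReg x) (p.reg (tmpReg (k + 1))) with hp₁
        set p₂ := p₁.setReg (varReg y) (p₁.reg (tmpReg (k + 4))) with hp₂
        have hp : Represents Γ
            ⟨Function.update (Function.update σ.var x i) y j, σ.mem⟩ p₂ := by
          refine ⟨fun b => ?_, fun z => ?_, fun a => ?_, fun a => ?_⟩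
          · rw [hp₂, setReg_reg, if_neg (par_ne_varReg b _), hp₁, setReg_reg,
              if_neg (par_ne_varReg b _), h6 _ (fun j _ => par_ne_tmpReg b j)
              (par_ne_varReg b _) (par_ne_varReg b _), hs.par]
          · simp only [hp₂, hp₁, setReg_reg, varReg_inj, Function.update_apply, tmpReg_ne_varReg,
              if_false, hpj, g1]
            split_ifs with hy hx
            · rfl
            · rfl
            · rw [h6 _ (fun j _ => varReg_ne_tmpReg z j) (by rwa [Ne, varReg_inj])
                (by rwa [Ne, varReg_inj]), hs.var]
          · change p.mem a = _
            rw [h1 _ (by omega), hs.inp]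
          · change p.mem (5 + a) = _
            rw [h1 _ (by omega), hs.mem]
        obtain ⟨p₃, t₃, w₃, hw₃, hv₃, ha₃⟩ := e.exec_compile Γ (k + 9) _ p₂ hp
        have htmp : ∀ j < k + 9, p₃.reg (tmpReg j) = p.reg (tmpReg j) := by
          intro j hj
          rw [ha₃.tmp hj, hp₂, setReg_reg, if_neg (tmpReg_ne_varReg _ _), hp₁, setReg_reg,
            if_neg (tmpReg_ne_varReg _ _)]
        have hmem₃ : p₃.mem = p.mem := ha₃.mem
        refine ⟨_, _, .seq (.copy _ _ _) (.seq (.copy _ _ _) (.seq w₃ (.seq (.store _ _ _ _)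
          (.add _ _ _ _)))), by omega, ⟨⟨?_, ?_, ?_, ?_, ?_, ?_⟩, ?_, ?_, ?_⟩, ?_⟩
        · intro a ha
          rw [setReg_mem]
          funext t
          rw [setMem_mem, if_neg (fun h => ha h.1), hmem₃, h1 a ha]
        · intro t ht
          rw [setReg_mem, setMem_mem, htmp _ (by omega), h5, hmem₃]
          by_cases htl : t = i * Γ.par b' + j
          · have hpos : 0 < Γ.par b' := by omega
            rw [if_pos ⟨rfl, htl⟩, hv₃, htl, mul_comm i, Nat.mul_add_div hpos,
              Nat.div_eq_of_lt hj, Nat.mul_add_mod, Nat.mod_eq_of_lt hj, add_zero]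
          · rw [if_neg (fun h => htl h.2), h2 t (by omega)]
        · rw [setReg_reg, if_neg (by rw [tmpReg_inj]; omega), setMem_reg, htmp _ (by omega), h3]
        · rw [setReg_reg, if_neg (by rw [tmpReg_inj]; omega), setMem_reg, htmp _ (by omega), h4]
        · rw [setReg_reg, if_pos rfl, setMem_reg, htmp _ (by omega), htmp _ (by omega), h5, g2,
            add_assoc]
        · intro r hr hrx hry
          rw [setReg_reg, if_neg (hr _ (by omega)), setMem_reg,
            ha₃.reg r (fun j hj => hr j (by omega)), hp₂, setReg_reg, if_neg hry, hp₁, setReg_reg,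
            if_neg hrx, h6 r hr hrx hry]
        · rw [setReg_reg, if_neg (by rw [tmpReg_inj]; omega), setMem_reg, htmp _ (by omega), g0]
        · rw [setReg_reg, if_neg (by rw [tmpReg_inj]; omega), setMem_reg, htmp _ (by omega), g1]
        · rw [setReg_reg, if_neg (by rw [tmpReg_inj]; omega), setMem_reg, htmp _ (by omega), g2]
        · intro j hj
          rw [setReg_reg, if_neg (by rw [tmpReg_inj]; omega), setMem_reg, htmp _ (by omega)])
      ⟨hq, rfl, hqi, hq1⟩
    refine ⟨q', t, hx, ht, by rwa [add_mul, one_mul], ?_⟩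
    intro j hj
    interval_cases j
    · exact g0
    · rw [g1, hqi]
    · rw [g2, hq1]
  · refine ⟨fun a _ => by rw [hm₁], fun t ht => by omega, hx₁, hy₁, by rw [hp₁, zero_mul], ?_⟩
    intro r hr _ _
    exact hr₁ r hr

/-- The loop of `Cmd.fill` that copies the buffer. -/
theorem exec_copyBuffer (k a n : ℕ) (s : State) (hn : s.reg (tmpReg (k + 8)) = n) :
    ∃ s' t, Exec (countLoop k (tmpReg (k + 8)) (.seq (.load (tmpReg (k + 9)) 4 (tmpReg (k + 1)))
        (.store (5 + a) (tmpReg (k + 1)) (tmpReg (k + 9))))) s s' t ∧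
      t ≤ 4 + n * (2 + 3) ∧
      (∀ c, c ≠ 5 + a → s'.mem c = s.mem c) ∧
      (∀ t, s'.mem (5 + a) t = if t < n then s.mem 4 t else s.mem (5 + a) t) ∧
      ∀ r, (∀ j, k ≤ j → r ≠ tmpReg j) → s'.reg r = s.reg r := by
  refine exec_countLoop (fun i s' => (∀ c, c ≠ 5 + a → s'.mem c = s.mem c) ∧
      (∀ t, s'.mem (5 + a) t = if t < i then s.mem 4 t else s.mem (5 + a) t) ∧
      ∀ r, (∀ j, k ≤ j → r ≠ tmpReg j) → s'.reg r = s.reg r) hn ?_ ?_ ?_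
  · rintro i q q' ⟨h1, h2, h3⟩ hm hr
    refine ⟨by rwa [hm], by rwa [hm], ?_⟩
    intro r h
    rw [hr r (h _ (by omega)) (h _ (by omega)) (h _ (by omega)), h3 r h]
  · rintro i hi q ⟨h1, h2, h3⟩ hqi _
    refine ⟨_, _, .seq (.load _ _ _ _) (.store _ _ _ _), by omega, ⟨?_, ?_, ?_⟩, ?_⟩
    · intro c hc
      funext t
      rw [setMem_mem, if_neg (fun h => hc h.1), setReg_mem, h1 c hc]
    · intro t
      have hidx : (q.setReg (tmpReg (k + 9)) (q.mem 4 (q.reg (tmpReg (k + 1))))).reg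
          (tmpReg (k + 1)) = i := by
        rw [setReg_reg, if_neg (by rw [tmpReg_inj]; omega), hqi]
      rw [setMem_mem, hidx, setReg_reg, if_pos rfl, hqi, h1 4 (by omega), setReg_mem, h2]
      by_cases ht : t = i
      · subst ht
        simp
      · rw [if_neg (fun h => ht h.2)]
        by_cases ht' : t < i
        · rw [if_pos ht', if_pos (by omega)]
        · rw [if_neg ht', if_neg (by omega)]
    · intro r h
      rw [setMem_reg, setReg_reg, if_neg (h _ (by omega)), h3 r h]
    · intro j hj
      rw [setMem_reg, setReg_reg, if_neg (by rw [tmpReg_inj]; omega)]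
  · exact ⟨fun _ _ => rfl, fun t => by simp, fun _ _ => rfl⟩

/-- The compiled program has the effect of the loop program. -/
theorem Cmd.realizes (Γ : Env) (c : Cmd) : ∀ (k : ℕ) (σ : Store),
    Realizes Γ (c.compile k) k σ (c.run Γ σ) (c.cost Γ.par) := by
  induction c with
  | set x e =>
    intro k σ s hs
    obtain ⟨s₁, t₁, x₁, ht₁, hv₁, ha₁⟩ := e.exec_compile Γ k σ s hs
    refine ⟨_, _, .seq x₁ (.copy _ _ _), by simp only [cost]; omega, ?_, ?_⟩
    · rw [hv₁]
      exact (ha₁.represents hs).setVar x _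
    · intro j hj
      rw [setReg_reg, if_neg (tmpReg_ne_varReg _ _), ha₁.tmp hj]
  | seq c₁ c₂ ih₁ ih₂ =>
    intro k σ s hs
    obtain ⟨s₁, t₁, x₁, ht₁, hr₁, ha₁⟩ := ih₁ k σ s hs
    obtain ⟨s₂, t₂, x₂, ht₂, hr₂, ha₂⟩ := ih₂ k _ s₁ hr₁
    exact ⟨s₂, _, .seq x₁ x₂, by simp only [cost]; omega, hr₂,
      fun j hj => (ha₂ j hj).trans (ha₁ j hj)⟩
  | iterate b x c ih =>
    intro k σ s hs
    refine exec_countLoop (n := Γ.par b) (c := 1 + c.cost Γ.par) (s := s)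
      (fun i s' => Represents Γ (iterSteps (fun i σ =>
        c.run Γ { σ with var := Function.update σ.var x i }) σ i) s' ∧
        ∀ j < k, s'.reg (tmpReg j) = s.reg (tmpReg j)) (hs.par b) ?_ ?_ ⟨hs, fun _ _ => rfl⟩
    · rintro i q q' ⟨h1, h2⟩ hm hr
      refine ⟨Agree.represents (k := k) ⟨hm, ?_⟩ h1, ?_⟩
      · intro r h
        exact hr r (h _ (by omega)) (h _ (by omega)) (h _ (by omega))
      · intro j hj
        rw [hr _ (by rw [Ne, tmpReg_inj]; omega) (by rw [Ne, tmpReg_inj]; omega)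
          (by rw [Ne, tmpReg_inj]; omega), h2 j hj]
    · rintro i hi q ⟨h1, h2⟩ hqi _
      obtain ⟨q', t, hx, ht, hr, hj⟩ := ih (k + 3) _ _ (h1.setVar x i)
      rw [← hqi] at hx
      have hj' : ∀ j < k + 3, q'.reg (tmpReg j) = q.reg (tmpReg j) := by
        intro j h
        rw [hj j h, setReg_reg, if_neg (tmpReg_ne_varReg _ _)]
      exact ⟨q', _, .seq (.copy _ _ _) hx, by omega,
        ⟨hr, fun j h => by rw [hj' j (by omega), h2 j h]⟩, fun j h => hj' _ (by omega)⟩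
  | fill a b x b' y e =>
    intro k σ s hs
    set s₁ := s.setReg (tmpReg (k + 6)) (s.reg (varReg x)) with hs₁
    set s₂ := s₁.setReg (tmpReg (k + 7)) (s₁.reg (varReg y)) with hs₂
    set s₃ := s₂.setReg (tmpReg (k + 8)) 0 with hs₃
    obtain ⟨q, t, hx, ht, hm, hv, hqx, hqy, hqp, hqr⟩ := exec_fillBuffer Γ e b b' x y k σ s hs s₃ rfl
      (by simp [hs₃, hs₂, hs₁, setReg_reg, tmpReg_inj, hs.var])
      (by simp [hs₃, hs₂, hs₁, setReg_reg, tmpReg_inj, hs.var, varReg_ne_tmpReg])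
      (by simp [hs₃, setReg_reg])
      (by
        intro r h
        rw [hs₃, setReg_reg, if_neg (h _ (by omega)), hs₂, setReg_reg, if_neg (h _ (by omega)),
          hs₁, setReg_reg, if_neg (h _ (by omega))])
    set q₁ := q.setReg (varReg x) (q.reg (tmpReg (k + 6))) with hq₁
    set q₂ := q₁.setReg (varReg y) (q₁.reg (tmpReg (k + 7))) with hq₂
    have hq₂r : ∀ r, (∀ j, k ≤ j → r ≠ tmpReg j) → q₂.reg r = s.reg r := by
      intro r hr
      simp only [hq₂, hq₁, setReg_reg, tmpReg_ne_varReg, if_false, hqx, hqy]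
      split_ifs with hry hrx
      · rw [hry, hs.var]
      · rw [hrx, hs.var]
      · exact hqr r hr hrx hry
    obtain ⟨s', t', hx', ht', hm', hv', hr'⟩ := exec_copyBuffer k a (Γ.par b * Γ.par b') q₂
      (by simp [hq₂, hq₁, setReg_reg, tmpReg_ne_varReg, hqp])
    have hm₂ : q₂.mem = q.mem := rfl
    refine ⟨s', _, .seq (.copy _ _ _) (.seq (.copy _ _ _) (.seq (.const _ _ _) (.seq hx
      (.seq (.copy _ _ _) (.seq (.copy _ _ _) hx'))))), by simp only [cost]; omega,
      ⟨fun d => ?_, fun z => ?_, fun d => ?_, fun d => ?_⟩, fun j hj => ?_⟩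
    · rw [hr' _ fun j _ => par_ne_tmpReg d j, hq₂r _ fun j _ => par_ne_tmpReg d j, hs.par]
    · rw [hr' _ fun j _ => varReg_ne_tmpReg z j, hq₂r _ fun j _ => varReg_ne_tmpReg z j, hs.var]
      rfl
    · rw [hm' _ (by omega), hm₂, hm _ (by omega), hs.inp]
    · by_cases hd : d = a
      · subst hd
        funext t
        simp only [run, Function.update_self]
        rw [hv', hm₂, hm (5 + d) (by omega), hs.mem]
        by_cases ht : t < Γ.par b * Γ.par b'
        · rw [if_pos ht, if_pos ht, hv t ht]
        · rw [if_neg ht, if_neg ht]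
      · simp only [run]
        rw [Function.update_of_ne hd, hm' _ (by omega), hm₂, hm _ (by omega), hs.mem]
    · rw [hr' _ (fun i hi => by rw [Ne, tmpReg_inj]; omega),
        hq₂r _ (fun i hi => by rw [Ne, tmpReg_inj]; omega)]

/-! ### Running time -/

/-- The coefficient of a polynomial bound for the running time of an expression. -/
def Exp.coeff : Exp → ℕ
  | .par _ => 1
  | .var _ => 1
  | .const _ => 1
  | .add e₁ e₂ => e₁.coeff + e₂.coeff + 1
  | .sub e₁ e₂ => e₁.coeff + e₂.coeff + 1
  | .inp _ e => e.coeff + 1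
  | .get _ e => e.coeff + 1
  | .ifz e e₁ e₂ => e.coeff + (e₁.coeff + e₂.coeff) + 1
  | .op d _ e₁ e₂ => e₁.coeff + e₂.coeff + 1 + (2 * d + (2 * d + 1))
  | .fold _ _ _ e₀ e₁ => e₀.coeff + e₁.coeff + 15

/-- The degree of a polynomial bound for the running time of an expression. -/
def Exp.degree : Exp → ℕ
  | .par _ => 0
  | .var _ => 0
  | .const _ => 0
  | .add e₁ e₂ => e₁.degree + e₂.degree
  | .sub e₁ e₂ => e₁.degree + e₂.degree
  | .inp _ e => e.degree
  | .get _ e => e.degree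
  | .ifz e e₁ e₂ => e.degree + (e₁.degree + e₂.degree)
  | .op _ _ e₁ e₂ => e₁.degree + e₂.degree
  | .fold _ _ _ e₀ e₁ => e₀.degree + e₁.degree + 1

/-- The first two parameters do not bound a loop in the expression. -/
def Exp.Inner : Exp → Prop
  | .par _ => True
  | .var _ => True
  | .const _ => True
  | .add e₁ e₂ => e₁.Inner ∧ e₂.Inner
  | .sub e₁ e₂ => e₁.Inner ∧ e₂.Inner
  | .inp _ e => e.Inner
  | .get _ e => e.Inner
  | .ifz e e₁ e₂ => e.Inner ∧ e₁.Inner ∧ e₂.Inner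
  | .op _ _ e₁ e₂ => e₁.Inner ∧ e₂.Inner
  | .fold b _ _ e₀ e₁ => 2 ≤ b ∧ e₀.Inner ∧ e₁.Inner

/-- The coefficient of a polynomial bound for the running time of a loop program. -/
def Cmd.coeff : Cmd → ℕ
  | .set _ e => e.coeff + 1
  | .fill _ _ _ _ _ e => e.coeff + 33
  | .seq c₁ c₂ => c₁.coeff + c₂.coeff
  | .iterate _ _ c => c.coeff + 8

/-- The degree of a polynomial bound for the running time of a loop program. -/
def Cmd.degree : Cmd → ℕ
  | .set _ e => e.degree
  | .fill _ _ _ _ _ e => e.degree + 2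
  | .seq c₁ c₂ => c₁.degree + c₂.degree
  | .iterate _ _ c => c.degree + 1

/-- The first two parameters do not bound a loop in the program. -/
def Cmd.Inner : Cmd → Prop
  | .set _ e => e.Inner
  | .fill _ b _ b' _ e => 2 ≤ b ∧ 2 ≤ b' ∧ e.Inner
  | .seq c₁ c₂ => c₁.Inner ∧ c₂.Inner
  | .iterate b _ c => 2 ≤ b ∧ c.Inner

/-- The first two parameters bound only outermost loops of the program. -/
def Cmd.Outer : Cmd → Prop
  | .set _ e => e.Inner
  | .fill _ b _ b' _ e => 2 ≤ b ∧ 2 ≤ b' ∧ e.Inner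
  | .seq c₁ c₂ => c₁.Outer ∧ c₂.Outer
  | .iterate _ _ c => c.Inner

theorem mul_pow_le_mul_pow {K D D' B : ℕ} (hD : D ≤ D') : K * (B + 1) ^ D ≤ K * (B + 1) ^ D' :=
  Nat.mul_le_mul_left _ (Nat.pow_le_pow_right (by omega) hD)

theorem le_mul_pow_succ (K B D : ℕ) : K ≤ K * (B + 1) ^ D :=
  Nat.le_mul_of_pos_right _ (by positivity)

theorem Exp.cost_le {par : Fin 8 → ℕ} {B : ℕ} (hB : ∀ b : Fin 8, 2 ≤ b → par b ≤ B) (e : Exp)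
    (he : e.Inner) : e.cost par ≤ e.coeff * (B + 1) ^ e.degree := by
  induction e with
  | par | var | const => simp [cost, coeff, degree]
  | add e₁ e₂ ih₁ ih₂ | sub e₁ e₂ ih₁ ih₂ =>
    have h1 := (ih₁ he.1).trans (mul_pow_le_mul_pow (Nat.le_add_right _ e₂.degree))
    have h2 := (ih₂ he.2).trans (mul_pow_le_mul_pow (Nat.le_add_left _ e₁.degree))
    have h3 := le_mul_pow_succ 1 B (e₁.degree + e₂.degree)
    simp only [cost, coeff, degree, add_mul]
    omega
  | inp a e ih | get a e ih =>
    have h1 := ih he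
    have h3 := le_mul_pow_succ 1 B e.degree
    simp only [cost, coeff, degree, add_mul]
    omega
  | ifz e e₁ e₂ ih ih₁ ih₂ =>
    have h1 := (ih he.1).trans (mul_pow_le_mul_pow (D' := e.degree + (e₁.degree + e₂.degree))
      (by omega))
    have h2 := (ih₁ he.2.1).trans (mul_pow_le_mul_pow
      (D' := e.degree + (e₁.degree + e₂.degree)) (by omega))
    have h3 := (ih₂ he.2.2).trans (mul_pow_le_mul_pow
      (D' := e.degree + (e₁.degree + e₂.degree)) (by omega))
    have h4 := le_mul_pow_succ 1 B (e.degree + (e₁.degree + e₂.degree))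
    simp only [cost, coeff, degree, add_mul] at *
    omega
  | op d f e₁ e₂ ih₁ ih₂ =>
    have h1 := (ih₁ he.1).trans (mul_pow_le_mul_pow (Nat.le_add_right _ e₂.degree))
    have h2 := (ih₂ he.2).trans (mul_pow_le_mul_pow (Nat.le_add_left _ e₁.degree))
    have h3 := le_mul_pow_succ (1 + (2 * d + (2 * d + 1))) B (e₁.degree + e₂.degree)
    have : (op d f e₁ e₂).coeff = e₁.coeff + e₂.coeff + (1 + (2 * d + (2 * d + 1))) := by
      simp only [coeff]
      omega
    rw [this]
    simp only [cost, degree]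
    rw [add_mul _ (1 + (2 * d + (2 * d + 1))), add_mul]
    omega
  | fold b x y e₀ e₁ ih₀ ih₁ =>
    have h1 := (ih₀ he.2.1).trans (mul_pow_le_mul_pow (D' := e₀.degree + e₁.degree + 1) (by omega))
    have h2 := (ih₁ he.2.2).trans (mul_pow_le_mul_pow (D' := e₀.degree + e₁.degree) (by omega))
    have h3 := le_mul_pow_succ 6 B (e₀.degree + e₁.degree)
    have h4 := le_mul_pow_succ 9 B (e₀.degree + e₁.degree + 1)
    have h5 : par b * (e₁.cost par + 6) ≤ (B + 1) *
        (e₁.coeff * (B + 1) ^ (e₀.degree + e₁.degree) + 6 * (B + 1) ^ (e₀.degree + e₁.degree)) :=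
      Nat.mul_le_mul ((hB b he.1).trans (by omega)) (by omega)
    have h6 : (B + 1) *
        (e₁.coeff * (B + 1) ^ (e₀.degree + e₁.degree) + 6 * (B + 1) ^ (e₀.degree + e₁.degree)) =
        (e₁.coeff + 6) * (B + 1) ^ (e₀.degree + e₁.degree + 1) := by ring
    have h7 : (fold b x y e₀ e₁).coeff * (B + 1) ^ (e₀.degree + e₁.degree + 1) =
        e₀.coeff * (B + 1) ^ (e₀.degree + e₁.degree + 1) +
        (e₁.coeff + 6) * (B + 1) ^ (e₀.degree + e₁.degree + 1) +
        9 * (B + 1) ^ (e₀.degree + e₁.degree + 1) := by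
      simp only [coeff]
      ring
    simp only [cost, degree]
    rw [h7]
    have : e₁.cost par + 3 + 3 = e₁.cost par + 6 := by omega
    rw [this]
    omega

theorem Cmd.cost_le {par : Fin 8 → ℕ} {B : ℕ} (hB : ∀ b : Fin 8, 2 ≤ b → par b ≤ B) (c : Cmd)
    (hc : c.Inner) : c.cost par ≤ c.coeff * (B + 1) ^ c.degree := by
  induction c with
  | set x e =>
    have h1 := e.cost_le hB hc
    have h2 := le_mul_pow_succ 1 B e.degree
    simp only [cost, coeff, degree, add_mul]
    omega
  | seq c₁ c₂ ih₁ ih₂ =>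
    have h1 := (ih₁ hc.1).trans (mul_pow_le_mul_pow (Nat.le_add_right _ c₂.degree))
    have h2 := (ih₂ hc.2).trans (mul_pow_le_mul_pow (Nat.le_add_left _ c₁.degree))
    simp only [cost, coeff, degree, add_mul]
    omega
  | iterate b x c ih =>
    have h1 := ih hc.2
    have h2 := le_mul_pow_succ 4 B c.degree
    have h3 := le_mul_pow_succ 4 B (c.degree + 1)
    have h5 : par b * (1 + c.cost par + 3) ≤ (B + 1) *
        (c.coeff * (B + 1) ^ c.degree + 4 * (B + 1) ^ c.degree) :=
      Nat.mul_le_mul ((hB b hc.1).trans (by omega)) (by omega)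
    have h6 : (B + 1) * (c.coeff * (B + 1) ^ c.degree + 4 * (B + 1) ^ c.degree) +
        4 * (B + 1) ^ (c.degree + 1) = (c.coeff + 8) * (B + 1) ^ (c.degree + 1) := by ring
    simp only [cost, coeff, degree]
    omega
  | fill a b x b' y e =>
    have h1 := e.cost_le hB hc.2.2
    have h2 := le_mul_pow_succ 7 B e.degree
    have h3 := le_mul_pow_succ 7 B (e.degree + 1)
    have h4 := le_mul_pow_succ 14 B (e.degree + 2)
    have hb : par b ≤ B + 1 := (hB b hc.1).trans (by omega)
    have hb' : par b' ≤ B + 1 := (hB b' hc.2.1).trans (by omega)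
    have h5 : par b' * (e.cost par + 4 + 3) ≤ (B + 1) *
        (e.coeff * (B + 1) ^ e.degree + 7 * (B + 1) ^ e.degree) :=
      Nat.mul_le_mul hb' (by omega)
    have h6 : (B + 1) * (e.coeff * (B + 1) ^ e.degree + 7 * (B + 1) ^ e.degree) =
        (e.coeff + 7) * (B + 1) ^ (e.degree + 1) := by ring
    have h7 : par b * (4 + par b' * (e.cost par + 4 + 3) + 3) ≤ (B + 1) *
        ((e.coeff + 7) * (B + 1) ^ (e.degree + 1) + 7 * (B + 1) ^ (e.degree + 1)) :=
      Nat.mul_le_mul hb (by omega)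
    have h8 : par b * par b' ≤ (B + 1) ^ 2 * (B + 1) ^ e.degree := by
      calc par b * par b' ≤ (B + 1) * (B + 1) := Nat.mul_le_mul hb hb'
        _ = (B + 1) ^ 2 := by ring
        _ ≤ _ := Nat.le_mul_of_pos_right _ (by positivity)
    have h9 : (e.coeff + 33) * (B + 1) ^ (e.degree + 2) =
        (B + 1) * ((e.coeff + 7) * (B + 1) ^ (e.degree + 1) + 7 * (B + 1) ^ (e.degree + 1)) +
        5 * ((B + 1) ^ 2 * (B + 1) ^ e.degree) + 14 * (B + 1) ^ (e.degree + 2) := by ring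
    simp only [cost, coeff, degree]
    omega

theorem Cmd.cost_le_of_outer {par : Fin 8 → ℕ} {B : ℕ} (hB : ∀ b : Fin 8, 2 ≤ b → par b ≤ B)
    (c : Cmd) (hc : c.Outer) :
    c.cost par ≤ c.coeff * (B + 1) ^ c.degree * (1 + par 0 + par 1) := by
  have inner : ∀ c : Cmd, c.Inner →
      c.cost par ≤ c.coeff * (B + 1) ^ c.degree * (1 + par 0 + par 1) := fun c hc =>
    (c.cost_le hB hc).trans (Nat.le_mul_of_pos_right _ (by omega))
  induction c with
  | set x e => exact inner _ hc
  | fill a b x b' y e => exact inner _ hc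
  | seq c₁ c₂ ih₁ ih₂ =>
    have h1 := (ih₁ hc.1).trans (Nat.mul_le_mul_right _
      (mul_pow_le_mul_pow (Nat.le_add_right _ c₂.degree)))
    have h2 := (ih₂ hc.2).trans (Nat.mul_le_mul_right _
      (mul_pow_le_mul_pow (Nat.le_add_left _ c₁.degree)))
    simp only [cost, coeff, degree, add_mul _ _ ((B + 1) ^ _)]
    rw [add_mul]
    omega
  | iterate b x c _ =>
    by_cases hb : 2 ≤ b
    · exact inner _ ⟨hb, hc⟩
    · have h1 := c.cost_le hB hc
      have hb' : par b ≤ par 0 + par 1 := by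
        have : b = 0 ∨ b = 1 := by omega
        rcases this with rfl | rfl <;> omega
      have h2 := le_mul_pow_succ 4 B c.degree
      have h3 := h1.trans (mul_pow_le_mul_pow (show c.degree ≤ c.degree + 1 by omega))
      have h4 := le_mul_pow_succ 4 B (c.degree + 1)
      have h5 : par b * (1 + c.cost par + 3) ≤ (par 0 + par 1) *
          ((c.coeff + 8) * (B + 1) ^ (c.degree + 1)) := by
        refine Nat.mul_le_mul hb' ?_
        rw [add_mul]
        omega
      have h6 : 4 ≤ (c.coeff + 8) * (B + 1) ^ (c.degree + 1) := by
        rw [add_mul]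
        omega
      simp only [cost, coeff, degree]
      calc 4 + par b * (1 + c.cost par + 3)
          ≤ (c.coeff + 8) * (B + 1) ^ (c.degree + 1) +
            (par 0 + par 1) * ((c.coeff + 8) * (B + 1) ^ (c.degree + 1)) := by omega
        _ = _ := by ring

end RAM

/-! ### Linear algebra of the algorithm -/

section Elimination

variable {F : Type*} [Field F]

/-- One elimination step: from vectors that span `S` to vectors, equally many, that span the kernel
of a linear form `w` on `S`. The pivot `p` is any index with `w (v p) ≠ 0`; if there is none, the
vectors do not change, whatever `p` is. -/
theorem span_eliminate {V ι : Type*} [AddCommGroup V] [Module F V] [Fintype ι] (v : ι → V)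
    (w : V →ₗ[F] F) (p : ι) (hp : w (v p) = 0 → ∀ i, w (v i) = 0) :
    Submodule.span F (Set.range fun i => v i - (w (v i) * (w (v p))⁻¹) • v p) =
      Submodule.span F (Set.range v) ⊓ LinearMap.ker w := by
  apply le_antisymm
  · rw [Submodule.span_le]
    rintro _ ⟨i, rfl⟩
    refine ⟨?_, ?_⟩
    · exact Submodule.sub_mem _ (Submodule.subset_span ⟨i, rfl⟩)
        (Submodule.smul_mem _ _ (Submodule.subset_span ⟨p, rfl⟩))
    · rw [SetLike.mem_coe, LinearMap.mem_ker, map_sub, map_smul, smul_eq_mul]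
      by_cases h : w (v p) = 0
      · rw [hp h i]
        simp
      · field_simp
        ring
  · rintro x ⟨hx, hwx⟩
    rw [SetLike.mem_coe, Submodule.mem_span_range_iff_exists_fun] at hx
    obtain ⟨c, rfl⟩ := hx
    have hw : ∑ i, c i * w (v i) = 0 := by
      have : w (∑ i, c i • v i) = 0 := hwx
      simpa using this
    have : ∑ i, c i • v i = ∑ i, c i • (v i - (w (v i) * (w (v p))⁻¹) • v p) := by
      simp only [smul_sub, Finset.sum_sub_distrib, smul_smul, ← mul_assoc]
      rw [← Finset.sum_smul, ← Finset.sum_mul, hw]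
      simp
    rw [this]
    exact Submodule.sum_mem _ fun i _ => Submodule.smul_mem _ _ (Submodule.subset_span ⟨i, rfl⟩)

/-- A vector orthogonal to everything orthogonal to `T` lies in the span of `T`. -/
theorem mem_span_of_dotProduct {n : ℕ} (T : Set (Fin n → F)) (y : Fin n → F) :
    y ∈ Submodule.span F T ↔ ∀ x : Fin n → F, (∀ t ∈ T, x ⬝ᵥ t = 0) → x ⬝ᵥ y = 0 := by
  constructor
  · intro hy x hx
    induction hy using Submodule.span_induction with
    | mem t ht => exact hx t ht
    | zero => simp
    | add a b _ _ ha hb => rw [dotProduct_add, ha, hb, add_zero]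
    | smul c a _ ha => rw [dotProduct_smul, ha, smul_zero]
  · intro h
    by_contra hy
    obtain ⟨f, hf, hle⟩ := Submodule.exists_le_ker_of_notMem hy
    have hfx : ∀ z, (fun i => f (Pi.single i 1)) ⬝ᵥ z = f z := by
      intro z
      conv_rhs => rw [← Finset.univ_sum_single z, map_sum]
      refine Finset.sum_congr rfl fun i _ => ?_
      have : (Pi.single i (z i) : Fin n → F) = z i • Pi.single i 1 := by
        rw [← Pi.single_smul, smul_eq_mul, mul_one]
      rw [this, map_smul, smul_eq_mul, mul_comm]
    apply hf
    rw [← hfx]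
    exact h _ fun t ht => by rw [hfx]; exact hle (Submodule.subset_span ht)

end Elimination

section Flag

variable {F : Type*} [Field F] {V : Type*} [AddCommGroup V] [Module F V]

/-- The iterates of a monotone map on the whole space decrease; if they reach zero, they reach it
after as many steps as the dimension says, since they are constant once two of them agree. -/
theorem iterate_finrank_eq_bot [FiniteDimensional F V] (f : Submodule F V → Submodule F V)
    (hf : Monotone f) {m : ℕ} (hm : f^[m] ⊤ = ⊥) : f^[Module.finrank F V] ⊤ = ⊥ := by
  have hanti : ∀ k, f^[k + 1] ⊤ ≤ f^[k] ⊤ := by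
    intro k
    rw [Function.iterate_succ_apply]
    exact hf.iterate k le_top
  have key : ∀ k, f^[k] ⊤ = ⊥ ∨ Module.finrank F (f^[k] ⊤ : Submodule F V) + k ≤
      Module.finrank F V := by
    intro k
    induction k with
    | zero => right; exact (finrank_top F V).le
    | succ k ih =>
      rcases ih with h | h
      · left
        rw [eq_bot_iff, ← h]
        exact hanti k
      · by_cases heq : f^[k + 1] ⊤ = f^[k] ⊤
        · left
          have hconst : ∀ j, f^[k + j] ⊤ = f^[k] ⊤ := by
            intro j
            induction j with
            | zero => rfl
            | succ j ih =>
              rw [← add_assoc, Function.iterate_succ_apply', ih, ← Function.iterate_succ_apply' f k,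
                heq]
          have h1 : f^[k + m] ⊤ = ⊥ := by
            rw [eq_bot_iff, ← hm, Function.iterate_add_apply, ← Function.iterate_add_apply,
              add_comm, Function.iterate_add_apply]
            exact hf.iterate m le_top
          rw [heq, ← hconst m, h1]
        · right
          have := Submodule.finrank_lt_finrank_of_lt (lt_of_le_of_ne (hanti k) heq)
          omega
  rcases key (Module.finrank F V) with h | h
  · exact h
  · rw [← Submodule.finrank_eq_zero (R := F)]
    omega

end Flag

section MatrixAlgebra

variable {F : Type*} [Field F] {N : ℕ} {ι : Type*}

/-- The span of the images of a subspace under some matrices. -/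
def imageSpan (B : ι → Matrix (Fin N) (Fin N) F) (U : Submodule F (Fin N → F)) :
    Submodule F (Fin N → F) :=
  Submodule.span F {y | ∃ i, ∃ s ∈ U, y = (B i).mulVec s}

theorem imageSpan_mono (B : ι → Matrix (Fin N) (Fin N) F) : Monotone (imageSpan B) := by
  intro U U' h
  apply Submodule.span_mono
  rintro y ⟨i, s, hs, rfl⟩
  exact ⟨i, s, h hs, rfl⟩

/-- Images under `B` may be computed from a spanning set. -/
theorem imageSpan_span (B : ι → Matrix (Fin N) (Fin N) F) {κ : Type*} (s : κ → Fin N → F) :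
    imageSpan B (Submodule.span F (Set.range s)) =
      Submodule.span F {y | ∃ i j, y = (B i).mulVec (s j)} := by
  apply le_antisymm
  · rw [imageSpan, Submodule.span_le]
    rintro _ ⟨i, t, ht, rfl⟩
    induction ht using Submodule.span_induction with
    | mem t ht =>
      obtain ⟨j, rfl⟩ := ht
      exact Submodule.subset_span ⟨i, j, rfl⟩
    | zero => simp
    | add a b _ _ ha hb =>
      rw [Matrix.mulVec_add]
      exact Submodule.add_mem _ ha hb
    | smul c a _ ha =>
      rw [Matrix.mulVec_smul]
      exact Submodule.smul_mem _ _ ha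
  · apply Submodule.span_mono
    rintro _ ⟨i, j, rfl⟩
    exact ⟨i, s j, Submodule.subset_span ⟨j, rfl⟩, rfl⟩

/-- An algebra `C` of matrices that is spanned by some matrices `A i` consists of matrices that are
scalar plus nilpotent iff the matrices `A i - γ i`, where `γ i` is the only candidate for the
scalar, generate a nilpotent algebra, that is, their iterated images reach zero. -/
theorem isScalarPlusNilpotent_iff_iterate (C : Subalgebra F (Matrix (Fin N) (Fin N) F))
    (A : ι → Matrix (Fin N) (Fin N) F)
    (hA : Submodule.span F (Set.range A) = Subalgebra.toSubmodule C) (γ : ι → F)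
    (hγ : 0 < N → ∀ i c, IsNilpotent (A i - algebraMap F _ c) → γ i = c) :
    IsScalarPlusNilpotent F C ↔ (imageSpan fun i => A i - algebraMap F _ (γ i))^[N] ⊤ = ⊥ := by
  rcases Nat.eq_zero_or_pos N with rfl | hN
  · refine ⟨fun _ => Subsingleton.elim _ _, fun _ x => ⟨0, 0, ?_⟩⟩
    exact Subtype.ext (Subsingleton.elim _ _)
  set B := fun i => A i - algebraMap F _ (γ i) with hB
  have hAC : ∀ i, A i ∈ C := by
    intro i
    rw [← Subalgebra.mem_toSubmodule, ← hA]
    exact Submodule.subset_span ⟨i, rfl⟩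
  have hsub : ∀ (x : C) (c : F), IsNilpotent (x - algebraMap F C c) ↔
      IsNilpotent ((x : Matrix (Fin N) (Fin N) F) - algebraMap F _ c) := by
    intro x c
    rw [← IsNilpotent.map_iff (f := C.val) Subtype.val_injective]
    rfl
  constructor
  · intro h
    have hBC : ∀ i, B i ∈ C := fun i => Subalgebra.sub_mem _ (hAC i) (C.algebraMap_mem _)
    have hBJ : ∀ i, (⟨B i, hBC i⟩ : C) ∈ Ring.jacobson C := by
      intro i
      apply h.mem_jacobson
      obtain ⟨c, hc⟩ := h ⟨A i, hAC i⟩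
      rw [hsub] at hc
      have hc' := hγ hN i c hc
      rw [← IsNilpotent.map_iff (f := C.val) Subtype.val_injective]
      change IsNilpotent (A i - algebraMap F _ (γ i))
      rwa [hc']
    obtain ⟨m, hm⟩ := exists_jacobson_pow_eq_bot F C
    -- the matrices `B i` lie in the radical, which is nilpotent
    have key : ∀ k, (imageSpan B)^[k] ⊤ ≤ Submodule.span F
        {y | ∃ x : C, x ∈ Ring.jacobson C ^ k ∧ ∃ s,
          y = (x : Matrix (Fin N) (Fin N) F).mulVec s} := by
      intro k
      induction k with
      | zero =>
        intro y _
        refine Submodule.subset_span ⟨1, ?_, y, by simp⟩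
        rw [Submodule.pow_zero, Ideal.one_eq_top]
        exact Submodule.mem_top
      | succ k ih =>
        rw [Function.iterate_succ_apply', imageSpan, Submodule.span_le]
        rintro _ ⟨i, s, hs, rfl⟩
        have hs' := ih hs
        clear hs
        induction hs' using Submodule.span_induction with
        | mem t ht =>
          obtain ⟨x, hx, s, rfl⟩ := ht
          refine Submodule.subset_span ⟨⟨B i, hBC i⟩ * x, ?_, s, ?_⟩
          · rw [Ideal.IsTwoSided.pow_succ]
            exact Ideal.mul_mem_mul (hBJ i) hx
          · rw [Matrix.mulVec_mulVec]
            rfl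
        | zero => simp
        | add a b _ _ ha hb =>
          rw [Matrix.mulVec_add]
          exact Submodule.add_mem _ ha hb
        | smul c a _ ha =>
          rw [Matrix.mulVec_smul]
          exact Submodule.smul_mem _ _ ha
    have hbot : (imageSpan B)^[m] ⊤ = ⊥ := by
      rw [eq_bot_iff]
      refine (key m).trans ?_
      rw [hm, Submodule.span_le]
      rintro _ ⟨x, hx, s, rfl⟩
      rw [Submodule.mem_bot] at hx
      subst hx
      simp
    have := iterate_finrank_eq_bot _ (imageSpan_mono B) hbot
    rwa [Module.finrank_fin_fun] at this
  · intro h x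
    -- each element of `C` is congruent to a scalar modulo the span of the `B i`, whose elements are
    -- nilpotent
    suffices H : ∀ x ∈ Submodule.span F (Set.range A), ∃ c : F,
        x - algebraMap F _ c ∈ Submodule.span F (Set.range B) by
      obtain ⟨c, hc⟩ := H x (by rw [hA]; exact x.2)
      refine ⟨c, ?_⟩
      rw [hsub]
      generalize (x : Matrix (Fin N) (Fin N) F) - algebraMap F _ c = y at hc ⊢
      have hy : ∀ U, ∀ s ∈ U, y.mulVec s ∈ imageSpan B U := by
        intro U s hs
        induction hc using Submodule.span_induction with
        | mem t ht =>
          obtain ⟨i, rfl⟩ := ht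
          exact Submodule.subset_span ⟨i, s, hs, rfl⟩
        | zero => simp
        | add a b _ _ ha hb =>
          rw [Matrix.add_mulVec]
          exact Submodule.add_mem _ ha hb
        | smul c a _ ha =>
          rw [Matrix.smul_mulVec]
          exact Submodule.smul_mem _ _ ha
      have hyk : ∀ k s, (y ^ k).mulVec s ∈ (imageSpan B)^[k] ⊤ := by
        intro k
        induction k with
        | zero => intro s; trivial
        | succ k ih =>
          intro s
          rw [pow_succ', ← Matrix.mulVec_mulVec, Function.iterate_succ_apply']
          exact hy _ _ (ih s)
      refine ⟨N, ?_⟩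
      apply Matrix.mulVec_injective
      funext s
      have := hyk N s
      rw [h, Submodule.mem_bot] at this
      rw [this, Matrix.zero_mulVec]
    intro x hx
    induction hx using Submodule.span_induction with
    | mem x hx =>
      obtain ⟨i, rfl⟩ := hx
      exact ⟨γ i, Submodule.subset_span ⟨i, rfl⟩⟩
    | zero => exact ⟨0, by simp⟩
    | add x y _ _ hx hy =>
      obtain ⟨c, hc⟩ := hx
      obtain ⟨d, hd⟩ := hy
      refine ⟨c + d, ?_⟩
      rw [map_add, add_sub_add_comm]
      exact Submodule.add_mem _ hc hd
    | smul t x _ hx =>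
      obtain ⟨c, hc⟩ := hx
      refine ⟨t * c, ?_⟩
      rw [map_mul, ← Algebra.smul_def, ← smul_sub]
      exact Submodule.smul_mem _ _ hc

/-- If `A` is a scalar `c` plus a nilpotent matrix, then `c` is the only scalar such that `A - c`
acts nilpotently on a given nonzero vector. -/
theorem pow_mulVec_eq_zero_iff {A : Matrix (Fin N) (Fin N) F} {c d : F}
    (hA : IsNilpotent (A - algebraMap F _ c)) {x : Fin N → F} (hx : x ≠ 0) :
    ((A - algebraMap F _ d) ^ N).mulVec x = 0 ↔ d = c := by
  constructor
  · intro h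
    by_contra hne
    have hu : IsUnit (algebraMap F (Matrix (Fin N) (Fin N) F) (c - d)) :=
      (IsUnit.mk0 _ (sub_ne_zero.mpr (Ne.symm hne))).map _
    have hu' := hA.isUnit_add_left_of_commute hu (Algebra.commute_algebraMap_right _ _)
    have hAcd : algebraMap F _ (c - d) + (A - algebraMap F _ c) = A - algebraMap F _ d := by
      rw [map_sub]
      abel
    rw [hAcd] at hu'
    obtain ⟨u, hu⟩ := hu'.pow N
    apply hx
    have := congrArg (fun y => (↑u⁻¹ : Matrix (Fin N) (Fin N) F).mulVec y) h
    simpa [← hu, Matrix.mulVec_mulVec] using this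
  · rintro rfl
    obtain ⟨m, hm⟩ := hA
    have := Module.End.ker_pow_le_ker_pow_finrank (Matrix.toLin' (A - algebraMap F _ d)) m
      (x := x) (by rw [LinearMap.mem_ker, ← Matrix.toLin'_pow, hm]; simp)
    rwa [Module.finrank_fin_fun, LinearMap.mem_ker, ← Matrix.toLin'_pow,
      Matrix.toLin'_apply] at this

end MatrixAlgebra

/-! ### Arithmetic of the finite field in loop programs -/

namespace RAM

/-- The variable `x` is not free in the expression. -/
def Exp.Fresh (x : ℕ) : Exp → Prop
  | .par _ => True
  | .var y => y ≠ x
  | .const _ => True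
  | .add e₁ e₂ => e₁.Fresh x ∧ e₂.Fresh x
  | .sub e₁ e₂ => e₁.Fresh x ∧ e₂.Fresh x
  | .inp _ e => e.Fresh x
  | .get _ e => e.Fresh x
  | .ifz e e₁ e₂ => e.Fresh x ∧ e₁.Fresh x ∧ e₂.Fresh x
  | .op _ _ e₁ e₂ => e₁.Fresh x ∧ e₂.Fresh x
  | .fold _ y z e₀ e₁ => e₀.Fresh x ∧ (x = y ∨ x = z ∨ e₁.Fresh x)

theorem Exp.eval_update {x : ℕ} {e : Exp} (Γ : Env) (m : ℕ → ℕ → ℕ) (ρ : ℕ → ℕ) (v : ℕ)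
    (h : e.Fresh x) : e.eval Γ m (Function.update ρ x v) = e.eval Γ m ρ := by
  induction e generalizing ρ with
  | par | const => rfl
  | var y => exact Function.update_of_ne h _ _
  | add e₁ e₂ ih₁ ih₂ | sub e₁ e₂ ih₁ ih₂ | op d f e₁ e₂ ih₁ ih₂ =>
    simp only [eval, ih₁ _ h.1, ih₂ _ h.2]
  | inp a e ih | get a e ih => simp only [eval, ih _ h]
  | ifz e e₁ e₂ ih ih₁ ih₂ => simp only [eval, ih _ h.1, ih₁ _ h.2.1, ih₂ _ h.2.2]
  | fold b y z e₀ e₁ ih₀ ih₁ =>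
    simp only [eval, ih₀ _ h.1]
    congr 1
    funext i r
    by_cases hx : x = y ∨ x = z
    · congr 1
      funext t
      simp only [Function.update_apply]
      rcases hx with rfl | rfl <;> split_ifs <;> rfl
    · push Not at hx
      have h1 := (h.2.resolve_left hx.1).resolve_left hx.2
      rw [Function.update_comm hx.1, Function.update_comm hx.2, ih₁ _ h1]

theorem iterSteps_sum {M : Type*} [AddCommMonoid M] (f : ℕ → M) (n : ℕ) :
    iterSteps (fun i r => r + f i) 0 n = ∑ i ∈ Finset.range n, f i := by
  induction n with
  | zero => rfl
  | succ n ih => rw [Finset.sum_range_succ, ← ih]; rfl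

/-- `e` times the parameter `b`, as an iterated sum. The bound variables `90` and `91` are used for
nothing else, like the variable `92` in `fsum` below. -/
def Exp.mulPar (e : Exp) (b : Fin 8) : Exp := .fold b 90 91 (.const 0) (.add (.var 91) e)

theorem Exp.eval_mulPar {e : Exp} {b : Fin 8} (Γ : Env) (m : ℕ → ℕ → ℕ) (ρ : ℕ → ℕ)
    (h : e.Fresh 90) (h' : e.Fresh 91) : (e.mulPar b).eval Γ m ρ = e.eval Γ m ρ * Γ.par b := by
  simp only [mulPar, eval, Function.update_self, eval_update _ _ _ _ h, eval_update _ _ _ _ h']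
  rw [iterSteps_sum]
  simp [mul_comm]

/-- The index of the entry in row `e₁` and column `e₂` of a matrix with `par b` columns. -/
def Exp.entry (b : Fin 8) (e₁ e₂ : Exp) : Exp := .add (e₁.mulPar b) e₂

theorem Exp.eval_entry {e₁ e₂ : Exp} {b : Fin 8} (Γ : Env) (m : ℕ → ℕ → ℕ) (ρ : ℕ → ℕ)
    (h : e₁.Fresh 90) (h' : e₁.Fresh 91) :
    (entry b e₁ e₂).eval Γ m ρ = e₁.eval Γ m ρ * Γ.par b + e₂.eval Γ m ρ := by
  rw [entry, eval, eval_mulPar _ _ _ h h']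

/-- The value is zero iff those of `e₁` and `e₂` agree. -/
def Exp.neq (e₁ e₂ : Exp) : Exp := .add (.sub e₁ e₂) (.sub e₂ e₁)

theorem Exp.eval_neq_eq_zero {e₁ e₂ : Exp} (Γ : Env) (m : ℕ → ℕ → ℕ) (ρ : ℕ → ℕ) :
    (neq e₁ e₂).eval Γ m ρ = 0 ↔ e₁.eval Γ m ρ = e₂.eval Γ m ρ := by
  simp only [neq, eval]
  omega

/-- The product of the values of `e₁` and `e₂`, as an iterated sum; the value of `e₁` must not be
larger than the parameter `2`. -/
def Exp.product (e₁ e₂ : Exp) : Exp :=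
  .fold 2 6 8 (.const 0) (.ifz (.sub e₁ (.var 6)) (.var 8) (.add (.var 8) e₂))

theorem Exp.eval_product {Γ : Env} {e₁ e₂ : Exp} (m : ℕ → ℕ → ℕ) (ρ : ℕ → ℕ)
    (h₁ : e₁.Fresh 6 ∧ e₁.Fresh 8) (h₂ : e₂.Fresh 6 ∧ e₂.Fresh 8)
    (hle : e₁.eval Γ m ρ ≤ Γ.par 2) :
    (Exp.product e₁ e₂).eval Γ m ρ = e₁.eval Γ m ρ * e₂.eval Γ m ρ := by
  have key : ∀ x y n : ℕ, iterSteps (fun i r => if x - i = 0 then r else r + y) 0 n =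
      min n x * y := by
    intro x y n
    induction n with
    | zero => simp [iterSteps]
    | succ n ih =>
      rw [iterSteps, ih]
      split_ifs with h
      · rw [min_eq_right (by omega), min_eq_right (by omega)]
      · rw [min_eq_left (by omega), min_eq_left (by omega), add_mul, one_mul]
  rw [← min_eq_right hle, ← key]
  simp only [Exp.product, Exp.eval, Exp.eval_update _ _ _ _ h₁.1, Exp.eval_update _ _ _ _ h₁.2,
    Exp.eval_update _ _ _ _ h₂.1, Exp.eval_update _ _ _ _ h₂.2, Function.update_self]
  simp

theorem run_seq (Γ : Env) (c₁ c₂ : Cmd) (σ : Store) :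
    (Cmd.seq c₁ c₂).run Γ σ = c₂.run Γ (c₁.run Γ σ) := rfl

theorem run_set (Γ : Env) (x : ℕ) (e : Exp) (σ : Store) :
    (Cmd.set x e).run Γ σ = ⟨Function.update σ.var x (e.eval Γ σ.mem σ.var), σ.mem⟩ := rfl

theorem run_fill_mem_of_ne {Γ : Env} {a c : ℕ} {b b' : Fin 8} {x y : ℕ} {e : Exp} {σ : Store}
    (h : c ≠ a) : ((Cmd.fill a b x b' y e).run Γ σ).mem c = σ.mem c :=
  Function.update_of_ne h _ _

theorem run_fill_mem {Γ : Env} {a n n' i j : ℕ} {b b' : Fin 8} {x y : ℕ} {e : Exp} {σ : Store}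
    (hn : Γ.par b = n) (hn' : Γ.par b' = n') (hi : i < n) (hj : j < n') :
    ((Cmd.fill a b x b' y e).run Γ σ).mem a (i * n' + j) =
      e.eval Γ σ.mem (Function.update (Function.update σ.var x i) y j) := by
  have hlt : i * n' + j < n * n' := by
    calc i * n' + j < i * n' + n' := by omega
      _ = (i + 1) * n' := by ring
      _ ≤ n * n' := Nat.mul_le_mul_right _ hi
  simp only [Cmd.run, Function.update_self, hn, hn', if_pos hlt]
  rw [mul_comm i, Nat.mul_add_div (by omega), Nat.div_eq_of_lt hj, Nat.mul_add_mod,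
    Nat.mod_eq_of_lt hj, add_zero]

/-- The case of a single column. -/
theorem run_fill_mem_one {Γ : Env} {a n i : ℕ} {b b' : Fin 8} {x y : ℕ} {e : Exp} {σ : Store}
    (hn : Γ.par b = n) (hn' : Γ.par b' = 1) (hi : i < n) :
    ((Cmd.fill a b x b' y e).run Γ σ).mem a i =
      e.eval Γ σ.mem (Function.update (Function.update σ.var x i) y 0) := by
  have := run_fill_mem (a := a) (x := x) (y := y) (e := e) (σ := σ) hn hn' hi zero_lt_one
  simpa using this

/-- Induction on the rounds of a loop. -/
theorem run_iterate_induction {Γ : Env} {b : Fin 8} {x n : ℕ} {c : Cmd} {σ : Store}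
    (I : ℕ → Store → Prop) (hn : Γ.par b = n) (h0 : I 0 σ)
    (hs : ∀ i < n, ∀ σ, I i σ → I (i + 1) (c.run Γ ⟨Function.update σ.var x i, σ.mem⟩)) :
    I n ((Cmd.iterate b x c).run Γ σ) := by
  have : ∀ j ≤ n, I j (iterSteps (fun i σ =>
      c.run Γ { σ with var := Function.update σ.var x i }) σ j) := by
    intro j
    induction j with
    | zero => exact fun _ => h0
    | succ j ih => exact fun hj => hs j (by omega) _ (ih (by omega))
  simp only [Cmd.run, hn]
  exact this n le_rfl

section Field

variable {F : Type*} [Field F] {q : ℕ} (code : F ≃ Fin q)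

/-- The number of a field element. -/
def encode (x : F) : ℕ := code x

/-- The field element with a given number; numbers that are too large are read as `q - 1`. -/
def decode (v : ℕ) : F :=
  code.symm ⟨min (q - 1) v, by have := (code 0).pos; omega⟩

theorem decode_min (v : ℕ) : decode code (min (q - 1) v) = decode code v := by
  simp [decode]

theorem decode_encode (x : F) : decode code (encode code x) = x := by
  have h : min (q - 1) (code x : ℕ) = code x := by have := (code x).isLt; omega
  simp [decode, encode, h]

/-- A binary operation of the field. -/
def fop (f : F → F → F) (e₁ e₂ : Exp) : Exp :=
  .op (q - 1) (fun i j => encode code (f (decode code i) (decode code j))) e₁ e₂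

theorem decode_fop (f : F → F → F) (e₁ e₂ : Exp) (Γ : Env) (m : ℕ → ℕ → ℕ) (ρ : ℕ → ℕ) :
    decode code ((fop code f e₁ e₂).eval Γ m ρ) =
      f (decode code (e₁.eval Γ m ρ)) (decode code (e₂.eval Γ m ρ)) := by
  rw [fop, Exp.eval, decode_encode, decode_min, decode_min]

/-- A field element. -/
def lit (x : F) : Exp := .const (encode code x)

theorem decode_lit (x : F) (Γ : Env) (m : ℕ → ℕ → ℕ) (ρ : ℕ → ℕ) :
    decode code ((lit code x).eval Γ m ρ) = x := decode_encode code x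

open Classical in
/-- The value is zero iff that of `e` is the zero of the field. -/
noncomputable def fne (e : Exp) : Exp :=
  .op (q - 1) (fun i _ => if decode code i = 0 then 0 else 1) e (.const 0)

theorem eval_fne_eq_zero (e : Exp) (Γ : Env) (m : ℕ → ℕ → ℕ) (ρ : ℕ → ℕ) :
    (fne code e).eval Γ m ρ = 0 ↔ decode code (e.eval Γ m ρ) = 0 := by
  rw [fne, Exp.eval, decode_min]
  split_ifs with h <;> simp [h]

/-- The sum of the field elements `e` for `x = 0, …, par b - 1`. -/
def fsum (b : Fin 8) (x : ℕ) (e : Exp) : Exp :=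
  .fold b x 92 (lit code 0) (fop code (· + ·) (.var 92) e)

theorem decode_fsum {b : Fin 8} {x n : ℕ} {e : Exp} {Γ : Env} (hn : Γ.par b = n)
    (m : ℕ → ℕ → ℕ) (ρ : ℕ → ℕ) (h : e.Fresh 92) :
    decode code ((fsum code b x e).eval Γ m ρ) =
      ∑ i : Fin n, decode code (e.eval Γ m (Function.update ρ x i)) := by
  rw [← Finset.sum_range fun i => decode code (e.eval Γ m (Function.update ρ x i)),
    fsum, Exp.eval, hn]
  clear hn
  induction n with
  | zero => exact decode_lit code 0 Γ m ρ
  | succ n ih =>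
    rw [Finset.sum_range_succ, ← ih, iterSteps, decode_fop, Exp.eval_update _ _ _ _ h, Exp.eval,
      Function.update_self]

/-- The value is zero iff the first `par b` entries of the array `a` are the zero of the field. -/
noncomputable def anyNonzero (b : Fin 8) (a : ℕ) : Exp :=
  .fold b 6 8 (.const 0) (.ifz (fne code (.get a (.var 6))) (.var 8) (.const 1))

theorem eval_anyNonzero {b : Fin 8} {n : ℕ} {Γ : Env} (hn : Γ.par b = n) (a : ℕ) (m : ℕ → ℕ → ℕ)
    (ρ : ℕ → ℕ) : (anyNonzero code b a).eval Γ m ρ ≤ 1 ∧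
      ((anyNonzero code b a).eval Γ m ρ = 0 ↔ ∀ i < n, decode code (m a i) = 0) := by
  classical
  have h : (anyNonzero code b a).eval Γ m ρ =
      iterSteps (fun i r => if decode code (m a i) = 0 then r else 1) 0 n := by
    simp only [anyNonzero, Exp.eval, hn, eval_fne_eq_zero]
    simp
  rw [h]
  clear h hn
  induction n with
  | zero => simp [iterSteps]
  | succ n ih =>
    rw [iterSteps]
    split_ifs with h
    · refine ⟨ih.1, ?_⟩
      rw [ih.2]
      constructor
      · intro h' i hi
        rcases Nat.lt_succ_iff_lt_or_eq.mp hi with h1 | rfl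
        · exact h' i h1
        · exact h
      · exact fun h' i hi => h' i (by omega)
    · refine ⟨le_rfl, ?_⟩
      simp only [false_iff]
      exact fun h' => h (h' n (by omega))

/-- The vector of the field elements in `n` cells from `p` on. -/
def vecAt (m : ℕ → ℕ) (n p : ℕ) : Fin n → F := fun j => decode code (m (p + j))

/-- The subspace spanned by the rows of an `n × n` matrix. -/
def rowSpan (m : ℕ → ℕ) (n : ℕ) : Submodule F (Fin n → F) :=
  Submodule.span F (Set.range fun i : Fin n => vecAt code m n (i * n))

/-- Fill the array `a` with the identity matrix. -/
def identity (a : ℕ) (b : Fin 8) : Cmd :=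
  .fill a b 4 b 5 (.ifz (.neq (.var 4) (.var 5)) (lit code 1) (lit code 0))

theorem decode_identity {Γ : Env} {a n : ℕ} {b : Fin 8} (hn : Γ.par b = n) (σ : Store)
    (i j : Fin n) : decode code (((identity code a b).run Γ σ).mem a (i * n + j)) =
      if i = j then 1 else 0 := by
  rw [identity, run_fill_mem hn hn i.2 j.2, Exp.eval]
  simp only [Exp.eval_neq_eq_zero]
  by_cases h : i = j
  · simp [Exp.eval, h, decode_lit]
  · have : (i : ℕ) ≠ j := fun h' => h (Fin.ext h')
    simp [Exp.eval, h, this, decode_lit]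

theorem rowSpan_identity {Γ : Env} {a n : ℕ} {b : Fin 8} (hn : Γ.par b = n) (σ : Store) :
    rowSpan code (((identity code a b).run Γ σ).mem a) n = ⊤ := by
  rw [eq_top_iff]
  intro x _
  rw [← Finset.univ_sum_single x]
  refine Submodule.sum_mem _ fun i _ => ?_
  have : (Pi.single i (x i) : Fin n → F) = x i • Pi.single i 1 := by
    rw [← Pi.single_smul, smul_eq_mul, mul_one]
  rw [this]
  refine Submodule.smul_mem _ _ (Submodule.subset_span ⟨i, ?_⟩)
  funext j
  refine (decode_identity code hn σ i j).trans ?_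
  rw [Pi.single_apply]
  simp [eq_comm]

/-- One elimination step on the rows of the array `a`, with the linear form in the array `4`. The
values of the form are put into the array `5`, the pivot into the variable `7`. -/
noncomputable def eliminate (a : ℕ) (b : Fin 8) : Cmd :=
  .seq (.fill 5 b 4 5 5 (fsum code b 6 (fop code (· * ·) (.get 4 (.var 6))
    (.get a (.entry b (.var 4) (.var 6))))))
  (.seq (.set 7 (.fold b 6 8 (.const 0) (.ifz (fne code (.get 5 (.var 6))) (.var 8) (.var 6))))
  (.fill a b 4 b 5 (fop code (· - ·) (.get a (.entry b (.var 4) (.var 5)))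
    (fop code (· * ·) (fop code (fun x y => x * y⁻¹) (.get 5 (.var 4)) (.get 5 (.var 7)))
      (.get a (.entry b (.var 7) (.var 5)))))))

/-- A loop that searches for an index `i` such that `Z i` fails finds one if there is any. -/
theorem iterSteps_search (Z : ℕ → Prop) [DecidablePred Z] (n : ℕ) (hn : 0 < n) :
    iterSteps (fun i r => if Z i then r else i) 0 n < n ∧
      (Z (iterSteps (fun i r => if Z i then r else i) 0 n) → ∀ i < n, Z i) := by
  have key : ∀ m, ((∀ i < m, Z i) ∧ iterSteps (fun i r => if Z i then r else i) 0 m = 0) ∨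
      (iterSteps (fun i r => if Z i then r else i) 0 m < m ∧
        ¬ Z (iterSteps (fun i r => if Z i then r else i) 0 m)) := by
    intro m
    induction m with
    | zero => left; exact ⟨fun i hi => by omega, rfl⟩
    | succ m ih =>
      rw [iterSteps]
      by_cases hm : Z m
      · simp only [if_pos hm]
        rcases ih with h | h
        · left
          refine ⟨fun i hi => ?_, h.2⟩
          rcases Nat.lt_succ_iff_lt_or_eq.mp hi with h1 | rfl
          · exact h.1 i h1
          · exact hm
        · right
          exact ⟨by omega, h.2⟩
      · simp only [if_neg hm]
        right
        exact ⟨by omega, hm⟩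
  rcases key n with h | h
  · exact ⟨by omega, fun _ => h.1⟩
  · exact ⟨h.1, fun h' => absurd h' h.2⟩

theorem eliminate_var {Γ : Env} {a : ℕ} {b : Fin 8} (σ : Store) {x : ℕ} (hx : x ≠ 7) :
    ((eliminate code a b).run Γ σ).var x = σ.var x := by
  simp [eliminate, Cmd.run, hx]

theorem eliminate_mem {Γ : Env} {a : ℕ} {b : Fin 8} (σ : Store) {c : ℕ} (hc : c ≠ a)
    (hc' : c ≠ 5) : ((eliminate code a b).run Γ σ).mem c = σ.mem c := by
  simp [eliminate, Cmd.run, hc, hc']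

/-- If the linear form vanishes on all rows, the search for a pivot returns the row `0`, and the rows
do not change, since `0⁻¹ = 0`. -/
theorem mem_rowSpan_eliminate {Γ : Env} {a n : ℕ} {b : Fin 8} (hn : Γ.par b = n)
    (h1 : Γ.par 5 = 1) (ha5 : a ≠ 5) (σ : Store) (x : Fin n → F) :
    x ∈ rowSpan code (((eliminate code a b).run Γ σ).mem a) n ↔
      x ∈ rowSpan code (σ.mem a) n ∧ vecAt code (σ.mem 4) n 0 ⬝ᵥ x = 0 := by
  classical
  rcases Nat.eq_zero_or_pos n with rfl | hpos
  · rw [Subsingleton.elim x 0]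
    simp only [dotProduct_zero, and_true]
    exact ⟨fun _ => Submodule.zero_mem _, fun _ => Submodule.zero_mem _⟩
  let v : Fin n → Fin n → F := fun i => vecAt code (σ.mem a) n (i * n)
  let w : (Fin n → F) →ₗ[F] F := Fintype.linearCombination F (vecAt code (σ.mem 4) n 0)
  have hw : ∀ y, w y = vecAt code (σ.mem 4) n 0 ⬝ᵥ y := by
    intro y
    simp [w, Fintype.linearCombination_apply, dotProduct, mul_comm]
  -- the values of the linear form
  set σ₁ := (Cmd.fill 5 b 4 5 5 (fsum code b 6 (fop code (· * ·) (.get 4 (.var 6))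
    (.get a (.entry b (.var 4) (.var 6)))))).run Γ σ with hσ₁
  have hval : ∀ i : Fin n, decode code (σ₁.mem 5 i) = w (v i) := by
    intro i
    rw [hσ₁, run_fill_mem_one hn h1 i.2, decode_fsum code hn _ _ (by
      simp [fop, Exp.Fresh, Exp.entry, Exp.mulPar]), hw, dotProduct]
    refine Finset.sum_congr rfl fun j _ => ?_
    rw [decode_fop]
    simp only [Exp.eval]
    rw [Exp.eval_entry _ _ _ (by simp [Exp.Fresh]) (by simp [Exp.Fresh])]
    simp [Exp.eval, v, vecAt, hn]
  have hσ₁a : σ₁.mem a = σ.mem a := run_fill_mem_of_ne ha5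
  -- the pivot
  obtain ⟨P, hPdef⟩ : ∃ P : Exp, P = .fold b 6 8 (.const 0)
    (.ifz (fne code (.get 5 (.var 6))) (.var 8) (.var 6)) := ⟨_, rfl⟩
  have hP : P.eval Γ σ₁.mem σ₁.var =
      iterSteps (fun i r => if decode code (σ₁.mem 5 i) = 0 then r else i) 0 n := by
    simp only [hPdef, Exp.eval, hn, eval_fne_eq_zero]
    simp
  obtain ⟨hp, hpz⟩ := iterSteps_search (fun i => decode code (σ₁.mem 5 i) = 0) n hpos
  rw [← hP] at hp hpz
  let p : Fin n := ⟨P.eval Γ σ₁.mem σ₁.var, hp⟩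
  have hspan := span_eliminate v w p (by
    intro h i
    rw [← hval] at h ⊢
    exact hpz h i i.2)
  have hrow : ∀ i : Fin n, vecAt code (((eliminate code a b).run Γ σ).mem a) n (i * n) =
      v i - (w (v i) * (w (v p))⁻¹) • v p := by
    intro i
    funext j
    rw [vecAt, eliminate, ← hPdef, run_seq, run_seq, ← hσ₁, run_set,
      run_fill_mem hn hn i.2 j.2, decode_fop, decode_fop, decode_fop]
    simp only [Exp.eval]
    rw [Exp.eval_entry _ _ _ (by simp [Exp.Fresh]) (by simp [Exp.Fresh]),
      Exp.eval_entry _ _ _ (by simp [Exp.Fresh]) (by simp [Exp.Fresh])]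
    simp only [Exp.eval]
    have e1 := hval i
    have e2 := hval p
    simp only [p] at e2
    simp [e1, e2, hσ₁a, hn, v, vecAt, p]
  simp only [rowSpan, hrow]
  rw [hspan, Submodule.mem_inf, LinearMap.mem_ker, hw]

end Field

end RAM

/-! ### Linear algebra by loop programs

The parameter `2` is `N`, the dimension of the whole space, `3` is `N * N`, `4` is `q` and `5` is `1`,
which serves for arrays with a single column. The arrays are: `0` and `1` for the vertex and the place
at this vertex of each basis vector, `2` for the matrix whose commutant is formed, `3` for the
spanning set of the endomorphism algebra, one `N × N` matrix in each of its `N * N` rows, `4` for a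
linear form, `5` for its values, `6` for a vector, `7` for the identity matrix, `8` and `9` for
subspaces of the whole space, spanned by the rows. -/

namespace RAM

/-- Vectors of length `N * N` as matrices. -/
def unflatten (F : Type*) [Field F] (N : ℕ) : (Fin (N * N) → F) ≃ₗ[F] Matrix (Fin N) (Fin N) F where
  toFun x := Matrix.of fun i j => x (finProdFinEquiv (i, j))
  map_add' _ _ := rfl
  map_smul' _ _ := rfl
  invFun X := fun t => X (finProdFinEquiv.symm t).1 (finProdFinEquiv.symm t).2
  left_inv x := by
    funext t
    simp only [Matrix.of_apply, Prod.mk.eta, Equiv.apply_symm_apply]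
  right_inv X := by
    ext i j
    simp only [Matrix.of_apply, Equiv.symm_apply_apply]

theorem unflatten_apply {F : Type*} [Field F] {N : ℕ} (x : Fin (N * N) → F) (i j : Fin N) :
    unflatten F N x i j = x (finProdFinEquiv (i, j)) := rfl

theorem val_finProdFinEquiv {m n : ℕ} (i : Fin m) (j : Fin n) :
    (finProdFinEquiv (i, j) : ℕ) = i * n + j := by
  rw [finProdFinEquiv_apply_val, mul_comm, add_comm]

section Field

variable {F : Type*} [Field F] {q : ℕ} (code : F ≃ Fin q)

/-- The `N × N` matrix of the field elements in `N * N` cells from `p` on. -/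
def matAt (m : ℕ → ℕ) (N p : ℕ) : Matrix (Fin N) (Fin N) F :=
  Matrix.of fun i j => decode code (m (p + (i * N + j)))

theorem unflatten_vecAt (m : ℕ → ℕ) (N p : ℕ) :
    unflatten F N (vecAt code m (N * N) p) = matAt code m N p := by
  ext i j
  rw [unflatten_apply, vecAt, val_finProdFinEquiv]
  rfl

/-- The program `c`, started in a store with the property `I`, replaces the span of the rows of the
array `a` by its intersection with `p`, and preserves `I`. -/
def Imposes (Γ : Env) (c : Cmd) (a n : ℕ) (I : Store → Prop) (p : Set (Fin n → F)) : Prop :=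
  ∀ σ, I σ → I (c.run Γ σ) ∧ ∀ x, x ∈ rowSpan code ((c.run Γ σ).mem a) n ↔
    x ∈ rowSpan code (σ.mem a) n ∧ x ∈ p

theorem Imposes.iterate {Γ : Env} {c : Cmd} {a n N : ℕ} {b : Fin 8} {x : ℕ} {I : Store → Prop}
    {p : ℕ → Set (Fin n → F)} (hN : Γ.par b = N)
    (hI : ∀ σ i, I σ → I ⟨Function.update σ.var x i, σ.mem⟩)
    (h : ∀ i < N, Imposes code Γ c a n (fun σ => I σ ∧ σ.var x = i) (p i)) :
    Imposes code Γ (.iterate b x c) a n I {y | ∀ i < N, y ∈ p i} := by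
  intro σ hσ
  refine run_iterate_induction (fun j τ => I τ ∧ ∀ y, y ∈ rowSpan code (τ.mem a) n ↔
    y ∈ rowSpan code (σ.mem a) n ∧ ∀ i < j, y ∈ p i) hN ⟨hσ, fun y => by simp⟩ ?_
  rintro i hi τ ⟨h1, h2⟩
  obtain ⟨h3, h4⟩ := h i hi ⟨Function.update τ.var x i, τ.mem⟩ ⟨hI _ _ h1, by simp⟩
  refine ⟨h3.1, fun y => ?_⟩
  rw [h4, h2, and_assoc]
  refine and_congr_right fun _ => ?_
  constructor
  · rintro ⟨h5, h6⟩ j hj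
    rcases Nat.lt_succ_iff_lt_or_eq.mp hj with h7 | rfl
    · exact h5 j h7
    · exact h6
  · exact fun h5 => ⟨fun j hj => h5 j (by omega), h5 i (by omega)⟩

/-- One linear condition: the form `w` is written into the array `4`, and one elimination step is
made. -/
theorem Imposes.fill_eliminate {Γ : Env} {a n : ℕ} {b b₁ b₂ : Fin 8} {x y : ℕ} {e : Exp}
    {I : Store → Prop} (w : Fin n → F) (hn : Γ.par b = n) (h1 : Γ.par 5 = 1) (ha4 : a ≠ 4)
    (ha5 : a ≠ 5) (hI : ∀ σ σ' : Store, (∀ x, x ≠ 7 → σ'.var x = σ.var x) →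
      (∀ c, c ≠ a → c ≠ 4 → c ≠ 5 → σ'.mem c = σ.mem c) → I σ → I σ')
    (hw : ∀ σ, I σ → vecAt code (((Cmd.fill 4 b₁ x b₂ y e).run Γ σ).mem 4) n 0 = w) :
    Imposes code Γ (.seq (.fill 4 b₁ x b₂ y e) (eliminate code a b)) a n I {x | w ⬝ᵥ x = 0} := by
  intro σ hσ
  rw [run_seq]
  refine ⟨hI σ _ (fun x hx => ?_) (fun c hc hc4 hc5 => ?_) hσ, fun z => ?_⟩
  · rw [eliminate_var code _ hx]
    rfl
  · rw [eliminate_mem code _ hc hc5, run_fill_mem_of_ne hc4]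
  · rw [mem_rowSpan_eliminate code hn h1 ha5, hw σ hσ, run_fill_mem_of_ne ha4]
    rfl

/-- Intersect the span of the rows of the array `3`, which are regarded as matrices, with the
commutant of the matrix in the array `2`: impose one linear condition for every entry of the
commutator. -/
noncomputable def commute : Cmd :=
  .iterate 2 2 (.iterate 2 3 (.seq (.fill 4 2 4 2 5 (fop code (· - ·)
    (.ifz (.neq (.var 4) (.var 2)) (.get 2 (.entry 2 (.var 5) (.var 3))) (lit code 0))
    (.ifz (.neq (.var 5) (.var 3)) (.get 2 (.entry 2 (.var 2) (.var 4))) (lit code 0))))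
    (eliminate code 3 3)))

theorem imposes_commute {Γ : Env} {N : ℕ} (hN : Γ.par 2 = N) (hNN : Γ.par 3 = N * N)
    (h1 : Γ.par 5 = 1) (m : ℕ → ℕ) {I : Store → Prop}
    (hI : ∀ σ σ' : Store, (∀ x, x ≠ 2 → x ≠ 3 → x ≠ 7 → σ'.var x = σ.var x) →
      (∀ c, c ≠ 3 → c ≠ 4 → c ≠ 5 → σ'.mem c = σ.mem c) → I σ → I σ')
    (hm : ∀ σ, I σ → σ.mem 2 = m) :
    Imposes code Γ (commute code) 3 (N * N) I
      {x | Commute (unflatten F N x) (matAt code m N 0)} := by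
  have key : Imposes code Γ (commute code) 3 (N * N) I
      {x | ∀ k < N, x ∈ {x | ∀ l < N, x ∈ {x : Fin (N * N) → F |
        (unflatten F N).symm (Matrix.of fun i j =>
          (if (i : ℕ) = k then decode code (m (j * N + l)) else 0) -
          (if (j : ℕ) = l then decode code (m (k * N + i)) else 0)) ⬝ᵥ x = 0}}} := by
    refine Imposes.iterate code hN (fun σ i h => hI σ _ (fun x hx _ _ => by simp [hx])
      (fun _ _ _ _ => rfl) h) fun k hk => ?_
    refine Imposes.iterate code hN (fun σ i h => ⟨hI σ _ (fun x _ hx _ => by simp [hx])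
      (fun _ _ _ _ => rfl) h.1, by simpa using h.2⟩) fun l hl => ?_
    refine Imposes.fill_eliminate code _ hNN h1 (by norm_num) (by norm_num) ?_ ?_
    · rintro σ σ' hv hm' ⟨⟨h2, h3⟩, h4⟩
      exact ⟨⟨hI σ σ' (fun x _ _ hx => hv x hx) hm' h2,
        by rw [hv 2 (by norm_num), h3]⟩, by rw [hv 3 (by norm_num), h4]⟩
    · rintro σ ⟨⟨h2, h3⟩, h4⟩
      rw [LinearEquiv.eq_symm_apply, unflatten_vecAt]
      ext i j
      rw [matAt, Matrix.of_apply, Matrix.of_apply, zero_add, run_fill_mem hN hN i.2 j.2,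
        decode_fop]
      simp only [Exp.eval, Exp.eval_neq_eq_zero]
      rw [Exp.eval_entry _ _ _ (by simp [Exp.Fresh]) (by simp [Exp.Fresh]),
        Exp.eval_entry _ _ _ (by simp [Exp.Fresh]) (by simp [Exp.Fresh])]
      simp only [Exp.eval, hN, hm σ h2]
      simp only [apply_ite (decode code), decode_lit]
      simp [h3, h4]
  convert key using 1
  ext x
  rw [Set.mem_ofPred_eq, commute_iff_eq, ← Matrix.ext_iff]
  have : ∀ k l : Fin N, ((unflatten F N).symm (Matrix.of fun i j =>
          (if (i : ℕ) = k then decode code (m (j * N + l)) else 0) -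
          (if (j : ℕ) = l then decode code (m (k * N + i)) else 0)) ⬝ᵥ x = 0) ↔
      (unflatten F N x * matAt code m N 0) k l = (matAt code m N 0 * unflatten F N x) k l := by
    intro k l
    rw [← sub_eq_zero (a := (unflatten F N x * matAt code m N 0) k l)]
    apply iff_of_eq
    congr 1
    rw [dotProduct, ← finProdFinEquiv.sum_comp, Fintype.sum_prod_type, Matrix.mul_apply,
      Matrix.mul_apply]
    simp only [unflatten, LinearEquiv.coe_symm_mk', LinearEquiv.coe_mk, Equiv.symm_apply_apply, Matrix.of_apply, sub_mul, Finset.sum_sub_distrib,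
      Fin.val_inj, matAt, zero_add, ite_mul, zero_mul, Finset.sum_ite_irrel, Finset.sum_const_zero,
      Finset.sum_ite_eq', Finset.mem_univ, if_true]
    congr 1
    exact Finset.sum_congr rfl fun _ _ => mul_comm _ _
  constructor
  · exact fun h k hk l hl => (this ⟨k, hk⟩ ⟨l, hl⟩).mpr (h _ _)
  · exact fun h k l => (this k l).mp (h k k.2 l l.2)

/-- The matrix `P`, whose entries are given by the expression `e`, is written into the array `2`, and
the commutant is formed. -/
theorem imposes_fill_commute {Γ : Env} {N : ℕ} (hN : Γ.par 2 = N) (hNN : Γ.par 3 = N * N)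
    (h1 : Γ.par 5 = 1) {e : Exp} (P : Matrix (Fin N) (Fin N) F) {I : Store → Prop}
    (hI : ∀ σ σ' : Store, (∀ x, x ≠ 2 → x ≠ 3 → x ≠ 7 → σ'.var x = σ.var x) →
      (∀ c, c ≠ 2 → c ≠ 3 → c ≠ 4 → c ≠ 5 → σ'.mem c = σ.mem c) → I σ → I σ')
    (hP : ∀ σ, I σ → ∀ i j : Fin N, decode code (e.eval Γ σ.mem
      (Function.update (Function.update σ.var 4 i) 5 j)) = P i j) :
    Imposes code Γ (.seq (.fill 2 2 4 2 5 e) (commute code)) 3 (N * N) I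
      {x | Commute (unflatten F N x) P} := by
  intro σ hσ
  have hP' : matAt code (((Cmd.fill 2 2 4 2 5 e).run Γ σ).mem 2) N 0 = P := by
    ext i j
    rw [matAt, Matrix.of_apply, zero_add, run_fill_mem hN hN i.2 j.2, hP σ hσ]
  have hI' : I ((Cmd.fill 2 2 4 2 5 e).run Γ σ) :=
    hI σ _ (fun _ _ _ _ => rfl) (fun c hc _ _ _ => run_fill_mem_of_ne hc) hσ
  obtain ⟨h2, h3⟩ := imposes_commute code hN hNN h1 (((Cmd.fill 2 2 4 2 5 e).run Γ σ).mem 2)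
    (I := fun τ => I τ ∧ τ.mem 2 = ((Cmd.fill 2 2 4 2 5 e).run Γ σ).mem 2)
    (fun τ τ' hv hm h => ⟨hI τ τ' hv (fun c _ => hm c) h.1,
      (hm 2 (by norm_num) (by norm_num) (by norm_num)).trans h.2⟩) (fun τ h => h.2)
    ((Cmd.fill 2 2 4 2 5 e).run Γ σ) ⟨hI', rfl⟩
  refine ⟨h2.1, fun x => ?_⟩
  rw [run_seq, h3, hP', run_fill_mem_of_ne (by norm_num)]

end Field
end RAM

namespace RAM

section Field

variable {F : Type*} [Field F] {q : ℕ} (code : F ≃ Fin q)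

/-- Apply `(A - γ) ^ N` to the first basis vector, where `A` is the matrix in the row `var 1` of the
array `3`, and `γ` is the field element with the number `var 2`. The result is put into the
array `6`; the array `7` contains the identity matrix. -/
def applyPower : Cmd :=
  .seq (.fill 6 2 4 5 5 (.ifz (.var 4) (lit code 1) (lit code 0)))
    (.iterate 2 3 (.fill 6 2 4 5 5 (fsum code 2 6 (fop code (· * ·)
      (fop code (· - ·) (.get 3 (.entry 3 (.var 1) (.entry 2 (.var 4) (.var 6))))
        (fop code (· * ·) (.var 2) (.get 7 (.entry 2 (.var 4) (.var 6))))) (.get 6 (.var 6))))))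

theorem run_applyPower {Γ : Env} {N i : ℕ} (hN : Γ.par 2 = N) (hNN : Γ.par 3 = N * N)
    (h1 : Γ.par 5 = 1) (A : Matrix (Fin N) (Fin N) F) (d : F) (σ : Store)
    (h7 : ∀ k l : Fin N, decode code (σ.mem 7 (k * N + l)) = if k = l then 1 else 0)
    (hi : σ.var 1 = i) (hA : matAt code (σ.mem 3) N (i * (N * N)) = A)
    (hd : decode code (σ.var 2) = d) :
    vecAt code (((applyPower code).run Γ σ).mem 6) N 0 =
      ((A - algebraMap F _ d) ^ N).mulVec (fun k => if (k : ℕ) = 0 then 1 else 0) ∧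
    (∀ c, c ≠ 6 → ((applyPower code).run Γ σ).mem c = σ.mem c) ∧
    ∀ x, x ≠ 3 → ((applyPower code).run Γ σ).var x = σ.var x := by
  rw [applyPower, run_seq]
  refine run_iterate_induction (fun j τ => vecAt code (τ.mem 6) N 0 =
      ((A - algebraMap F _ d) ^ j).mulVec (fun k => if (k : ℕ) = 0 then 1 else 0) ∧
    (∀ c, c ≠ 6 → τ.mem c = σ.mem c) ∧ ∀ x, x ≠ 3 → τ.var x = σ.var x) hN ?_ ?_
  · refine ⟨?_, fun c hc => run_fill_mem_of_ne hc, fun x _ => rfl⟩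
    funext k
    rw [pow_zero, Matrix.one_mulVec, vecAt, zero_add, run_fill_mem_one hN h1 k.2]
    simp [Exp.eval, apply_ite (decode code), decode_lit]
  · rintro j hj τ ⟨h2, h3, h4⟩
    refine ⟨?_, fun c hc => (run_fill_mem_of_ne hc).trans (h3 c hc), fun x hx => ?_⟩
    · funext k
      rw [pow_succ', ← Matrix.mulVec_mulVec, ← h2, vecAt, zero_add, run_fill_mem_one hN h1 k.2,
        decode_fsum code hN _ _ (by simp [fop, Exp.Fresh, Exp.entry, Exp.mulPar]), Matrix.mulVec,
        dotProduct]
      refine Finset.sum_congr rfl fun l _ => ?_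
      rw [decode_fop, decode_fop, decode_fop]
      simp only [Exp.eval]
      rw [Exp.eval_entry _ _ _ (by simp [Exp.Fresh]) (by simp [Exp.Fresh]),
        Exp.eval_entry _ _ _ (by simp [Exp.Fresh]) (by simp [Exp.Fresh])]
      simp only [Exp.eval]
      simp [hN, hNN, h4, h3, hi, hd, h7, ← hA, matAt, vecAt, Matrix.algebraMap_matrix_apply]
    · change Function.update τ.var 3 j x = _
      rw [Function.update_of_ne hx, h4 x hx]

/-- Search for the eigenvalue of the matrix in the row `var 1` of the array `3`, if this matrix is a
scalar plus a nilpotent matrix, and put its number into the variable `9`. -/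
noncomputable def findEigenvalue : Cmd :=
  .iterate 4 2 (.seq (applyPower code) (.set 9 (.ifz (anyNonzero code 2 6) (.var 2) (.var 9))))

theorem run_findEigenvalue {Γ : Env} {N i : ℕ} (hN : Γ.par 2 = N) (hNN : Γ.par 3 = N * N)
    (h1 : Γ.par 5 = 1) (hq : Γ.par 4 = q) (A : Matrix (Fin N) (Fin N) F) (σ : Store)
    (h7 : ∀ k l : Fin N, decode code (σ.mem 7 (k * N + l)) = if k = l then 1 else 0)
    (hi : σ.var 1 = i) (hA : matAt code (σ.mem 3) N (i * (N * N)) = A) :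
    (0 < N → ∀ c, IsNilpotent (A - algebraMap F _ c) →
      decode code (((findEigenvalue code).run Γ σ).var 9) = c) ∧
    (∀ c, c ≠ 6 → ((findEigenvalue code).run Γ σ).mem c = σ.mem c) ∧
    ((findEigenvalue code).run Γ σ).var 1 = i := by
  suffices h : (0 < N → ∀ c, IsNilpotent (A - algebraMap F _ c) → encode code c < q →
      decode code (((findEigenvalue code).run Γ σ).var 9) = c) ∧
    (∀ c, c ≠ 6 → ((findEigenvalue code).run Γ σ).mem c = σ.mem c) ∧
    ((findEigenvalue code).run Γ σ).var 1 = i from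
    ⟨fun hpos c hc => h.1 hpos c hc (code c).2, h.2⟩
  refine run_iterate_induction (fun g τ => (0 < N → ∀ c, IsNilpotent (A - algebraMap F _ c) →
      encode code c < g → decode code (τ.var 9) = c) ∧
    (∀ c, c ≠ 6 → τ.mem c = σ.mem c) ∧ τ.var 1 = i) hq ?_ ?_
  · exact ⟨fun _ c _ h => absurd h (Nat.not_lt_zero _), fun _ _ => rfl, hi⟩
  · rintro g hg τ ⟨h2, h3, h4⟩
    obtain ⟨d, hd⟩ := code.surjective ⟨g, hg⟩
    have hg' : g = encode code d := by rw [encode, hd]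
    obtain ⟨h5, h6, h8⟩ := run_applyPower code hN hNN h1 A d
      ⟨Function.update τ.var 2 g, τ.mem⟩ (by simpa [h3] using h7) (by simpa using h4)
      (by simpa [h3] using hA) (by simp [hg', decode_encode])
    obtain ⟨υ, hυ⟩ : ∃ υ, υ = (applyPower code).run Γ ⟨Function.update τ.var 2 g, τ.mem⟩ :=
      ⟨_, rfl⟩
    rw [← hυ] at h5 h6 h8
    rw [run_seq, run_set, ← hυ]
    refine ⟨fun hpos c hc hcg => ?_, fun c hc => (h6 c hc).trans (h3 c hc), ?_⟩
    -- the vector in the array `6` vanishes iff `d` is the eigenvalue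
    · have hz : (anyNonzero code 2 6).eval Γ υ.mem υ.var = 0 ↔ d = c := by
        have he : (fun k : Fin N => if (k : ℕ) = 0 then (1 : F) else 0) ≠ 0 := by
          intro h
          simpa using congrFun h ⟨0, hpos⟩
        rw [← pow_mulVec_eq_zero_iff hc he, ← h5, (eval_anyNonzero code hN 6 _ _).2, funext_iff]
        simp only [vecAt, zero_add, Pi.zero_apply]
        exact ⟨fun h k => h k k.2, fun h k hk => h ⟨k, hk⟩⟩
      dsimp only
      rw [Function.update_self, Exp.eval]
      split_ifs with h
      · rw [← hz.mp h, Exp.eval, h8 2 (by norm_num)]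
        dsimp only
        rw [Function.update_self, hg', decode_encode]
      · rw [Exp.eval, h8 9 (by norm_num)]
        dsimp only
        rw [Function.update_of_ne (by norm_num)]
        refine h2 hpos c hc ?_
        have : encode code c ≠ g := by
          rintro h'
          refine h (hz.mpr (code.injective (Fin.ext ?_)))
          exact (h'.trans hg').symm
        omega
    · dsimp only
      rw [Function.update_of_ne (by norm_num), h8 1 (by norm_num)]
      dsimp only
      rw [Function.update_of_ne (by norm_num), h4]

/-- Subtract from each matrix in the rows of the array `3` its eigenvalue, if it is a scalar plus a
nilpotent matrix, and otherwise any scalar. -/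
noncomputable def subtractEigenvalues : Cmd :=
  .seq (identity code 7 2) (.iterate 3 1 (.seq (findEigenvalue code)
    (.fill 3 3 4 3 5 (.ifz (.neq (.var 4) (.var 1))
      (fop code (· - ·) (.get 3 (.entry 3 (.var 4) (.var 5)))
        (fop code (· * ·) (.var 9) (.get 7 (.var 5))))
      (.get 3 (.entry 3 (.var 4) (.var 5)))))))

/-- The scalar `γ i` is arbitrary if the matrix in the row `i` is not a scalar plus a nilpotent
matrix. -/
theorem run_subtractEigenvalues {Γ : Env} {N n : ℕ} (hN : Γ.par 2 = N) (hNN : Γ.par 3 = n)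
    (hn : n = N * N) (h1 : Γ.par 5 = 1) (hq : Γ.par 4 = q) (σ : Store) :
    ∃ γ : Fin n → F,
      (0 < N → ∀ (i : Fin n) c, IsNilpotent (matAt code (σ.mem 3) N (i * n) - algebraMap F _ c) →
        γ i = c) ∧
      ∀ i : Fin n, matAt code (((subtractEigenvalues code).run Γ σ).mem 3) N (i * n) =
        matAt code (σ.mem 3) N (i * n) - algebraMap F _ (γ i) := by
  suffices h : (∀ k l : Fin N, decode code (((subtractEigenvalues code).run Γ σ).mem 7 (k * N + l)) =
        if k = l then 1 else 0) ∧ ∀ i : Fin n, ∃ γ : F, (i : ℕ) < n →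
      (0 < N → ∀ c, IsNilpotent (matAt code (σ.mem 3) N (i * n) - algebraMap F _ c) → γ = c) ∧
      matAt code (((subtractEigenvalues code).run Γ σ).mem 3) N (i * n) =
        matAt code (σ.mem 3) N (i * n) - algebraMap F _ γ by
    choose γ hγ using h.2
    exact ⟨γ, fun hpos i => (hγ i i.2).1 hpos, fun i => (hγ i i.2).2⟩
  suffices h : (∀ k l : Fin N, decode code (((subtractEigenvalues code).run Γ σ).mem 7 (k * N + l)) =
        if k = l then 1 else 0) ∧ ∀ i : Fin n,
      ((i : ℕ) < n → ∃ γ : F,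
        (0 < N → ∀ c, IsNilpotent (matAt code (σ.mem 3) N (i * n) - algebraMap F _ c) → γ = c) ∧
        matAt code (((subtractEigenvalues code).run Γ σ).mem 3) N (i * n) =
          matAt code (σ.mem 3) N (i * n) - algebraMap F _ γ) ∧
      (n ≤ i → matAt code (((subtractEigenvalues code).run Γ σ).mem 3) N (i * n) =
        matAt code (σ.mem 3) N (i * n)) by
    refine ⟨h.1, fun i => ?_⟩
    obtain ⟨γ, hγ⟩ := (h.2 i).1 i.2
    exact ⟨γ, fun _ => hγ⟩
  rw [subtractEigenvalues, run_seq]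
  refine run_iterate_induction (fun j τ => (∀ k l : Fin N, decode code (τ.mem 7 (k * N + l)) =
        if k = l then 1 else 0) ∧ ∀ i : Fin n,
      ((i : ℕ) < j → ∃ γ : F,
        (0 < N → ∀ c, IsNilpotent (matAt code (σ.mem 3) N (i * n) - algebraMap F _ c) → γ = c) ∧
        matAt code (τ.mem 3) N (i * n) =
          matAt code (σ.mem 3) N (i * n) - algebraMap F _ γ) ∧
      (j ≤ i → matAt code (τ.mem 3) N (i * n) =
        matAt code (σ.mem 3) N (i * n))) hNN ?_ ?_
  · refine ⟨fun k l => decode_identity code hN σ k l, fun i => ⟨fun h => absurd h (by omega),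
      fun _ => ?_⟩⟩
    rw [identity, run_fill_mem_of_ne (by norm_num)]
  · rintro j hj τ ⟨h2, h3⟩
    obtain ⟨h4, h5, h6⟩ := run_findEigenvalue (i := j) code hN (hNN.trans hn) h1 hq
      (matAt code (σ.mem 3) N (j * n)) ⟨Function.update τ.var 1 j, τ.mem⟩ h2
      (by simp)
      (by
        rw [← hn]
        exact (h3 ⟨j, hj⟩).2 le_rfl)
    obtain ⟨υ, hυ⟩ : ∃ υ, υ = (findEigenvalue code).run Γ ⟨Function.update τ.var 1 j, τ.mem⟩ :=
      ⟨_, rfl⟩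
    rw [← hυ] at h4 h5 h6
    rw [run_seq, ← hυ, run_fill_mem_of_ne (by norm_num), h5 7 (by norm_num)]
    refine ⟨h2, fun i => ?_⟩
    have hrow : ∀ k l : Fin N, matAt code (((Cmd.fill 3 3 4 3 5 (.ifz (.neq (.var 4) (.var 1))
        (fop code (· - ·) (.get 3 (.entry 3 (.var 4) (.var 5)))
          (fop code (· * ·) (.var 9) (.get 7 (.var 5))))
        (.get 3 (.entry 3 (.var 4) (.var 5))))).run Γ υ).mem 3) N (i * n) k l =
        if (i : ℕ) = j then matAt code (τ.mem 3) N (i * n) k l -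
          decode code (υ.var 9) * (if k = l then 1 else 0)
        else matAt code (τ.mem 3) N (i * n) k l := by
      intro k l
      have hkl : (k : ℕ) * N + l < n := by
        rw [hn, ← val_finProdFinEquiv]
        exact (finProdFinEquiv (k, l)).2
      rw [matAt, Matrix.of_apply, run_fill_mem hNN hNN i.2 hkl]
      simp only [Exp.eval, Exp.eval_neq_eq_zero]
      rw [Exp.eval_entry _ _ _ (by simp [Exp.Fresh]) (by simp [Exp.Fresh]),
        apply_ite (decode code), decode_fop, decode_fop]
      simp only [Exp.eval, hNN]
      rw [Exp.eval_entry _ _ _ (by simp [Exp.Fresh]) (by simp [Exp.Fresh])]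
      simp only [Exp.eval, hNN]
      simp [h5, h6, h2, matAt]
    by_cases hij : (i : ℕ) = j
    · refine ⟨fun _ => ⟨decode code (υ.var 9), ?_, ?_⟩, fun h => absurd h (by omega)⟩
      · rw [hij]
        exact fun hpos c hc => h4 hpos c hc
      · ext k l
        rw [hrow, if_pos hij, (h3 i).2 hij.ge]
        simp [Matrix.algebraMap_matrix_apply]
    · have : matAt code (((Cmd.fill 3 3 4 3 5 (.ifz (.neq (.var 4) (.var 1))
        (fop code (· - ·) (.get 3 (.entry 3 (.var 4) (.var 5)))
          (fop code (· * ·) (.var 9) (.get 7 (.var 5))))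
        (.get 3 (.entry 3 (.var 4) (.var 5))))).run Γ υ).mem 3) N (i * n) =
          matAt code (τ.mem 3) N (i * n) := by
        ext k l
        rw [hrow, if_neg hij]
      rw [this]
      exact ⟨fun h => (h3 i).1 (by omega), fun h => (h3 i).2 (by omega)⟩

end Field
end RAM

namespace RAM

section Field

variable {F : Type*} [Field F] {q : ℕ} (code : F ≃ Fin q)

/-- Replace the rows of the array `8` by vectors that span the images of these rows under the
matrices in the rows of the array `3`, as the orthogonal complement (array `9`) of the orthogonal
complement. -/
noncomputable def flagStep : Cmd :=
  .seq (identity code 9 2)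
  (.seq (.iterate 3 1 (.iterate 2 2 (.seq (.fill 4 2 4 5 5 (fsum code 2 6 (fop code (· * ·)
    (.get 3 (.entry 3 (.var 1) (.entry 2 (.var 4) (.var 6)))) (.get 8 (.entry 2 (.var 2) (.var 6))))))
    (eliminate code 9 2))))
  (.seq (identity code 8 2)
  (.iterate 2 2 (.seq (.fill 4 2 4 5 5 (.get 9 (.entry 2 (.var 2) (.var 4))))
    (eliminate code 8 2)))))

theorem run_flagStep {Γ : Env} {N n : ℕ} (hN : Γ.par 2 = N) (hNN : Γ.par 3 = n)
    (h1 : Γ.par 5 = 1) (σ : Store) :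
    rowSpan code (((flagStep code).run Γ σ).mem 8) N =
      imageSpan (fun i : Fin n => matAt code (σ.mem 3) N (i * n)) (rowSpan code (σ.mem 8) N) ∧
    ((flagStep code).run Γ σ).mem 3 = σ.mem 3 := by
  -- the rows of the array `9` span the orthogonal complement of the images
  have first : Imposes code Γ (.iterate 3 1 (.iterate 2 2 (.seq (.fill 4 2 4 5 5
      (fsum code 2 6 (fop code (· * ·) (.get 3 (.entry 3 (.var 1) (.entry 2 (.var 4) (.var 6))))
        (.get 8 (.entry 2 (.var 2) (.var 6)))))) (eliminate code 9 2)))) 9 N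
      (fun τ => τ.mem 3 = σ.mem 3 ∧ τ.mem 8 = σ.mem 8)
      {x | ∀ i < n, x ∈ {x | ∀ l < N, x ∈ {x |
        (matAt code (σ.mem 3) N (i * n)).mulVec (vecAt code (σ.mem 8) N (l * N)) ⬝ᵥ x = 0}}} := by
    refine Imposes.iterate code hNN (fun τ i h => h) fun i hi => ?_
    refine Imposes.iterate code hN (fun τ l h => ⟨h.1, by simpa using h.2⟩) fun l hl => ?_
    refine Imposes.fill_eliminate code _ hN h1 (by norm_num) (by norm_num) ?_ ?_
    · rintro τ τ' hv hm ⟨⟨⟨h2, h3⟩, h4⟩, h5⟩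
      exact ⟨⟨⟨by rw [hm 3 (by norm_num) (by norm_num) (by norm_num), h2],
        by rw [hm 8 (by norm_num) (by norm_num) (by norm_num), h3]⟩,
        by rw [hv 1 (by norm_num), h4]⟩, by rw [hv 2 (by norm_num), h5]⟩
    · rintro τ ⟨⟨⟨h2, h3⟩, h4⟩, h5⟩
      funext k
      rw [vecAt, zero_add, run_fill_mem_one hN h1 k.2,
        decode_fsum code hN _ _ (by simp [fop, Exp.Fresh, Exp.entry, Exp.mulPar]), Matrix.mulVec,
        dotProduct]
      refine Finset.sum_congr rfl fun r _ => ?_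
      rw [decode_fop]
      simp only [Exp.eval]
      rw [Exp.eval_entry _ _ _ (by simp [Exp.Fresh]) (by simp [Exp.Fresh]),
        Exp.eval_entry _ _ _ (by simp [Exp.Fresh]) (by simp [Exp.Fresh]),
        Exp.eval_entry _ _ _ (by simp [Exp.Fresh]) (by simp [Exp.Fresh])]
      simp only [Exp.eval]
      simp [hN, hNN, h2, h3, h4, h5, matAt, vecAt]
  rw [flagStep, run_seq, run_seq, run_seq]
  obtain ⟨τ₁, hτ₁⟩ : ∃ τ, τ = (identity code 9 2).run Γ σ := ⟨_, rfl⟩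
  obtain ⟨⟨h2, -⟩, h4⟩ := first τ₁ (by
    rw [hτ₁, identity]
    exact ⟨run_fill_mem_of_ne (by norm_num), run_fill_mem_of_ne (by norm_num)⟩)
  rw [← hτ₁]
  have htop : rowSpan code (τ₁.mem 9) N = ⊤ := by rw [hτ₁, rowSpan_identity code hN]
  rw [htop] at h4
  revert h2 h4
  generalize (Cmd.run Γ _ τ₁ : Store) = τ₂
  intro h4 h2
  -- the rows of the array `8` span the orthogonal complement of those of the array `9`
  have second : Imposes code Γ (.iterate 2 2 (.seq (.fill 4 2 4 5 5
      (.get 9 (.entry 2 (.var 2) (.var 4)))) (eliminate code 8 2))) 8 N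
      (fun τ => τ.mem 3 = σ.mem 3 ∧ τ.mem 9 = τ₂.mem 9)
      {x | ∀ l < N, x ∈ {x | vecAt code (τ₂.mem 9) N (l * N) ⬝ᵥ x = 0}} := by
    refine Imposes.iterate code hN (fun τ l h => h) fun l hl => ?_
    refine Imposes.fill_eliminate code _ hN h1 (by norm_num) (by norm_num) ?_ ?_
    · rintro τ τ' hv hm ⟨⟨h5, h6⟩, h7⟩
      exact ⟨⟨by rw [hm 3 (by norm_num) (by norm_num) (by norm_num), h5],
        by rw [hm 9 (by norm_num) (by norm_num) (by norm_num), h6]⟩,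
        by rw [hv 2 (by norm_num), h7]⟩
    · rintro τ ⟨⟨h5, h6⟩, h7⟩
      funext k
      rw [vecAt, zero_add, run_fill_mem_one hN h1 k.2]
      simp only [Exp.eval]
      rw [Exp.eval_entry _ _ _ (by simp [Exp.Fresh]) (by simp [Exp.Fresh])]
      simp only [Exp.eval]
      simp [hN, h6, h7, vecAt]
  obtain ⟨⟨h5, h6⟩, h7⟩ := second ((identity code 8 2).run Γ τ₂) (by
    rw [identity]
    exact ⟨(run_fill_mem_of_ne (by norm_num)).trans h2, run_fill_mem_of_ne (by norm_num)⟩)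
  refine ⟨?_, h5⟩
  ext y
  rw [h7, rowSpan_identity code hN, rowSpan, imageSpan_span, mem_span_of_dotProduct]
  simp only [Submodule.mem_top, true_and, Set.mem_ofPred_eq]
  constructor
  · intro h x hx
    have hx' : x ∈ rowSpan code (τ₂.mem 9) N := by
      rw [h4]
      refine ⟨Submodule.mem_top, fun i hi l hl => ?_⟩
      rw [Set.mem_ofPred_eq, dotProduct_comm]
      exact hx _ ⟨⟨i, hi⟩, ⟨l, hl⟩, rfl⟩
    rw [dotProduct_comm]
    refine (mem_span_of_dotProduct _ x).mp hx' y ?_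
    rintro _ ⟨l, rfl⟩
    rw [dotProduct_comm]
    exact h l l.2
  · intro h l hl
    refine h _ ?_
    have hx' : vecAt code (τ₂.mem 9) N (l * N) ∈ rowSpan code (τ₂.mem 9) N :=
      Submodule.subset_span ⟨⟨l, hl⟩, rfl⟩
    rw [h4] at hx'
    rintro _ ⟨i, j, rfl⟩
    rw [dotProduct_comm]
    exact hx'.2 i i.2 j j.2

/-- Compute the image of the whole space under all products of `N` of the matrices in the rows of
the array `3`. -/
noncomputable def flag : Cmd :=
  .seq (identity code 8 2) (.iterate 2 10 (flagStep code))

theorem run_flag {Γ : Env} {N n : ℕ} (hN : Γ.par 2 = N) (hNN : Γ.par 3 = n)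
    (h1 : Γ.par 5 = 1) (σ : Store) :
    rowSpan code (((flag code).run Γ σ).mem 8) N =
      (imageSpan fun i : Fin n => matAt code (σ.mem 3) N (i * n))^[N] ⊤ := by
  rw [flag, run_seq]
  refine (run_iterate_induction (fun j τ => rowSpan code (τ.mem 8) N =
      (imageSpan fun i : Fin n => matAt code (σ.mem 3) N (i * n))^[j] ⊤ ∧
      τ.mem 3 = σ.mem 3) hN ?_ ?_).1
  · refine ⟨rowSpan_identity code hN σ, ?_⟩
    rw [identity, run_fill_mem_of_ne (by norm_num)]
  · rintro j _ τ ⟨h2, h3⟩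
    obtain ⟨h4, h5⟩ := run_flagStep code hN hNN h1 ⟨Function.update τ.var 10 j, τ.mem⟩
    refine ⟨?_, h5.trans h3⟩
    rw [h4, Function.iterate_succ_apply', ← h2]
    dsimp only
    rw [h3]

/-- The value is `1` if the first `par b` entries of the array `a` are the zero of the field, and
otherwise `0`. -/
noncomputable def allZero (b : Fin 8) (a : ℕ) : Exp := .sub (.const 1) (anyNonzero code b a)

theorem eval_allZero {Γ : Env} {b : Fin 8} {N a : ℕ} (hb : Γ.par b = N * N) (m : ℕ → ℕ → ℕ)
    (ρ : ℕ → ℕ) : ((allZero code b a).eval Γ m ρ = 1 ↔ rowSpan code (m a) N = ⊥) ∧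
      (allZero code b a).eval Γ m ρ ≤ 1 := by
  obtain ⟨h1, h2⟩ := eval_anyNonzero code hb a m ρ
  refine ⟨?_, Nat.sub_le _ _⟩
  have : rowSpan code (m a) N = ⊥ ↔ ∀ i < N * N, decode code (m a i) = 0 := by
    rw [rowSpan, Submodule.span_eq_bot]
    constructor
    · intro h i hi
      obtain ⟨⟨k, l⟩, hkl⟩ := finProdFinEquiv.surjective ⟨i, hi⟩
      have := congrFun (h _ ⟨k, rfl⟩) l
      simp only [vecAt, ← val_finProdFinEquiv, hkl] at this
      exact this
    · rintro h _ ⟨k, rfl⟩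
      funext l
      simp only [vecAt, ← val_finProdFinEquiv]
      exact h _ (Fin.is_lt _)
  rw [this, ← h2, allZero, Exp.eval, Exp.eval]
  omega

end Field
end RAM

/-! ### The endomorphism algebra as a commutant of matrices -/

theorem IsScalarPlusNilpotent.map {K A B : Type*} [Field K] [Ring A] [Algebra K A] [Ring B]
    [Algebra K B] (h : IsScalarPlusNilpotent K A) (e : A ≃ₐ[K] B) : IsScalarPlusNilpotent K B := by
  intro x
  obtain ⟨c, hc⟩ := h (e.symm x)
  refine ⟨c, ?_⟩
  simpa using hc.map e

namespace QuiverRep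

variable {V : Type u} [Quiver.{v} V] [DecidableEq V] {K : Type k} [Field K]

/-- The endomorphism of the direct sum given by the map at an arrow. -/
def arrowEnd (ρ : QuiverRep.{u, v, w, k} V K) {i j : V} (e : i ⟶ j) :
    Module.End K (∀ i, ρ.space i) :=
  LinearMap.single K ρ.space j ∘ₗ ρ.map e ∘ₗ LinearMap.proj i

/-- The projection to the vector space at a vertex. -/
def vertexEnd (ρ : QuiverRep.{u, v, w, k} V K) (i : V) : Module.End K (∀ i, ρ.space i) :=
  LinearMap.single K ρ.space i ∘ₗ LinearMap.proj i

/-- The endomorphism algebra is the commutant of the path algebra. -/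
theorem mem_endAlgebra_iff (ρ : QuiverRep.{u, v, w, k} V K)
    (a : Module.End K (∀ i, ρ.space i)) : a ∈ ρ.endAlgebra ↔
      (∀ i, Commute a (ρ.vertexEnd i)) ∧ ∀ (i j : V) (e : i ⟶ j), Commute a (ρ.arrowEnd e) := by
  constructor
  · rintro ⟨f, hf, ha⟩
    constructor
    · intro i
      refine LinearMap.ext fun x => funext fun j => ?_
      simp only [vertexEnd, Module.End.mul_apply, LinearMap.comp_apply, LinearMap.proj_apply,
        LinearMap.single_apply, ha]
      by_cases h : j = i
      · subst h; simp
      · simp [h]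
    · intro i j e
      refine LinearMap.ext fun x => funext fun l => ?_
      simp only [arrowEnd, Module.End.mul_apply, LinearMap.comp_apply, LinearMap.proj_apply,
        LinearMap.single_apply, ha]
      by_cases h : l = j
      · subst h
        simpa using LinearMap.congr_fun (hf i l e) (x i)
      · simp [h]
  · rintro ⟨hv, he⟩
    have hv' : ∀ (i : V) (x : ∀ i, ρ.space i), a x i = a (Pi.single i (x i)) i := by
      intro i x
      have := congrFun (LinearMap.congr_fun (hv i) x) i
      simpa [vertexEnd] using this.symm
    refine ⟨fun i => LinearMap.proj i ∘ₗ a ∘ₗ LinearMap.single K ρ.space i, ?_, fun x i => hv' i x⟩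
    intro i j e
    ext x
    have := congrFun (LinearMap.congr_fun (he i j e) (Pi.single i x)) j
    simpa [arrowEnd] using this

end QuiverRep

namespace MatrixRep

variable {F : Type k} [Field F] (π : MatrixRep F)

/-- The numbering of the basis vectors of the direct sum of all vector spaces, vertex by vertex. -/
def index : (Σ i, Fin (π.dim i)) ≃ Fin π.totalDim := finSigmaFinEquiv

/-- The direct sum of the vector spaces at all vertices as a space of column vectors. -/
def coordinates : (∀ j, π.toRep.space j) ≃ₗ[F] (Fin π.totalDim → F) where
  toFun x := fun t => (x ⟨(π.index.symm t).1⟩ : Fin (π.dim (π.index.symm t).1) → F)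
    (π.index.symm t).2
  map_add' _ _ := rfl
  map_smul' _ _ := rfl
  invFun y := fun j => fun a : Fin (π.dim j.index) => y (π.index ⟨j.index, a⟩)
  left_inv x := by
    funext ⟨j⟩ a
    exact congrArg (fun p : Σ i, Fin (π.dim i) => (x ⟨p.1⟩ : Fin (π.dim p.1) → F) p.2)
      (π.index.symm_apply_apply ⟨j, a⟩)
  right_inv y := by
    funext t
    exact congrArg y (π.index.apply_symm_apply t)

theorem coordinates_index (x : ∀ j, π.toRep.space j) (j : Fin π.quiver.numVertices)
    (a : Fin (π.dim j)) :
    π.coordinates x (π.index ⟨j, a⟩) = (x ⟨j⟩ : Fin (π.dim j) → F) a :=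
  congrArg (fun p : Σ i, Fin (π.dim i) => (x ⟨p.1⟩ : Fin (π.dim p.1) → F) p.2)
    (π.index.symm_apply_apply ⟨j, a⟩)

theorem finrank_space : Module.finrank F (∀ j, π.toRep.space j) = π.totalDim := by
  rw [π.coordinates.finrank_eq, Module.finrank_fin_fun]

/-- An entry of the matrix at an arrow, or `0` if the indices are too large. The indices are natural
numbers, since equal vertices need not have the same type of indices definitionally. -/
def entry (e : Fin π.quiver.numArrows) (a b : ℕ) : F :=
  if h : a < π.dim (π.quiver.tgt e) ∧ b < π.dim (π.quiver.src e) then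
    π.mat e ⟨a, h.1⟩ ⟨b, h.2⟩ else 0

/-- The map at an arrow, as a matrix on the direct sum. -/
def arrowMatrix (e : Fin π.quiver.numArrows) : Matrix (Fin π.totalDim) (Fin π.totalDim) F :=
  Matrix.of fun s t => if (π.index.symm s).1 = π.quiver.tgt e ∧
    (π.index.symm t).1 = π.quiver.src e then π.entry e (π.index.symm s).2 (π.index.symm t).2 else 0

theorem arrowMatrix_index (e : Fin π.quiver.numArrows) (i j : Fin π.quiver.numVertices)
    (a : Fin (π.dim i)) (b : Fin (π.dim j)) :
    π.arrowMatrix e (π.index ⟨i, a⟩) (π.index ⟨j, b⟩) =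
      if i = π.quiver.tgt e ∧ j = π.quiver.src e then π.entry e a b else 0 := by
  rw [arrowMatrix, Matrix.of_apply, Equiv.symm_apply_apply, Equiv.symm_apply_apply]

/-- The projection to the vector space at a vertex, as a matrix on the direct sum. -/
def vertexMatrix (i : Fin π.quiver.numVertices) : Matrix (Fin π.totalDim) (Fin π.totalDim) F :=
  Matrix.of fun s t => if s = t ∧ (π.index.symm s).1 = i then 1 else 0

/-- The endomorphisms of the direct sum as matrices. -/
def matrixEquiv :
    Module.End F (∀ j, π.toRep.space j) ≃ₐ[F] Matrix (Fin π.totalDim) (Fin π.totalDim) F :=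
  (π.coordinates.conjAlgEquiv F).trans LinearMap.toMatrixAlgEquiv'

/-- `π.matrixEquiv a` is the matrix of `a` in the chosen coordinates. -/
theorem matrixEquiv_eq_iff (a : Module.End F (∀ j, π.toRep.space j))
    (M : Matrix (Fin π.totalDim) (Fin π.totalDim) F) :
    π.matrixEquiv a = M ↔ ∀ x, M.mulVec (π.coordinates x) = π.coordinates (a x) := by
  rw [matrixEquiv, AlgEquiv.trans_apply, ← LinearMap.toMatrixAlgEquiv'.symm.injective.eq_iff,
    AlgEquiv.symm_apply_apply, LinearMap.ext_iff, ← π.coordinates.forall_congr_right]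
  refine forall_congr' fun x => ?_
  simp [eq_comm]

theorem matrixEquiv_vertexEnd (i : Fin π.quiver.numVertices) :
    π.matrixEquiv (π.toRep.vertexEnd ⟨i⟩) = π.vertexMatrix i := by
  rw [matrixEquiv_eq_iff]
  intro x
  funext s
  obtain ⟨⟨j, a⟩, rfl⟩ := π.index.surjective s
  rw [coordinates_index, Matrix.mulVec, dotProduct, Finset.sum_eq_single (π.index ⟨j, a⟩)]
  · rw [coordinates_index]
    simp only [vertexMatrix, Matrix.of_apply, Equiv.symm_apply_apply, true_and,
      QuiverRep.vertexEnd, LinearMap.comp_apply, LinearMap.proj_apply, LinearMap.single_apply]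
    by_cases h : j = i
    · subst h
      simp
    · have : (⟨j⟩ : π.quiver.Vertex) ≠ ⟨i⟩ := fun h' => h (congrArg QuiverData.Vertex.index h')
      rw [if_neg h, Pi.single_eq_of_ne this, zero_mul]
      rfl
  · intro t _ ht
    simp [vertexMatrix, ht.symm]
  · exact fun h => absurd (Finset.mem_univ _) h

theorem matrixEquiv_arrowEnd (e : Fin π.quiver.numArrows) :
    π.matrixEquiv (π.toRep.arrowEnd (i := ⟨π.quiver.src e⟩) (j := ⟨π.quiver.tgt e⟩)
      ⟨e, rfl, rfl⟩) = π.arrowMatrix e := by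
  rw [matrixEquiv_eq_iff]
  intro x
  funext s
  obtain ⟨⟨j, a⟩, rfl⟩ := π.index.surjective s
  rw [coordinates_index, Matrix.mulVec, dotProduct, ← π.index.sum_comp, Fintype.sum_sigma,
    Finset.sum_eq_single (π.quiver.src e)]
  · simp only [coordinates_index, arrowMatrix_index, and_true,
      QuiverRep.arrowEnd, LinearMap.comp_apply, LinearMap.proj_apply, LinearMap.single_apply]
    by_cases h : j = π.quiver.tgt e
    · subst h
      rw [Pi.single_eq_same]
      simp only [entry, Fin.is_lt, and_self, dite_true, if_true, Fin.eta]
      rfl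
    · have : (⟨j⟩ : π.quiver.Vertex) ≠ ⟨π.quiver.tgt e⟩ :=
        fun h' => h (congrArg QuiverData.Vertex.index h')
      rw [Pi.single_eq_of_ne this]
      simp only [h, if_false, zero_mul, Finset.sum_const_zero]
      rfl
  · intro i _ hi
    simp [arrowMatrix_index, hi]
  · exact fun h => absurd (Finset.mem_univ _) h

/-- The commutant of the matrices of all arrows and vertices. -/
def commutant : Subalgebra F (Matrix (Fin π.totalDim) (Fin π.totalDim) F) :=
  Subalgebra.centralizer F (Set.range π.vertexMatrix ∪ Set.range π.arrowMatrix)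

theorem mem_commutant_iff (X : Matrix (Fin π.totalDim) (Fin π.totalDim) F) :
    X ∈ π.commutant ↔ (∀ i, Commute X (π.vertexMatrix i)) ∧ ∀ e, Commute X (π.arrowMatrix e) := by
  rw [commutant, Subalgebra.mem_centralizer_iff]
  constructor
  · intro h
    exact ⟨fun i => (h _ (Or.inl ⟨i, rfl⟩)).symm, fun e => (h _ (Or.inr ⟨e, rfl⟩)).symm⟩
  · rintro ⟨hv, he⟩ _ (⟨i, rfl⟩ | ⟨e, rfl⟩)
    · exact (hv i).symm
    · exact (he e).symm

theorem isScalarPlusNilpotent_endAlgebra_iff :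
    IsScalarPlusNilpotent F π.toRep.endAlgebra ↔ IsScalarPlusNilpotent F π.commutant := by
  have h : π.toRep.endAlgebra.map (π.matrixEquiv : _ →ₐ[F] _) = π.commutant := by
    ext X
    obtain ⟨a, rfl⟩ := π.matrixEquiv.surjective X
    have : ∀ b, Commute (π.matrixEquiv a) (π.matrixEquiv b) ↔ Commute a b := by
      intro b
      exact commute_map_iff π.matrixEquiv.injective
    rw [mem_commutant_iff, Subalgebra.mem_map]
    trans a ∈ π.toRep.endAlgebra
    · constructor
      · rintro ⟨b, hb, hba⟩
        exact π.matrixEquiv.injective hba ▸ hb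
      · exact fun ha => ⟨a, ha, rfl⟩
    · rw [QuiverRep.mem_endAlgebra_iff]
      simp only [← matrixEquiv_vertexEnd, ← matrixEquiv_arrowEnd, this]
      constructor
      · exact fun h => ⟨fun i => h.1 _, fun e => h.2 _ _ _⟩
      · refine fun h => ⟨fun i => h.1 i.index, ?_⟩
        rintro ⟨i⟩ ⟨j⟩ ⟨e, hi, hj⟩
        obtain rfl : π.quiver.src e = i := hi
        obtain rfl : π.quiver.tgt e = j := hj
        exact h.2 e
  rw [← h]
  exact ⟨fun h => h.map (π.matrixEquiv.subalgebraMap _),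
    fun h => h.map (π.matrixEquiv.subalgebraMap _).symm⟩

end MatrixRep

/-! ### The decision procedure -/

/-- The entries of the `i`-th block of a concatenation of lists, where `L` gives the lengths of the
blocks. -/
theorem List.getD_flatMap_finRange {n : ℕ} (f : Fin n → List ℕ) (L : ℕ → ℕ)
    (hL : ∀ i : Fin n, L i = (f i).length) (i : Fin n) (j : ℕ) (hj : j < (f i).length) :
    ((List.finRange n).flatMap f).getD (∑ i' ∈ Finset.range i, L i' + j) 0 = (f i).getD j 0 := by
  induction n generalizing L with
  | zero => exact i.elim0
  | succ n ih =>
    rw [List.finRange_succ, List.flatMap_cons, List.flatMap_map]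
    cases i using Fin.cases with
    | zero => simpa using List.getD_append _ _ _ _ hj
    | succ i =>
      rw [Fin.val_succ, Finset.sum_range_succ', List.getD_append_right _ _ _ _ (by
        have := hL 0
        rw [Fin.val_zero] at this
        omega)]
      rw [← ih (fun i => f i.succ) (fun i => L (i + 1)) (fun i => hL i.succ) i hj]
      congr 1
      have := hL 0
      rw [Fin.val_zero] at this
      omega

theorem List.getD_ofFn {n : ℕ} {α : Type*} (f : Fin n → α) (i : Fin n) (d : α) :
    (List.ofFn f).getD i d = f i := by
  simp [List.getD]

namespace MatrixRep

open RAM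

variable {F : Type k} {q : ℕ} (code : F ≃ Fin q) (π : MatrixRep F)

/-- The parameters and the input for the program that decides absolute indecomposability: the
numbers of vertices and arrows, `N`, `N * N`, `q` and `1`, where `N` is the sum of the dimensions. -/
def env : Env where
  par := ![π.quiver.numVertices, π.quiver.numArrows, π.totalDim, π.totalDim * π.totalDim, q, 1, 0, 0]
  inp a := (π.initialState code).mem a

theorem env_dim (i : Fin π.quiver.numVertices) : (π.env code).inp 0 i = π.dim i :=
  List.getD_ofFn _ _ _

theorem env_src (e : Fin π.quiver.numArrows) : (π.env code).inp 1 e = π.quiver.src e :=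
  List.getD_ofFn (fun e => (π.quiver.src e : ℕ)) e 0

theorem env_tgt (e : Fin π.quiver.numArrows) : (π.env code).inp 2 e = π.quiver.tgt e :=
  List.getD_ofFn (fun e => (π.quiver.tgt e : ℕ)) e 0

/-- The number of the first basis vector of the vector space at a vertex. -/
def offset (i : ℕ) : ℕ := ∑ j ∈ Finset.range i, (π.env code).inp 0 j

theorem val_index (i : Fin π.quiver.numVertices) (a : Fin (π.dim i)) :
    (π.index ⟨i, a⟩ : ℕ) = π.offset code i + a := by
  refine (finSigmaFinEquiv_apply _).trans ?_
  rw [offset, Finset.sum_range]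
  congr 1
  refine Finset.sum_congr rfl fun j _ => ?_
  exact (π.env_dim code (Fin.castLE i.2.le j)).symm

/-- Put the vertex to which each basis vector belongs into the array `0`, and its number among the
basis vectors of this vertex into the array `1`. -/
def locate : Cmd :=
  .iterate 0 1
    (.seq (.fill 0 2 4 5 5 (.ifz (.sub (.add (.var 4) (.const 1)) (.var 0)) (.get 0 (.var 4))
      (.var 1)))
    (.seq (.fill 1 2 4 5 5 (.ifz (.sub (.add (.var 4) (.const 1)) (.var 0)) (.get 1 (.var 4))
      (.sub (.var 4) (.var 0))))
    (.set 0 (.add (.var 0) (.inp 0 (.var 1))))))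

/-- The arrays `0` and `1` contain what `locate` computes. -/
def Located (σ : Store) : Prop :=
  ∀ (i : Fin π.quiver.numVertices) (a : Fin (π.dim i)),
    σ.mem 0 (π.index ⟨i, a⟩) = i ∧ σ.mem 1 (π.index ⟨i, a⟩) = a

/-- The variable `0` is the number of the first basis vector of the vertex `var 1` of the loop: the
basis vectors before this number keep the vertex they have, the other ones are assigned to this
vertex, and those that belong to later vertices are corrected in later rounds. -/
theorem located_locate (σ : Store) (hσ : σ.var 0 = 0) :
    π.Located (locate.run (π.env code) σ) := by
  suffices h : ((locate.run (π.env code) σ).var 0 = π.offset code π.quiver.numVertices) ∧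
      ∀ (i : Fin π.quiver.numVertices) (a : Fin (π.dim i)), (i : ℕ) < π.quiver.numVertices →
        (locate.run (π.env code) σ).mem 0 (π.index ⟨i, a⟩) = i ∧
        (locate.run (π.env code) σ).mem 1 (π.index ⟨i, a⟩) = a from
    fun i a => h.2 i a i.2
  refine run_iterate_induction (fun j τ => τ.var 0 = π.offset code j ∧
    ∀ (i : Fin π.quiver.numVertices) (a : Fin (π.dim i)), (i : ℕ) < j →
      τ.mem 0 (π.index ⟨i, a⟩) = i ∧ τ.mem 1 (π.index ⟨i, a⟩) = a) rfl ?_ ?_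
  · exact ⟨hσ, fun i a h => absurd h (Nat.not_lt_zero _)⟩
  · rintro j hj τ ⟨h1, h2⟩
    rw [run_seq, run_seq, run_set]
    refine ⟨?_, fun i a hi => ?_⟩
    · rw [offset, Finset.sum_range_succ]
      simp [Exp.eval, Cmd.run, h1, offset]
    · have hlt := (π.index ⟨i, a⟩).2
      have hle : (i : ℕ) < j → (π.index ⟨i, a⟩ : ℕ) + 1 - π.offset code j = 0 := by
        intro hij
        have h3 : π.offset code (i + 1) ≤ π.offset code j :=
          Finset.sum_le_sum_of_subset (Finset.range_mono hij)
        rw [offset, Finset.sum_range_succ, env_dim] at h3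
        have h4 := π.val_index code i a
        rw [offset] at h4
        have := a.2
        omega
      have hge : (i : ℕ) = j → (π.index ⟨i, a⟩ : ℕ) + 1 - π.offset code j ≠ 0 ∧
          (π.index ⟨i, a⟩ : ℕ) - π.offset code j = a := by
        rintro rfl
        rw [π.val_index code]
        omega
      dsimp only
      rw [run_fill_mem_of_ne (by norm_num), run_fill_mem_one rfl rfl hlt,
        run_fill_mem_one rfl rfl hlt]
      simp only [Exp.eval]
      rcases Nat.lt_succ_iff_lt_or_eq.mp hi with h | h
      · have h5 := h2 i a h
        simp [Cmd.run, h1, hle h, h5]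
      · have h5 := hge h
        simp [Cmd.run, h1, h5, h]

theorem dim_le_totalDim (i : Fin π.quiver.numVertices) : π.dim i ≤ π.totalDim :=
  Finset.single_le_sum (f := π.dim) (fun _ _ => Nat.zero_le _) (Finset.mem_univ i)

/-- The position of the first entry of the matrix at an arrow. -/
def position (e : ℕ) : ℕ := ∑ j ∈ Finset.range e,
  (π.env code).inp 0 ((π.env code).inp 2 j) * (π.env code).inp 0 ((π.env code).inp 1 j)

variable [Field F]

/-- The input contains the entries of the matrices, arrow by arrow and row by row. -/
theorem env_entry (e : Fin π.quiver.numArrows) (a : Fin (π.dim (π.quiver.tgt e)))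
    (b : Fin (π.dim (π.quiver.src e))) :
    decode code ((π.env code).inp 3 (π.position code e + (a * π.dim (π.quiver.src e) + b))) =
      π.mat e a b := by
  have hrow : ∀ (e : Fin π.quiver.numArrows) (a : Fin (π.dim (π.quiver.tgt e))),
      ((List.finRange (π.dim (π.quiver.src e))).map fun j => (code (π.mat e a j) : ℕ)).length =
        π.dim (π.quiver.src e) := by simp
  have hlen : ∀ e : Fin π.quiver.numArrows,
      ((List.finRange (π.dim (π.quiver.tgt e))).flatMap fun i =>
        (List.finRange (π.dim (π.quiver.src e))).map fun j => (code (π.mat e i j) : ℕ)).length =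
        π.dim (π.quiver.tgt e) * π.dim (π.quiver.src e) := by
    intro e
    simp [List.length_flatMap]
  have key : (π.entries code).getD (π.position code e + (a * π.dim (π.quiver.src e) + b)) 0 =
      code (π.mat e a b) := by
    rw [entries, position, List.getD_flatMap_finRange _ _ (fun e => by
      rw [hlen, env_tgt, env_src, env_dim, env_dim]) e _ (by
      rw [hlen, ← val_finProdFinEquiv]
      exact (finProdFinEquiv (a, b)).2)]
    have : (a : ℕ) * π.dim (π.quiver.src e) =
        ∑ i' ∈ Finset.range a, (fun _ => π.dim (π.quiver.src e)) i' := by simp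
    rw [this, List.getD_flatMap_finRange _ _ (fun i => (hrow e i).symm) a b (by
      rw [hrow]
      exact b.2)]
    simp [List.getD]
  have h : (π.env code).inp 3 (π.position code e + (a * π.dim (π.quiver.src e) + b)) =
      encode code (π.mat e a b) := key
  rw [h, decode_encode]

/-- The entries of the matrix of the vertex `var 1`. -/
def vertexExp : Exp :=
  .ifz (.add (.neq (.var 4) (.var 5)) (.neq (.get 0 (.var 4)) (.var 1))) (lit code 1) (lit code 0)

theorem decode_vertexExp (σ : Store) (hσ : π.Located σ)
    (i : Fin π.quiver.numVertices) (hi : σ.var 1 = i) (s t : Fin π.totalDim) :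
    decode code ((vertexExp code).eval (π.env code) σ.mem
      (Function.update (Function.update σ.var 4 s) 5 t)) = π.vertexMatrix i s t := by
  obtain ⟨⟨j, a⟩, rfl⟩ := π.index.surjective s
  simp only [vertexExp, Exp.eval, Nat.add_eq_zero_iff, Exp.eval_neq_eq_zero, vertexMatrix,
    Matrix.of_apply, Equiv.symm_apply_apply, apply_ite (decode code), decode_lit]
  simp [(hσ j a).1, hi, Fin.val_inj]

/-- The entries of the matrix of the arrow `var 1`; the position of the first one in the input is
`var 0`. -/
def arrowExp : Exp :=
  .ifz (.add (.neq (.get 0 (.var 4)) (.inp 2 (.var 1))) (.neq (.get 0 (.var 5)) (.inp 1 (.var 1))))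
    (.inp 3 (.add (.var 0) (.add (.product (.get 1 (.var 4)) (.inp 0 (.inp 1 (.var 1))))
      (.get 1 (.var 5))))) (lit code 0)

theorem decode_arrowExp (σ : Store) (hσ : π.Located σ) (e : Fin π.quiver.numArrows)
    (he : σ.var 1 = e) (hp : σ.var 0 = π.position code e) (s t : Fin π.totalDim) :
    decode code ((arrowExp code).eval (π.env code) σ.mem
      (Function.update (Function.update σ.var 4 s) 5 t)) = π.arrowMatrix e s t := by
  obtain ⟨⟨i, a⟩, rfl⟩ := π.index.surjective s
  obtain ⟨⟨j, b⟩, rfl⟩ := π.index.surjective t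
  rw [arrowMatrix_index]
  simp only [arrowExp, Exp.eval, Nat.add_eq_zero_iff, Exp.eval_neq_eq_zero]
  rw [Exp.eval_product _ _ (by simp [Exp.Fresh]) (by simp [Exp.Fresh]) (by
    simp only [Exp.eval]
    simp only [Function.update_of_ne (show (4 : ℕ) ≠ 5 by norm_num), Function.update_self,
      (hσ i a).2]
    exact a.2.le.trans (π.dim_le_totalDim i)), apply_ite (decode code), decode_lit]
  simp only [Exp.eval]
  simp only [Function.update_of_ne (show (4 : ℕ) ≠ 5 by norm_num), Function.update_self,
    Function.update_of_ne (show (1 : ℕ) ≠ 5 by norm_num),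
    Function.update_of_ne (show (1 : ℕ) ≠ 4 by norm_num),
    Function.update_of_ne (show (0 : ℕ) ≠ 5 by norm_num),
    Function.update_of_ne (show (0 : ℕ) ≠ 4 by norm_num),
    (hσ i a).2, (hσ i a).1, (hσ j b).1, (hσ j b).2, he, hp, env_src, env_tgt, env_dim, Fin.val_inj]
  by_cases h : i = π.quiver.tgt e ∧ j = π.quiver.src e
  · obtain ⟨rfl, rfl⟩ := h
    simp [entry, env_entry]
  · simp [h]

/-- Compute a spanning set of the commutant of all vertices and arrows, in the rows of the
array `3`. -/
noncomputable def computeCommutant : Cmd :=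
  .seq (identity code 3 3)
  (.seq (.iterate 0 1 (.seq (.fill 2 2 4 2 5 (vertexExp code)) (commute code)))
  (.seq (.set 0 (.const 0))
  (.iterate 1 1 (.seq (.seq (.fill 2 2 4 2 5 (arrowExp code)) (commute code))
    (.set 0 (.add (.var 0) (.product (.inp 0 (.inp 2 (.var 1))) (.inp 0 (.inp 1 (.var 1))))))))))

theorem mem_rowSpan_computeCommutant (σ : Store) (hσ : π.Located σ)
    (x : Fin (π.totalDim * π.totalDim) → F) :
    x ∈ rowSpan code (((computeCommutant code).run (π.env code) σ).mem 3)
      (π.totalDim * π.totalDim) ↔ unflatten F π.totalDim x ∈ π.commutant := by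
  have hstable : ∀ σ σ' : Store, (∀ c, c ≠ 2 → c ≠ 3 → c ≠ 4 → c ≠ 5 → σ'.mem c = σ.mem c) →
      π.Located σ → π.Located σ' := by
    intro σ σ' h hσ i a
    rw [h 0 (by norm_num) (by norm_num) (by norm_num) (by norm_num),
      h 1 (by norm_num) (by norm_num) (by norm_num) (by norm_num)]
    exact hσ i a
  rw [mem_commutant_iff, computeCommutant, run_seq, run_seq, run_seq]
  obtain ⟨τ₁, hτ₁⟩ : ∃ τ, τ = (identity code 3 3).run (π.env code) σ := ⟨_, rfl⟩
  have hloc₁ : π.Located τ₁ := by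
    rw [hτ₁]
    exact hstable σ _ (fun c _ hc _ _ => run_fill_mem_of_ne hc) hσ
  have htop : rowSpan code (τ₁.mem 3) (π.totalDim * π.totalDim) = ⊤ := by
    rw [hτ₁]
    exact rowSpan_identity code rfl σ
  obtain ⟨τ₂, hτ₂⟩ : ∃ τ, τ = (Cmd.iterate 0 1 (.seq (.fill 2 2 4 2 5 (vertexExp code))
    (commute code))).run (π.env code) τ₁ := ⟨_, rfl⟩
  have h₂ : π.Located τ₂ ∧ ∀ x, x ∈ rowSpan code (τ₂.mem 3) (π.totalDim * π.totalDim) ↔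
      ∀ i : Fin π.quiver.numVertices, (i : ℕ) < π.quiver.numVertices →
        Commute (unflatten F π.totalDim x) (π.vertexMatrix i) := by
    rw [hτ₂]
    refine run_iterate_induction (fun j τ => π.Located τ ∧
      ∀ x, x ∈ rowSpan code (τ.mem 3) (π.totalDim * π.totalDim) ↔
      ∀ i : Fin π.quiver.numVertices, (i : ℕ) < j →
        Commute (unflatten F π.totalDim x) (π.vertexMatrix i)) rfl ?_ ?_
    · exact ⟨hloc₁, fun x => by simp [htop]⟩
    · rintro j hj τ ⟨hτ, hx⟩
      obtain ⟨h3, h4⟩ := imposes_fill_commute code (Γ := π.env code) (N := π.totalDim) rfl rfl rfl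
        (e := vertexExp code) (π.vertexMatrix ⟨j, hj⟩) (I := fun τ => π.Located τ ∧ τ.var 1 = j)
        (fun τ τ' hv hm h => ⟨hstable τ τ' hm h.1,
          (hv 1 (by norm_num) (by norm_num) (by norm_num)).trans h.2⟩)
        (fun τ h s t => π.decode_vertexExp code τ h.1 ⟨j, hj⟩ h.2 s t)
        ⟨Function.update τ.var 1 j, τ.mem⟩ ⟨hτ, by simp⟩
      refine ⟨h3.1, fun x => ?_⟩
      rw [h4, hx, Set.mem_ofPred_eq]
      constructor
      · rintro ⟨h5, h6⟩ i hi
        rcases Nat.lt_succ_iff_lt_or_eq.mp hi with h | h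
        · exact h5 i h
        · obtain rfl : i = ⟨j, hj⟩ := Fin.ext h
          exact h6
      · exact fun h => ⟨fun i hi => h i (by omega), h ⟨j, hj⟩ (Nat.lt_succ_self j)⟩
  rw [← hτ₁, ← hτ₂, run_set]
  have h₃ := run_iterate_induction (Γ := π.env code) (b := 1) (x := 1)
    (n := π.quiver.numArrows) (c := .seq (.seq (.fill 2 2 4 2 5 (arrowExp code)) (commute code))
    (.set 0 (.add (.var 0) (.product (.inp 0 (.inp 2 (.var 1))) (.inp 0 (.inp 1 (.var 1)))))))
    (σ := ⟨Function.update τ₂.var 0 ((Exp.const 0).eval (π.env code) τ₂.mem τ₂.var), τ₂.mem⟩)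
    (fun j τ => (π.Located τ ∧ τ.var 0 = π.position code j) ∧
      ∀ x, x ∈ rowSpan code (τ.mem 3) (π.totalDim * π.totalDim) ↔
      x ∈ rowSpan code (τ₂.mem 3) (π.totalDim * π.totalDim) ∧
        ∀ e : Fin π.quiver.numArrows, (e : ℕ) < j →
          Commute (unflatten F π.totalDim x) (π.arrowMatrix e)) rfl ?_ ?_
  · rw [h₃.2, h₂.2]
    exact and_congr ⟨fun h i => h i i.2, fun h i _ => h i⟩ ⟨fun h e => h e e.2, fun h e _ => h e⟩
  · exact ⟨⟨h₂.1, by simp [position, Exp.eval]⟩, fun x => by simp⟩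
  · rintro j hj τ ⟨⟨hτ, hp⟩, hx⟩
    obtain ⟨h3, h4⟩ := imposes_fill_commute code (Γ := π.env code) (N := π.totalDim) rfl rfl rfl
      (e := arrowExp code) (π.arrowMatrix ⟨j, hj⟩)
      (I := fun τ => π.Located τ ∧ τ.var 1 = j ∧ τ.var 0 = π.position code j)
      (fun τ τ' hv hm h => ⟨hstable τ τ' hm h.1,
        (hv 1 (by norm_num) (by norm_num) (by norm_num)).trans h.2.1,
        (hv 0 (by norm_num) (by norm_num) (by norm_num)).trans h.2.2⟩)
      (fun τ h s t => π.decode_arrowExp code τ h.1 ⟨j, hj⟩ h.2.1 h.2.2 s t)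
      ⟨Function.update τ.var 1 j, τ.mem⟩ ⟨hτ, by simp, by simpa using hp⟩
    rw [run_seq, run_set]
    refine ⟨⟨h3.1, ?_⟩, fun x => ?_⟩
    · dsimp only
      have htgt := π.env_tgt code ⟨j, hj⟩
      have hdim := π.env_dim code (π.quiver.tgt ⟨j, hj⟩)
      dsimp only at htgt
      rw [Function.update_self, Exp.eval, Exp.eval_product _ _ (by simp [Exp.Fresh])
        (by simp [Exp.Fresh]) (by
          simp only [Exp.eval, h3.2.1, htgt, hdim]
          exact π.dim_le_totalDim _)]
      simp only [Exp.eval, h3.2.1, h3.2.2]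
      rw [position, position, Finset.sum_range_succ]
    · dsimp only
      rw [h4, hx, Set.mem_ofPred_eq, and_assoc]
      refine and_congr_right fun _ => ?_
      constructor
      · rintro ⟨h5, h6⟩ i hi
        rcases Nat.lt_succ_iff_lt_or_eq.mp hi with h | h
        · exact h5 i h
        · obtain rfl : i = ⟨j, hj⟩ := Fin.ext h
          exact h6
      · exact fun h => ⟨fun i hi => h i (by omega), h ⟨j, hj⟩ (Nat.lt_succ_self j)⟩

end MatrixRep

namespace MatrixRep

open RAM

variable {F : Type k} {q : ℕ} (code : F ≃ Fin q) (π : MatrixRep F)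

theorem _root_.RAM.Represents.setPar {Γ : Env} {σ : Store} {s : State} (h : Represents Γ σ s)
    (b : Fin 8) (n : ℕ) :
    Represents { Γ with par := Function.update Γ.par b n } σ (s.setReg b n) where
  par c := by
    simp [setReg_reg, Function.update_apply, Fin.val_inj, h.par]
  var x := by rw [setReg_reg, if_neg (par_ne_varReg b x).symm, h.var]
  inp a := h.inp a
  mem a := h.mem a

/-- Initially only the numbers of vertices and arrows are known among the parameters. -/
theorem represents_initialState :
    Represents ⟨![π.quiver.numVertices, π.quiver.numArrows, 0, 0, 0, 0, 0, 0], (π.env code).inp⟩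
      ⟨fun _ => 0, fun _ _ => 0⟩ (π.initialState code) where
  par b := by fin_cases b <;> rfl
  var x := by
    rw [varReg, add_comm]
    rfl
  inp a := rfl
  mem a := by
    rw [add_comm]
    rfl

/-- Compute the parameters: the sum of the dimensions and its square by loops, `q` and `1` as
constants. -/
def setParameters : Program :=
  .seq ((Exp.fold 0 1 2 (.const 0) (.add (.var 2) (.inp 0 (.var 1)))).compile 0)
  (.seq (.copy 2 (tmpReg 0))
  (.seq ((Exp.fold 2 1 2 (.const 0) (.add (.var 2) (.par 2))).compile 0)
  (.seq (.copy 3 (tmpReg 0))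
  (.seq (.const 4 q)
  (.const 5 1)))))

theorem exec_setParameters : ∃ s t, Exec (setParameters (q := q)) (π.initialState code) s t ∧
    t ≤ 24 + 10 * π.quiver.numVertices + 9 * π.totalDim ∧
    Represents (π.env code) ⟨fun _ => 0, fun _ _ => 0⟩ s := by
  have h₀ := π.represents_initialState code
  obtain ⟨s₁, t₁, x₁, ht₁, hv₁, ha₁⟩ := Exp.exec_compile _
    (Exp.fold 0 1 2 (.const 0) (.add (.var 2) (.inp 0 (.var 1)))) 0 _ _ h₀
  have h₁ := (ha₁.represents h₀).setPar 2 (s₁.reg (tmpReg 0))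
  obtain ⟨s₂, t₂, x₂, ht₂, hv₂, ha₂⟩ := Exp.exec_compile _
    (Exp.fold 2 1 2 (.const 0) (.add (.var 2) (.par 2))) 0 _ _ h₁
  have h₂ := (((ha₂.represents h₁).setPar 3 (s₂.reg (tmpReg 0))).setPar 4 q).setPar 5 1
  have e₁ : s₁.reg (tmpReg 0) = π.totalDim := by
    rw [hv₁]
    simp only [Exp.eval, Function.update_self,
      Function.update_of_ne (show (1 : ℕ) ≠ 2 by norm_num)]
    rw [iterSteps_sum]
    change ∑ i ∈ Finset.range π.quiver.numVertices, _ = _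
    rw [Finset.sum_range]
    exact Finset.sum_congr rfl fun i _ => π.env_dim code i
  have e₂ : s₂.reg (tmpReg 0) = π.totalDim * π.totalDim := by
    rw [hv₂]
    simp only [Exp.eval, Function.update_self]
    rw [iterSteps_sum, e₁]
    simp
  rw [e₁, e₂] at h₂
  refine ⟨_, _, .seq x₁ (.seq (.copy _ _ _) (.seq x₂ (.seq (.copy _ _ _) (.seq (.const _ _ _)
    (.const _ _ _))))), ?_, ?_⟩
  · simp [Exp.cost, e₁] at ht₁ ht₂
    omega
  · rw [e₂]
    convert h₂ using 1
    · change Env.mk (π.env code).par (π.env code).inp = _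
      congr 1
      funext b
      fin_cases b <;> rfl
    · rfl

variable [Field F]

/-- Decide whether each endomorphism is a scalar plus a nilpotent one. If so, the array `8` is zero
at the end. -/
noncomputable def decisionCmd : Cmd :=
  .seq locate (.seq (computeCommutant code) (.seq (subtractEigenvalues code) (flag code)))

theorem rowSpan_decisionCmd (σ : Store) (hσ : σ.var 0 = 0) :
    rowSpan code (((decisionCmd code).run (π.env code) σ).mem 8) π.totalDim = ⊥ ↔
      IsScalarPlusNilpotent F π.commutant := by
  rw [decisionCmd, run_seq, run_seq, run_seq]
  have hspan := π.mem_rowSpan_computeCommutant code _ (π.located_locate code σ hσ)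
  revert hspan
  generalize (computeCommutant code).run (π.env code) (locate.run (π.env code) σ) = τ
  intro hspan
  obtain ⟨γ, hγ, hmem⟩ := run_subtractEigenvalues code (Γ := π.env code) (N := π.totalDim)
    (n := π.totalDim * π.totalDim) rfl rfl rfl rfl rfl τ
  rw [run_flag code (Γ := π.env code) (N := π.totalDim) (n := π.totalDim * π.totalDim) rfl rfl rfl]
  simp only [hmem]
  refine (isScalarPlusNilpotent_iff_iterate π.commutant _ ?_ γ hγ).symm
  have hmap : Submodule.span F (Set.range fun i : Fin (π.totalDim * π.totalDim) =>
      matAt code (τ.mem 3) π.totalDim (i * (π.totalDim * π.totalDim))) =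
      (rowSpan code (τ.mem 3) (π.totalDim * π.totalDim)).map
        (unflatten F π.totalDim : _ →ₗ[F] _) := by
    rw [rowSpan, Submodule.map_span, ← Set.range_comp]
    congr 2
    funext i
    exact (unflatten_vecAt code _ _ _).symm
  ext X
  rw [hmap, Submodule.mem_map_equiv, hspan, LinearEquiv.apply_symm_apply,
    Subalgebra.mem_toSubmodule]

theorem outer_decisionCmd : (decisionCmd code).Outer := by
  simp [decisionCmd, locate, computeCommutant, subtractEigenvalues, flag, flagStep, findEigenvalue,
    applyPower, identity, eliminate, commute, vertexExp, arrowExp, anyNonzero, fsum, fop, fne, lit,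
    Exp.product, Exp.neq, Exp.entry, Exp.mulPar, Cmd.Outer, Cmd.Inner, Exp.Inner]

theorem inner_allZero {b : Fin 8} (hb : 2 ≤ b) (a : ℕ) : (allZero code b a).Inner := by
  simp [allZero, anyNonzero, fne, Exp.Inner, hb]

/-- The compiled program decides in polynomial time, up to a linear factor for the quiver, whether
the endomorphism algebra is scalar plus nilpotent. In the running time bound `X * X + X + q + 1` is
an upper bound for all parameters but the first two. -/
theorem exists_program : ∃ (P : Program) (p : Polynomial ℕ), ∀ π : MatrixRep F,
    ∃ (s : State) (t : ℕ), Exec P (π.initialState code) s t ∧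
      t ≤ p.eval π.totalDim * (1 + π.quiver.numVertices + π.quiver.numArrows) ∧
      (IsScalarPlusNilpotent F π.commutant → s.reg 0 = 1) ∧
      (¬ IsScalarPlusNilpotent F π.commutant → s.reg 0 = 0) := by
  refine ⟨.seq (setParameters (q := q)) (.seq ((decisionCmd code).compile 0)
    (.seq ((allZero code 3 8).compile 0) (.copy 0 (tmpReg 0)))),
    25 + 9 * Polynomial.X + ((decisionCmd code).coeff : Polynomial ℕ) *
      (Polynomial.X * Polynomial.X + Polynomial.X + (q : Polynomial ℕ) + 1 + 1) ^
        (decisionCmd code).degree +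
      ((allZero code 3 8).coeff : Polynomial ℕ) *
      (Polynomial.X * Polynomial.X + Polynomial.X + (q : Polynomial ℕ) + 1 + 1) ^
        (allZero code 3 8).degree, fun π => ?_⟩
  obtain ⟨s₁, t₁, x₁, ht₁, h₁⟩ := π.exec_setParameters code
  obtain ⟨s₂, t₂, x₂, ht₂, h₂, -⟩ := (decisionCmd code).realizes _ 0 _ s₁ h₁
  obtain ⟨s₃, t₃, x₃, ht₃, hv₃, ha₃⟩ := (allZero code 3 8).exec_compile _ 0 _ s₂ h₂
  refine ⟨_, _, .seq x₁ (.seq x₂ (.seq x₃ (.copy _ _ _))), ?_, ?_⟩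
  · have hB : ∀ b : Fin 8, 2 ≤ b → (π.env code).par b ≤
        π.totalDim * π.totalDim + π.totalDim + q + 1 := by
      intro b hb
      fin_cases b <;> simp [env] at hb ⊢ <;> omega
    have c₂ := ht₂.trans ((decisionCmd code).cost_le_of_outer hB (outer_decisionCmd code))
    have c₃ := ht₃.trans ((allZero code 3 8).cost_le hB (inner_allZero code (by decide) 8))
    change t₂ ≤ _ * (1 + π.quiver.numVertices + π.quiver.numArrows) at c₂
    simp only [Polynomial.eval_add, Polynomial.eval_mul, Polynomial.eval_pow, Polynomial.eval_X,
      Polynomial.eval_natCast, Polynomial.eval_one, Polynomial.eval_ofNat, Nat.cast_id]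
    revert c₂ c₃
    generalize (decisionCmd code).coeff * _ ^ (decisionCmd code).degree = K
    generalize (allZero code 3 8).coeff * _ ^ (allZero code 3 8).degree = K'
    intro c₂ c₃
    have d₁ : π.quiver.numVertices ≤ π.quiver.numVertices + π.quiver.numArrows := by omega
    calc _ ≤ 25 + 10 * π.quiver.numVertices + 9 * π.totalDim +
          K * (1 + π.quiver.numVertices + π.quiver.numArrows) + K' := by omega
      _ ≤ _ := by nlinarith
  · obtain ⟨h₄, h₅⟩ := eval_allZero code (Γ := π.env code) (b := 3) (N := π.totalDim) (a := 8) rfl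
      ((decisionCmd code).run (π.env code) ⟨fun _ => 0, fun _ _ => 0⟩).mem
      ((decisionCmd code).run (π.env code) ⟨fun _ => 0, fun _ _ => 0⟩).var
    rw [π.rowSpan_decisionCmd code ⟨fun _ => 0, fun _ _ => 0⟩ rfl] at h₄
    rw [setReg_reg, if_pos rfl, hv₃]
    refine ⟨h₄.mpr, fun h => ?_⟩
    have := mt h₄.mp h
    omega

end MatrixRep

theorem theorem2 {F : Type*} [Field F] [Finite F] (code : F ≃ Fin (Nat.card F)) :
    (∃ (P : RAM.Program) (p : Polynomial ℕ), ∀ π : MatrixRep F,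
      ∃ (s : RAM.State) (t : ℕ), RAM.Exec P (π.initialState code) s t ∧
        t ≤ p.eval π.totalDim * (1 + π.quiver.numVertices + π.quiver.numArrows) ∧
        (π.toRep.IsAbsolutelyIndecomposable → s.reg 0 = 1) ∧
        (¬ π.toRep.IsAbsolutelyIndecomposable → s.reg 0 = 0)) ∧
    (∀ (π : MatrixRep F) (m : ℕ) (a : Module.Basis (Fin m) F π.toRep.endAlgebra),
      π.toRep.IsAbsolutelyIndecomposable ↔
        (∀ i, ∃ γ : F, (-(a i : Module.End F (∀ j, π.toRep.space j))).charpoly =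
          (Polynomial.X + Polynomial.C γ) ^ π.totalDim) ∧
        ∃ n, LieModule.lowerCentralSeries F π.toRep.endAlgebra π.toRep.endAlgebra n = ⊥) := by
  constructor
  · simp only [QuiverRep.isAbsolutelyIndecomposable_iff,
      MatrixRep.isScalarPlusNilpotent_endAlgebra_iff]
    exact MatrixRep.exists_program code
  · intro π m a
    rw [← π.finrank_space]
    exact π.toRep.isAbsolutelyIndecomposable_iff_charpoly a
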